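/- Let $\Omega=(a,b)$ be a bounded interval, $P\in\{a,b\}$ one of its endpoints, $d=b-a$, and for $Q\in\Omega$ let $r=|Q-P|$; functions on $\Omega$ are written as functions of $r\in(0,d)$. Let $0<\alpha<1$, $0\le\sigma<1$. In the complex space $L_2(\Omega)$ let $$(\mathfrak I^{\sigma}_{0+}f)(r)=\frac1{\Gamma(\sigma)}\int_0^r\frac{f(t)}{(r-t)^{1-\sigma}}\,dt\quad(\sigma>0),\qquad \mathfrak I^{0}_{0+}=I,$$ and let $\mathfrak D^{\alpha}_{d-}f$ be the $L_2$-limit, as $\varepsilon\to0+$, of the truncated derivatives $$(\mathfrak D^{\alpha}_{d-,\varepsilon}f)(r)=\frac{\alpha}{\Gamma(1-\alpha)}\int_{r+\varepsilon}^{d}\frac{f(r)-f(t)}{(t-r)^{\alpha+1}}\,dt+\frac{f(r)}{\Gamma(1-\alpha)}(d-r)^{-\alpha}\ \ (0\le r\le d-\varepsilon),$$ $$(\mathfrak D^{\alpha}_{d-,\varepsilon}f)(r)=\frac{f(r)}{\alpha}\Big(\frac1{\varepsilon^{\alpha}}-\frac1{(d-r)^{\alpha}}\Big)\ \ (d-\varepsilon<r\le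 d).$$ For $a^{11}\in C^2(\bar\Omega)$ complex-valued with $\mathrm{Re}\,a^{11}\ge\gamma_a>0$ on $\Omega$ and $\rho\in L_\infty(\Omega)$ let $$Lu=-(a^{11}u')'+\mathfrak I^{\sigma}_{0+}\,\rho\,\mathfrak D^{\alpha}_{d-}u,\qquad \mathrm D(L)=H^2(\Omega)\cap H^1_0(\Omega).$$ An operator $W$ in a complex Hilbert space $\mathfrak H$ belongs to the class $\mathfrak G_\alpha$ if $$W=J^{*}GJ+FJ^{\alpha}$$ (with equality of domains, products and sums being taken on their natural domains) for some $J,G,F$ such that: $J$ is a densely defined m-accretive operator, i.e. $(J+\zeta)^{-1}\in\mathcal B(\mathfrak H)$ and $\|(J+\zeta)^{-1}\|\le(\mathrm{Re}\,\zeta)^{-1}$ for $\mathrm{Re}\,\zeta>0$; $J^{-1}$ is compact; $F\in\mathcal B(\mathfrak H)$; $G$ is bounded with $\mathrm D(G)\supset\mathrm R(J)$ and $\mathrm{Re}(Gf,f)\ge\gamma_G\|f\|^2$ for $f\in\mathrm D(G)$, where $$\gamma_G>C_\alpha\|J^{-1}\|\,\|F\|,\quad \gamma_G>0,\quad C_\alpha=2\alpha^{-1}\|J^{-1}\|+(1-\alpha)^{-1}.$$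 Here $J^\alpha$ is the closure of the operator $\frac{\sin\alpha\pi}{\pi}\int_0^\infty\lambda^{\alpha-1}(\lambda+J)^{-1}J\,d\lambda$ on $\mathrm D(J)$. **Corollary.** If $\gamma_a$ is sufficiently large in comparison with $\|\rho\|_{L_\infty}$, namely if $\gamma_a>K\|\rho\|_{L_\infty}$ for a constant $K>0$ that depends only on $a,b,P,\alpha,\sigma$, then $L$ is well defined on all of $H^2(\Omega)\cap H^1_0(\Omega)$ and $L\in\mathfrak G_\alpha$. -/

import Mathlib

open MeasureTheory Set Filter Topology
open scoped ContDiff ENNReal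

noncomputable section

namespace FracOp

/-! ### Operators in a Hilbert space and the class `𝔊_α` -/

section Abstract

variable {H : Type*} [NormedAddCommGroup H] [InnerProductSpace ℂ H]

/-- The operator whose graph is a given linear and single-valued relation. -/
def ofRel (R : H → H → Prop) (h0 : R 0 0)
    (hadd : ∀ f f' g g', R f g → R f' g' → R (f + f') (g + g'))
    (hsmul : ∀ (c : ℂ) f g, R f g → R (c • f) (c • g))
    (huniq : ∀ f g g', R f g → R f g' → g = g') : H →ₗ.[ℂ] H where
  domain :=
    { carrier := {f | ∃ g, R f g}
      zero_mem' := ⟨0, h0⟩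
      add_mem' := by
        rintro f f' ⟨g, hg⟩ ⟨g', hg'⟩
        exact ⟨g + g', hadd _ _ _ _ hg hg'⟩
      smul_mem' := by
        rintro c f ⟨g, hg⟩
        exact ⟨c • g, hsmul _ _ _ hg⟩ }
  toFun :=
    { toFun := fun f => f.2.choose
      map_add' := by
        intro f f'
        exact huniq _ _ _ (f + f').2.choose_spec
          (hadd _ _ _ _ f.2.choose_spec f'.2.choose_spec)
      map_smul' := by
        intro c f
        exact huniq _ _ _ (c • f).2.choose_spec (hsmul _ _ _ f.2.choose_spec) }

theorem ofRel_mem {R : H → H → Prop} {h0 hadd hsmul huniq} {f : H} :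
    f ∈ (ofRel R h0 hadd hsmul huniq).domain ↔ ∃ g, R f g := Iff.rfl

theorem ofRel_spec {R : H → H → Prop} {h0 hadd hsmul huniq}
    (f : (ofRel R h0 hadd hsmul huniq).domain) :
    R f (ofRel R h0 hadd hsmul huniq f) := f.2.choose_spec

theorem ofRel_eq {R : H → H → Prop} {h0 hadd hsmul huniq}
    (f : (ofRel R h0 hadd hsmul huniq).domain) {g : H} (hg : R f g) :
    ofRel R h0 hadd hsmul huniq f = g := huniq _ _ _ (ofRel_spec f) hg

/-- The product `S T` of two operators, with its natural domain
`{f ∈ D(T) : T f ∈ D(S)}`. -/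
def mulP (S T : H →ₗ.[ℂ] H) : H →ₗ.[ℂ] H where
  domain :=
    { carrier := {f | ∃ h : f ∈ T.domain, T ⟨f, h⟩ ∈ S.domain}
      zero_mem' := by
        refine ⟨T.domain.zero_mem, ?_⟩
        rw [show T ⟨0, T.domain.zero_mem⟩ = 0 from T.map_zero]
        exact S.domain.zero_mem
      add_mem' := by
        rintro f f' ⟨h, hS⟩ ⟨h', hS'⟩
        refine ⟨T.domain.add_mem h h', ?_⟩
        rw [show T ⟨f + f', T.domain.add_mem h h'⟩ = T ⟨f, h⟩ + T ⟨f', h'⟩ from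
          T.map_add ⟨f, h⟩ ⟨f', h'⟩]
        exact S.domain.add_mem hS hS'
      smul_mem' := by
        rintro c f ⟨h, hS⟩
        refine ⟨T.domain.smul_mem c h, ?_⟩
        rw [show T ⟨c • f, T.domain.smul_mem c h⟩ = c • T ⟨f, h⟩ from T.map_smul c ⟨f, h⟩]
        exact S.domain.smul_mem c hS }
  toFun :=
    { toFun := fun f => S ⟨T ⟨f, f.2.choose⟩, f.2.choose_spec⟩
      map_add' := by
        intro f f'
        rw [← S.map_add]
        congr 1
        apply Subtype.ext
        exact T.map_add ⟨f, f.2.choose⟩ ⟨f', f'.2.choose⟩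
      map_smul' := by
        intro c f
        rw [RingHom.id_apply, ← S.map_smul]
        congr 1
        apply Subtype.ext
        exact T.map_smul c ⟨f, f.2.choose⟩ }

theorem mem_mulP_domain {S T : H →ₗ.[ℂ] H} {f : H} :
    f ∈ (mulP S T).domain ↔ ∃ h : f ∈ T.domain, T ⟨f, h⟩ ∈ S.domain := Iff.rfl

theorem mulP_apply {S T : H →ₗ.[ℂ] H} {f : H} (hf : f ∈ (mulP S T).domain)
    (h : f ∈ T.domain) (h' : T ⟨f, h⟩ ∈ S.domain) :
    mulP S T ⟨f, hf⟩ = S ⟨T ⟨f, h⟩, h'⟩ := rfl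

/-- `R = (J + ζ)⁻¹`, as a bounded operator defined on the whole space. -/
def IsResolvent (J : H →ₗ.[ℂ] H) (ζ : ℂ) (R : H →L[ℂ] H) : Prop :=
  (∀ f : J.domain, R (J f + ζ • (f : H)) = f) ∧
    ∀ g : H, ∃ h : R g ∈ J.domain, J ⟨R g, h⟩ + ζ • R g = g

/-- Densely defined m-accretive operators: `(J + ζ)⁻¹` is bounded, everywhere defined, and
`‖(J + ζ)⁻¹‖ ≤ (Re ζ)⁻¹` whenever `Re ζ > 0`. -/
def MAccretive (J : H →ₗ.[ℂ] H) : Prop :=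
  Dense (J.domain : Set H) ∧
    ∀ ζ : ℂ, 0 < ζ.re → ∃ R : H →L[ℂ] H, IsResolvent J ζ R ∧ ‖R‖ ≤ (ζ.re)⁻¹

open Classical in
/-- The operator `(J + ζ)⁻¹`, and `0` if it is not a bounded operator on the whole space. -/
def resolventOp (J : H →ₗ.[ℂ] H) (ζ : ℂ) : H →L[ℂ] H :=
  if h : ∃ R, IsResolvent J ζ R then h.choose else 0

/-- The integrand `t ^ (α - 1) (t + J)⁻¹ g` of the Balakrishnan formula. -/
def balaIntegrand (J : H →ₗ.[ℂ] H) (α : ℝ) (g : H) (t : ℝ) : H :=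
  ((t ^ (α - 1) : ℝ) : ℂ) • resolventOp J (t : ℂ) g

/-- The operator `f ↦ (sin απ / π) ∫₀^∞ t ^ (α - 1) (t + J)⁻¹ J f dt`, defined for those
`f ∈ D(J)` for which the integral converges absolutely (all of `D(J)` if `J` is m-accretive and
`0 < α < 1`). -/
def balakrishnan (J : H →ₗ.[ℂ] H) (α : ℝ) : H →ₗ.[ℂ] H where
  domain :=
    { carrier := {f | ∃ h : f ∈ J.domain,
        IntegrableOn (balaIntegrand J α (J ⟨f, h⟩)) (Ioi 0)}
      zero_mem' := by
        refine ⟨J.domain.zero_mem, ?_⟩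
        have h0 : J ⟨0, J.domain.zero_mem⟩ = 0 := J.map_zero
        have : balaIntegrand J α 0 = fun _ => (0 : H) := by
          funext t; simp [balaIntegrand]
        rw [h0, this]
        exact integrableOn_zero
      add_mem' := by
        rintro f f' ⟨h, hi⟩ ⟨h', hi'⟩
        refine ⟨J.domain.add_mem h h', ?_⟩
        have h1 : J ⟨f + f', J.domain.add_mem h h'⟩ = J ⟨f, h⟩ + J ⟨f', h'⟩ :=
          J.map_add ⟨f, h⟩ ⟨f', h'⟩
        have : balaIntegrand J α (J ⟨f, h⟩ + J ⟨f', h'⟩)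
            = balaIntegrand J α (J ⟨f, h⟩) + balaIntegrand J α (J ⟨f', h'⟩) := by
          funext t; simp [balaIntegrand]
        rw [h1, this]
        exact hi.add hi'
      smul_mem' := by
        rintro c f ⟨h, hi⟩
        refine ⟨J.domain.smul_mem c h, ?_⟩
        have h1 : J ⟨c • f, J.domain.smul_mem c h⟩ = c • J ⟨f, h⟩ := J.map_smul c ⟨f, h⟩
        have : balaIntegrand J α (c • J ⟨f, h⟩) = c • balaIntegrand J α (J ⟨f, h⟩) := by
          funext t; simp [balaIntegrand, smul_comm c]
        rw [h1, this]
        exact hi.smul c }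
  toFun :=
    { toFun := fun f => ((Real.sin (α * Real.pi) / Real.pi : ℝ) : ℂ) •
        ∫ t in Ioi (0 : ℝ), balaIntegrand J α (J ⟨f, f.2.choose⟩) t
      map_add' := by
        intro f f'
        rw [← smul_add, ← integral_add f.2.choose_spec f'.2.choose_spec]
        congr 2
        funext t
        have h1 : J ⟨(f + f' : H), (f + f').2.choose⟩
            = J ⟨f, f.2.choose⟩ + J ⟨f', f'.2.choose⟩ :=
          J.map_add ⟨f, f.2.choose⟩ ⟨f', f'.2.choose⟩
        change balaIntegrand J α (J ⟨(f + f' : H), (f + f').2.choose⟩) t = _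
        rw [h1]
        simp [balaIntegrand]
      map_smul' := by
        intro c f
        rw [RingHom.id_apply, smul_comm c, ← integral_smul c]
        congr 2
        funext t
        have h1 : J ⟨(c • f : H), (c • f).2.choose⟩ = c • J ⟨f, f.2.choose⟩ :=
          J.map_smul c ⟨f, f.2.choose⟩
        change balaIntegrand J α (J ⟨(c • f : H), (c • f).2.choose⟩) t = _
        rw [h1]
        simp [balaIntegrand, smul_comm c] }

/-- The fractional power `J ^ α`, `0 < α < 1`, of an m-accretive operator: the closure of the
operator given on `D(J)` by the Balakrishnan formula. -/
def fracPow (J : H →ₗ.[ℂ] H) (α : ℝ) : H →ₗ.[ℂ] H := (balakrishnan J α).closure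

/-- The transform `Z^α_{G,F}(J) = J* G J + F J ^ α`. -/
def transformZ [CompleteSpace H] (α : ℝ) (G : H →ₗ.[ℂ] H) (F : H →L[ℂ] H) (J : H →ₗ.[ℂ] H) :
    H →ₗ.[ℂ] H :=
  mulP J.adjoint (mulP G J) + (F : H →ₗ[ℂ] H).compPMap (fracPow J α)

/-- The class `𝔊_α`, `0 < α < 1`: the operators `W = Z^α_{G,F}(J)`, where `J` is m-accretive with
compact inverse `T = J⁻¹`, `F` is a bounded operator on the whole space, `G` is a bounded operator
with `D(G) ⊇ R(J)`, strictly accretive with a lower bound `γ > C_α ‖J⁻¹‖ ‖F‖`, and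
`C_α = 2 α⁻¹ ‖J⁻¹‖ + (1 - α)⁻¹`. -/
def ClassG [CompleteSpace H] (α : ℝ) (W : H →ₗ.[ℂ] H) : Prop :=
  ∃ (J G : H →ₗ.[ℂ] H) (F T : H →L[ℂ] H) (γ : ℝ),
    MAccretive J ∧
    IsResolvent J 0 T ∧ IsCompactOperator T ∧
    (∃ C : ℝ, ∀ f : G.domain, ‖G f‖ ≤ C * ‖(f : H)‖) ∧
    (∀ f : J.domain, J f ∈ G.domain) ∧
    0 < γ ∧
    (∀ f : G.domain, γ * ‖(f : H)‖ ^ 2 ≤ (inner ℂ (f : H) (G f)).re) ∧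
    (2 * α⁻¹ * ‖T‖ + (1 - α)⁻¹) * ‖T‖ * ‖F‖ < γ ∧
    W = transformZ α G F J

end Abstract

/-! ### Operators in `L²(a, b)` -/

/-- Lebesgue measure on the interval `(a, b)`. -/
abbrev mu (a b : ℝ) : Measure ℝ := volume.restrict (Ioo a b)

/-- The complex Hilbert space `L²(a, b)`. -/
abbrev L2 (a b : ℝ) : Type := Lp ℂ 2 (mu a b)

theorem integrable_L2 {a b : ℝ} (f : L2 a b) : Integrable f (mu a b) :=
  (Lp.memLp f).integrable (by norm_num)

/-- Test functions: `φ ∈ C₀^∞(a, b)`. -/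
def IsTest (a b : ℝ) (φ : ℝ → ℂ) : Prop :=
  ContDiff ℝ ∞ φ ∧ HasCompactSupport φ ∧ tsupport φ ⊆ Ioo a b

theorem IsTest.deriv_cont {a b : ℝ} {φ : ℝ → ℂ} (h : IsTest a b φ) : Continuous (deriv φ) :=
  h.1.continuous_deriv (by simp)

theorem integrable_mul_of_compact {a b : ℝ} (f : L2 a b) {φ : ℝ → ℂ} (h : Continuous φ)
    (hc : HasCompactSupport φ) : Integrable (fun x => f x * φ x) (mu a b) := by
  obtain ⟨C, hC⟩ := h.bounded_above_of_compact_support hc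
  exact (integrable_L2 f).mul_bdd (c := C) h.aestronglyMeasurable (ae_of_all _ hC)

/-- `v` is the weak derivative of `u` on `(a, b)`. -/
def HasWeakDeriv (a b : ℝ) (u v : ℝ → ℂ) : Prop :=
  ∀ φ : ℝ → ℂ, IsTest a b φ →
    ∫ x in Ioo a b, u x * deriv φ x = -∫ x in Ioo a b, v x * φ x

theorem HasWeakDeriv.unique {a b : ℝ} {u : ℝ → ℂ} {v w : L2 a b}
    (hv : HasWeakDeriv a b u v) (hw : HasWeakDeriv a b u w) : v = w := by
  have key := IsOpen.ae_eq_zero_of_integral_contDiff_smul_eq_zero (μ := volume)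
    (f := fun x => v x - w x) (U := Ioo a b) isOpen_Ioo
    (show IntegrableOn (fun x => v x - w x) (Ioo a b) volume from
      (integrable_L2 v).sub (integrable_L2 w)).locallyIntegrableOn ?_
  · apply Lp.ext
    have := (ae_restrict_iff' (μ := volume) measurableSet_Ioo).2 key
    filter_upwards [this] with x hx
    exact sub_eq_zero.1 hx
  · intro g hg hgc hgs
    let φ : ℝ → ℂ := fun x => (g x : ℂ)
    have hφ : IsTest a b φ := by
      refine ⟨Complex.ofRealCLM.contDiff.comp hg, ?_, ?_⟩
      · exact hgc.comp_left (g := fun x : ℝ => (x : ℂ)) (by simp)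
      · refine (closure_mono ?_).trans hgs
        intro x hx
        simpa [φ] using hx
    have e1 := hv φ hφ
    have e2 := hw φ hφ
    have e3 : ∫ x in Ioo a b, (v x * φ x - w x * φ x) = 0 := by
      rw [integral_sub (integrable_mul_of_compact v hφ.1.continuous hφ.2.1)
        (integrable_mul_of_compact w hφ.1.continuous hφ.2.1)]
      rw [e1] at e2
      rw [sub_eq_zero]
      exact neg_injective e2
    rw [← setIntegral_eq_integral_of_forall_compl_eq_zero (s := Ioo a b)]
    · rw [← e3]
      congr 1
      funext x
      simp [φ]
      ring
    · intro x hx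
      have : g x = 0 := by
        by_contra h
        exact hx (hgs (subset_tsupport g h))
      simp [this]

/-- Weak differentiation `u ↦ u'` in `L²(a, b)`; its domain is the Sobolev space `H¹(a, b)`. -/
def weakDeriv (a b : ℝ) : L2 a b →ₗ.[ℂ] L2 a b :=
  ofRel (fun u v => HasWeakDeriv a b u v)
    (by
      intro φ _
      have h0 := Lp.coeFn_zero ℂ 2 (mu a b)
      rw [integral_eq_zero_of_ae, integral_eq_zero_of_ae, neg_zero]
      · filter_upwards [h0] with x hx
        simp only [hx, Pi.zero_apply, zero_mul]
      · filter_upwards [h0] with x hx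
        simp only [hx, Pi.zero_apply, zero_mul])
    (by
      intro f f' g g' h h' φ hφ
      have e1 : ∫ x in Ioo a b, (f + f' : L2 a b) x * deriv φ x
          = ∫ x in Ioo a b, (f x * deriv φ x + f' x * deriv φ x) := by
        apply integral_congr_ae
        filter_upwards [Lp.coeFn_add f f'] with x hx
        rw [hx, Pi.add_apply, add_mul]
      have e2 : ∫ x in Ioo a b, (g + g' : L2 a b) x * φ x
          = ∫ x in Ioo a b, (g x * φ x + g' x * φ x) := by
        apply integral_congr_ae
        filter_upwards [Lp.coeFn_add g g'] with x hx
        rw [hx, Pi.add_apply, add_mul]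
      rw [e1, e2, integral_add, integral_add, h φ hφ, h' φ hφ]
      · ring
      · exact integrable_mul_of_compact g hφ.1.continuous hφ.2.1
      · exact integrable_mul_of_compact g' hφ.1.continuous hφ.2.1
      · exact integrable_mul_of_compact f hφ.deriv_cont hφ.2.1.deriv
      · exact integrable_mul_of_compact f' hφ.deriv_cont hφ.2.1.deriv)
    (by
      intro c f g h φ hφ
      have e1 : ∫ x in Ioo a b, (c • f : L2 a b) x * deriv φ x
          = ∫ x in Ioo a b, c * (f x * deriv φ x) := by
        apply integral_congr_ae
        filter_upwards [Lp.coeFn_smul c f] with x hx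
        rw [hx, Pi.smul_apply, smul_eq_mul, mul_assoc]
      have e2 : ∫ x in Ioo a b, (c • g : L2 a b) x * φ x
          = ∫ x in Ioo a b, c * (g x * φ x) := by
        apply integral_congr_ae
        filter_upwards [Lp.coeFn_smul c g] with x hx
        rw [hx, Pi.smul_apply, smul_eq_mul, mul_assoc]
      rw [e1, e2, integral_const_mul, integral_const_mul, h φ hφ]
      ring)
    (fun _ _ _ h h' => h.unique h')

/-- The pairs `(φ, φ')` with `φ ∈ C₀^∞(a, b)`. -/
def testGraph (a b : ℝ) : Set (L2 a b × L2 a b) :=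
  {p | ∃ φ : ℝ → ℂ, IsTest a b φ ∧ p.1 =ᵐ[mu a b] φ ∧ p.2 =ᵐ[mu a b] deriv φ}

/-- The Sobolev space `H¹₀(a, b)`: the closure of `C₀^∞(a, b)` in the norm
`(‖u‖² + ‖u'‖²) ^ (1/2)`. -/
def H10 (a b : ℝ) : Submodule ℂ (L2 a b) :=
  ((Submodule.span ℂ (testGraph a b)).topologicalClosure).map
    (LinearMap.fst ℂ (L2 a b) (L2 a b))

/-- The Sobolev space `H²(a, b)`. -/
def H2 (a b : ℝ) : Submodule ℂ (L2 a b) := (mulP (weakDeriv a b) (weakDeriv a b)).domain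

/-- Multiplication by a function `m`, with domain `{f ∈ L² : m f ∈ L²}`. -/
def mulOp (a b : ℝ) (m : ℝ → ℂ) : L2 a b →ₗ.[ℂ] L2 a b :=
  ofRel (fun f g => g =ᵐ[mu a b] fun x => m x * f x)
    (by
      filter_upwards [Lp.coeFn_zero ℂ 2 (mu a b)] with x hx
      rw [hx, Pi.zero_apply, mul_zero])
    (by
      intro f f' g g' h h'
      filter_upwards [h, h', Lp.coeFn_add f f', Lp.coeFn_add g g'] with x h1 h2 h3 h4
      rw [h3, h4, Pi.add_apply, Pi.add_apply, h1, h2, mul_add])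
    (by
      intro c f g h
      filter_upwards [h, Lp.coeFn_smul c f, Lp.coeFn_smul c g] with x h1 h2 h3
      rw [h2, h3, Pi.smul_apply, Pi.smul_apply, h1, smul_eq_mul, smul_eq_mul]
      ring)
    (fun _ _ _ h h' => Lp.ext (h.trans h'.symm))

/-! In the following `P` is an endpoint of `(a, b)`, `r = |x - P|` is the distance of a point `x`
from `P`, and `d = b - a`. A point at distance `t` from `P` is written `s`, so that integrals over
`0 < t < r` and `r + ε < t < d` are integrals over `|s - P| < |x - P|` and
`|x - P| + ε < |s - P|`, `s ∈ (a, b)`. -/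

/-- The kernel `f(s) (|x - P| - |s - P|) ^ (σ - 1)` of the fractional integral. -/
def fracIntKernel (P σ : ℝ) (f : ℝ → ℂ) (x s : ℝ) : ℂ :=
  f s * (((|x - P| - |s - P|) ^ (σ - 1) : ℝ) : ℂ)

/-- The part of `(a, b)` between `P` and `x`. -/
def nearSet (a b P x : ℝ) : Set ℝ := {s | s ∈ Ioo a b ∧ |s - P| < |x - P|}

theorem ae_near {a b P x : ℝ} {p : ℝ → Prop} (h : ∀ᵐ s ∂(mu a b), p s) :
    ∀ᵐ s ∂(volume.restrict (nearSet a b P x)), p s :=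
  ae_mono (Measure.restrict_mono (fun _ hs => hs.1) le_rfl) h

/-- The fractional integral `f ↦ Γ(σ)⁻¹ ∫₀^r f(t) (r - t) ^ (σ - 1) dt` for `σ ≠ 0`, on its
natural domain in `L²(a, b)`, and the identity for `σ = 0`. -/
def fracInt (a b P σ : ℝ) : L2 a b →ₗ.[ℂ] L2 a b :=
  if σ = 0 then (LinearMap.id : L2 a b →ₗ[ℂ] L2 a b).toPMap ⊤ else
  ofRel (fun f g =>
      (∀ᵐ x ∂(mu a b), IntegrableOn (fracIntKernel P σ f x) (nearSet a b P x)) ∧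
      g =ᵐ[mu a b] fun x =>
        ((1 / Real.Gamma σ : ℝ) : ℂ) * ∫ s in nearSet a b P x, fracIntKernel P σ f x s)
    (by
      have h0 := Lp.coeFn_zero ℂ 2 (mu a b)
      have hk : ∀ x, fracIntKernel P σ (0 : L2 a b) x =ᵐ[volume.restrict (nearSet a b P x)]
          fun _ => (0 : ℂ) := by
        intro x
        filter_upwards [ae_near h0] with s hs
        rw [fracIntKernel, hs, Pi.zero_apply, zero_mul]
      refine ⟨ae_of_all _ fun x => (integrable_zero _ _ _).congr (hk x).symm, ?_⟩
      filter_upwards [h0] with x hx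
      rw [integral_congr_ae (hk x), hx]
      simp)
    (by
      rintro f f' g g' ⟨h1, h2⟩ ⟨h1', h2'⟩
      have hk : ∀ x, fracIntKernel P σ (f + f' : L2 a b) x
          =ᵐ[volume.restrict (nearSet a b P x)]
          fun s => fracIntKernel P σ f x s + fracIntKernel P σ f' x s := by
        intro x
        filter_upwards [ae_near (Lp.coeFn_add f f')] with s hs
        rw [fracIntKernel, hs, Pi.add_apply, add_mul, fracIntKernel, fracIntKernel]
      refine ⟨?_, ?_⟩
      · filter_upwards [h1, h1'] with x hx hx'
        exact (hx.add hx').congr (hk x).symm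
      · filter_upwards [h1, h1', h2, h2', Lp.coeFn_add g g'] with x hx hx' hg hg' ha
        rw [ha, Pi.add_apply, hg, hg', integral_congr_ae (hk x), integral_add hx hx', mul_add])
    (by
      rintro z f g ⟨h1, h2⟩
      have hk : ∀ x, fracIntKernel P σ (z • f : L2 a b) x
          =ᵐ[volume.restrict (nearSet a b P x)]
          fun s => z * fracIntKernel P σ f x s := by
        intro x
        filter_upwards [ae_near (Lp.coeFn_smul z f)] with s hs
        simp [fracIntKernel, hs, mul_assoc]
      refine ⟨?_, ?_⟩
      · filter_upwards [h1] with x hx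
        exact (hx.const_mul z).congr (hk x).symm
      · filter_upwards [h2, Lp.coeFn_smul z g] with x hg ha
        rw [ha, Pi.smul_apply, hg, integral_congr_ae (hk x), integral_const_mul, smul_eq_mul]
        ring)
    (fun _ _ _ h h' => Lp.ext (h.2.trans h'.2.symm))

/-- The part of `(a, b)` beyond `x`, seen from `P`, at distance more than `ε` from `x`. -/
def farSet (a b P ε x : ℝ) : Set ℝ := {s | s ∈ Ioo a b ∧ |x - P| + ε < |s - P|}

/-- The truncated right-side fractional derivative. -/
def truncDeriv (a b P α ε : ℝ) (f : ℝ → ℂ) (x : ℝ) : ℂ :=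
  if |x - P| ≤ (b - a) - ε then
    ((α / Real.Gamma (1 - α) : ℝ) : ℂ) *
        (∫ s in farSet a b P ε x,
          (f x - f s) / (((|s - P| - |x - P|) ^ (α + 1) : ℝ) : ℂ)) +
      f x / ((Real.Gamma (1 - α) : ℝ) : ℂ) * ((((b - a) - |x - P|) ^ (-α) : ℝ) : ℂ)
  else
    f x / (α : ℂ) * ((1 / ε ^ α - 1 / ((b - a) - |x - P|) ^ α : ℝ) : ℂ)

theorem ae_far {a b P ε x : ℝ} {p : ℝ → Prop} (h : ∀ᵐ s ∂(mu a b), p s) :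
    ∀ᵐ s ∂(volume.restrict (farSet a b P ε x)), p s :=
  ae_mono (Measure.restrict_mono (fun _ hs => hs.1) le_rfl) h

theorem measurableSet_farSet (a b P ε x : ℝ) : MeasurableSet (farSet a b P ε x) :=
  measurableSet_Ioo.inter
    (measurableSet_lt measurable_const (by fun_prop : Measurable fun s : ℝ => |s - P|))

theorem integrable_far {a b : ℝ} (P α : ℝ) {ε : ℝ} (hε : 0 < ε) (f : L2 a b) (x : ℝ) :
    IntegrableOn (fun s => (f x - f s) / (((|s - P| - |x - P|) ^ (α + 1) : ℝ) : ℂ))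
      (farSet a b P ε x) := by
  have hf : IntegrableOn (fun s => f x - f s) (farSet a b P ε x) :=
    ((integrable_const (f x)).sub (integrable_L2 f)).mono_measure
      (Measure.restrict_mono (fun _ hs => hs.1) le_rfl)
  let M : ℝ := |a - P| + |b - P|
  have hcont : ContinuousOn (fun t : ℝ => t ^ (α + 1)) (Icc ε M) := by
    intro t ht
    exact (Real.continuousAt_rpow_const t (α + 1)
      (Or.inl (hε.trans_le ht.1).ne')).continuousWithinAt
  have hcont' : ContinuousOn (fun t : ℝ => (t ^ (α + 1))⁻¹) (Icc ε M) :=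
    hcont.inv₀ fun t ht => (Real.rpow_pos_of_pos (hε.trans_le ht.1) _).ne'
  obtain ⟨C, hC⟩ := isCompact_Icc.exists_bound_of_continuousOn hcont'
  have hmeas : Measurable fun s : ℝ => ((((|s - P| - |x - P|) ^ (α + 1))⁻¹ : ℝ) : ℂ) := by
    fun_prop
  have := hf.mul_bdd (c := C) hmeas.aestronglyMeasurable (by
    rw [ae_restrict_iff' (measurableSet_farSet a b P ε x)]
    refine ae_of_all _ fun s hs => ?_
    rw [Complex.norm_real]
    refine hC _ ⟨by linarith [hs.2], ?_⟩
    have h1 : |s - P| ≤ M := by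
      have := hs.1.1
      have := hs.1.2
      refine abs_le.2 ⟨?_, ?_⟩
      · linarith [neg_abs_le (a - P), abs_nonneg (b - P)]
      · linarith [le_abs_self (b - P), abs_nonneg (a - P)]
    linarith [abs_nonneg (x - P)])
  refine this.congr (ae_of_all _ fun s => ?_)
  simp [div_eq_mul_inv]

theorem truncDeriv_add {a b : ℝ} (P α : ℝ) {ε : ℝ} (hε : 0 < ε) (f f' : L2 a b) :
    truncDeriv a b P α ε (f + f' : L2 a b)
      =ᵐ[mu a b] fun x => truncDeriv a b P α ε f x + truncDeriv a b P α ε f' x := by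
  filter_upwards [Lp.coeFn_add f f'] with x hx
  have hi : ∫ s in farSet a b P ε x, ((f + f' : L2 a b) x - (f + f' : L2 a b) s) /
        (((|s - P| - |x - P|) ^ (α + 1) : ℝ) : ℂ)
      = (∫ s in farSet a b P ε x, (f x - f s) / (((|s - P| - |x - P|) ^ (α + 1) : ℝ) : ℂ)) +
        ∫ s in farSet a b P ε x, (f' x - f' s) / (((|s - P| - |x - P|) ^ (α + 1) : ℝ) : ℂ) := by
    rw [← integral_add (integrable_far P α hε f x) (integrable_far P α hε f' x)]
    apply integral_congr_ae
    filter_upwards [ae_far (Lp.coeFn_add f f')] with s hs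
    rw [hs, hx, Pi.add_apply, Pi.add_apply]
    ring
  unfold truncDeriv
  rw [hi, hx, Pi.add_apply]
  split_ifs <;> ring

theorem truncDeriv_smul {a b : ℝ} (P α ε : ℝ) (z : ℂ) (f : L2 a b) :
    truncDeriv a b P α ε (z • f : L2 a b)
      =ᵐ[mu a b] fun x => z * truncDeriv a b P α ε f x := by
  filter_upwards [Lp.coeFn_smul z f] with x hx
  have hi : ∫ s in farSet a b P ε x, ((z • f : L2 a b) x - (z • f : L2 a b) s) /
        (((|s - P| - |x - P|) ^ (α + 1) : ℝ) : ℂ)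
      = z * ∫ s in farSet a b P ε x,
          (f x - f s) / (((|s - P| - |x - P|) ^ (α + 1) : ℝ) : ℂ) := by
    rw [← integral_const_mul]
    apply integral_congr_ae
    filter_upwards [ae_far (Lp.coeFn_smul z f)] with s hs
    rw [hs, hx, Pi.smul_apply, Pi.smul_apply, smul_eq_mul, smul_eq_mul]
    ring
  unfold truncDeriv
  rw [hi, hx, Pi.smul_apply, smul_eq_mul]
  split_ifs <;> ring

/-- The right-side fractional derivative: the limit in `L²(a, b)` of the truncated derivatives as
`ε → 0+`, defined for those `f` for which this limit exists. -/
def fracDeriv (a b P α : ℝ) : L2 a b →ₗ.[ℂ] L2 a b :=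
  ofRel (fun f g =>
      (∀ᶠ ε in 𝓝[>] (0 : ℝ), MemLp (truncDeriv a b P α ε f) 2 (mu a b)) ∧
      Tendsto (fun ε : ℝ => eLpNorm (fun x => truncDeriv a b P α ε f x - g x) 2 (mu a b))
        (𝓝[>] 0) (𝓝 0))
    (by
      have h0 : ∀ ε : ℝ, 0 < ε →
          truncDeriv a b P α ε (0 : L2 a b) =ᵐ[mu a b] fun _ => (0 : ℂ) := by
        intro ε hε
        simpa using truncDeriv_smul P α ε (0 : ℂ) (0 : L2 a b)
      refine ⟨?_, ?_⟩
      · filter_upwards [self_mem_nhdsWithin] with ε hε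
        exact (memLp_congr_ae (h0 ε hε)).2 MemLp.zero
      · refine tendsto_const_nhds.congr' ?_
        filter_upwards [self_mem_nhdsWithin] with ε hε
        rw [eq_comm, eLpNorm_congr_ae (g := fun _ => (0 : ℂ))]
        · exact eLpNorm_zero
        · filter_upwards [h0 ε hε, Lp.coeFn_zero ℂ 2 (mu a b)] with x h1 h2
          rw [h1, h2, Pi.zero_apply, sub_zero])
    (by
      rintro f f' g g' ⟨h1, h2⟩ ⟨h1', h2'⟩
      refine ⟨?_, ?_⟩
      · filter_upwards [h1, h1', self_mem_nhdsWithin] with ε hx hx' hε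
        exact (memLp_congr_ae (truncDeriv_add P α hε f f')).2 (hx.add hx')
      · have hs := h2.add h2'
        rw [add_zero] at hs
        refine tendsto_of_tendsto_of_tendsto_of_le_of_le' tendsto_const_nhds hs
          (Eventually.of_forall fun _ => zero_le) ?_
        filter_upwards [h1, h1', self_mem_nhdsWithin] with ε hx hx' hε
        refine le_trans (le_of_eq (eLpNorm_congr_ae ?_))
          (eLpNorm_add_le (hx.sub (Lp.memLp g)).1 (hx'.sub (Lp.memLp g')).1 (by norm_num))
        filter_upwards [truncDeriv_add P α hε f f', Lp.coeFn_add g g'] with x e1 e2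
        simp only [e1, e2, Pi.add_apply]
        ring)
    (by
      rintro z f g ⟨h1, h2⟩
      refine ⟨?_, ?_⟩
      · filter_upwards [h1] with ε hx
        exact (memLp_congr_ae (truncDeriv_smul P α ε z f)).2 (hx.const_mul z)
      · have hs := ENNReal.Tendsto.const_mul (a := ‖z‖ₑ) h2 (Or.inr (by simp))
        rw [mul_zero] at hs
        refine hs.congr fun ε => ?_
        rw [← eLpNorm_const_smul]
        apply eLpNorm_congr_ae
        filter_upwards [truncDeriv_smul P α ε z f, Lp.coeFn_smul z g] with x e1 e2
        simp only [e1, e2, Pi.smul_apply, smul_eq_mul]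
        ring)
    (by
      rintro f g g' ⟨h1, h2⟩ ⟨-, h2'⟩
      have hs := h2.add h2'
      rw [add_zero] at hs
      have h0 : eLpNorm (fun x => g x - g' x) 2 (mu a b) ≤ 0 := by
        refine ge_of_tendsto hs ?_
        filter_upwards [h1] with ε hx
        rw [add_comm]
        refine le_trans (le_of_eq (eLpNorm_congr_ae ?_))
          (eLpNorm_sub_le (hx.sub (Lp.memLp g')).1 (hx.sub (Lp.memLp g)).1 (by norm_num))
        filter_upwards with x
        simp
      have h3 := (eLpNorm_eq_zero_iff ((Lp.memLp g).sub (Lp.memLp g')).1 (by norm_num)).1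
        (le_antisymm h0 zero_le)
      apply Lp.ext
      filter_upwards [h3] with x hx
      exact sub_eq_zero.1 hx)

/-- The operator `L u = -(c u')' + I^σ ρ D^α u` with domain `H²(a, b) ∩ H¹₀(a, b)`, where `I^σ` is
the left-side fractional integral and `D^α` the right-side fractional derivative. -/
def kipriyanovL (a b P α σ : ℝ) (c ρ : ℝ → ℂ) : L2 a b →ₗ.[ℂ] L2 a b :=
  (-(mulP (weakDeriv a b) (mulP (mulOp a b c) (weakDeriv a b))) +
      mulP (fracInt a b P σ) (mulP (mulOp a b ρ) (fracDeriv a b P α))).domRestrict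
    (H2 a b ⊓ H10 a b)

end FracOp

end

/-! Let `J` be the positive square root of the Dirichlet Laplacian on `(a, b)` and `T` its compact
inverse. The domain of `J` is `H¹₀`, and there is an isometry `U` of `L²` onto the functions of mean
value zero such that `U J u = u'` (`exists_sqrt_dirichlet`). It comes from the polar decomposition
of the primitive restricted to mean-zero functions. Since the adjoint of `d/dx` on `H¹₀` is `-d/dx`
on `H¹`, `U* v = -T v'` for `v` in `H¹`. With `M` denoting multiplication by `c`, this gives `-(c
u')' = J* (U* M U) J u`. The operator `G = U* M U` is bounded, and because `U` is isometric it
inherits the lower bound `γ` of `Re c`. The domains agree because `c u'` lies in `H¹` exactly when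
`u'` does, `c` being `C¹` and bounded away from zero.

It remains to write the lower-order term as `F J^α` on `D(J)` with `‖F‖ ≤ C ‖ρ‖`. The fractional
integral and multiplication by `ρ` are bounded on `L²`, so by Douglas' lemma (`exists_clm_comp_eq`)
the inequality `‖D^α u‖ ≤ C ‖J^α u‖` on `H¹₀` suffices. It rests on three facts.

(1) For `u` in `H¹₀`, writing `u` as an integral of `u'` and applying Fubini turns the truncated
derivatives into integrals of `u'` against `max(ε, ·)^(-α)`. By dominated convergence `D^α u` is, up
to a factor, the convolution of `u'` with a one-sided truncated power (`truncDeriv_eq_kerFun`,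
`exists_fracDeriv_eq`).

(2) On an interval three times as long the convolution does not wrap around, and its Fourier
coefficients are at most a constant times `|ξ|^(α-1)` times those of `u'`, by an elementary
oscillatory integral bound. If `f = J u` and `w = (t + J)⁻¹ f`, then `u' = w' + t U w`. Taking `0 <
t < |ξ|` bounds the weighted coefficients of `u'` by an integral in `t` of those of `w` and `U w`
(`enorm_inner_mode_sq_le`). Parseval then reduces everything to `∫ t^(2α-1) ‖(t + J)⁻¹ f‖² dt`.

(3) That integral is at most `α ‖∫ t^(α-1) (t + J)⁻¹ f dt‖²`, because `Re ⟨(t+J)⁻¹f, (s+J)⁻¹f⟩ ≥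
‖(t+J)⁻¹f‖²` for `s ≤ t` (`lintegral_sq_resolventOp_le`). The vector on the right is `J^α u` up to
the factor `π / sin απ`.

None of `J`, `U`, `T` and the constants involves `c` or `ρ`, so the threshold `K` depends only on
the interval, `P`, `α` and `σ`. -/

noncomputable section

namespace FracOp

/-! ### Factorization of operators, inverses of bounded operators, m-accretivity -/

section Operators

variable {H : Type*} [NormedAddCommGroup H] [InnerProductSpace ℂ H]

/-- Douglas' lemma: if `‖A m‖ ≤ C ‖B m‖` then `A` factors through `B` by a bounded operator of
norm at most `C`. -/
theorem exists_clm_comp_eq [CompleteSpace H] {M H' : Type*} [AddCommGroup M] [Module ℂ M]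
    [NormedAddCommGroup H'] [InnerProductSpace ℂ H'] [CompleteSpace H']
    (A : M →ₗ[ℂ] H') (B : M →ₗ[ℂ] H) {C : ℝ} (hC : 0 ≤ C) (h : ∀ m, ‖A m‖ ≤ C * ‖B m‖) :
    ∃ X : H →L[ℂ] H', ‖X‖ ≤ C ∧ ∀ m, X (B m) = A m := by
  let S : Submodule ℂ H := (LinearMap.range B).topologicalClosure
  have hS : ∀ m, B m ∈ S := fun m =>
    Submodule.le_topologicalClosure _ (LinearMap.mem_range_self B m)
  let e : M →ₗ[ℂ] S := B.codRestrict S hS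
  have hd : DenseRange e := by
    intro y
    rw [Topology.IsInducing.subtypeVal.closure_eq_preimage_closure_image]
    have : ((fun x : S => (x : H)) '' range e) = (LinearMap.range B : Set H) := by
      ext z
      constructor
      · rintro ⟨_, ⟨m, rfl⟩, rfl⟩
        exact ⟨m, rfl⟩
      · rintro ⟨m, rfl⟩
        exact ⟨e m, ⟨m, rfl⟩, rfl⟩
    change (y : H) ∈ closure ((fun x : S => (x : H)) '' range e)
    rw [this]
    exact y.2
  have hn : ∀ m, ‖A m‖ ≤ C * ‖e m‖ := h
  have : CompleteSpace S := (Submodule.isClosed_topologicalClosure _).completeSpace_coe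
  -- The inequality makes `A` a function of `B m`, continuous on the dense range of `e` in `S`. The
  -- extension to `S` is carried to all of `H` by the orthogonal projection, which does not increase
  -- the norm.
  let X0 : S →L[ℂ] H' := A.extendOfNorm e
  refine ⟨X0.comp S.orthogonalProjectionOnto, ?_, fun m => ?_⟩
  · refine (ContinuousLinearMap.opNorm_comp_le _ _).trans ?_
    have h1 : ‖X0‖ ≤ C := LinearMap.opNorm_extendOfNorm_le hd hC hn
    have h2 : ‖S.orthogonalProjectionOnto‖ ≤ 1 := Submodule.orthogonalProjectionOnto_norm_le S
    nlinarith [norm_nonneg X0, norm_nonneg S.orthogonalProjectionOnto]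
  · have : S.orthogonalProjectionOnto (B m) = e m :=
      Submodule.orthogonalProjectionOnto_mem_subspace_eq_self (K := S) (e m)
    rw [ContinuousLinearMap.comp_apply, this]
    exact LinearMap.extendOfNorm_eq hd ⟨C, hn⟩ m

/-- The (unbounded) inverse of an injective bounded operator. -/
def invP (T : H →L[ℂ] H) (hT : Function.Injective T) : H →ₗ.[ℂ] H where
  domain := LinearMap.range (T : H →ₗ[ℂ] H)
  toFun := (LinearEquiv.ofInjective (T : H →ₗ[ℂ] H) hT).symm.toLinearMap

section invP

variable {T : H →L[ℂ] H} {hT : Function.Injective T}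

theorem apply_mem_invP_domain (f : H) : T f ∈ (invP T hT).domain := ⟨f, rfl⟩

@[simp]
theorem invP_apply (f : H) (h : T f ∈ (invP T hT).domain) : invP T hT ⟨T f, h⟩ = f := by
  change (LinearEquiv.ofInjective (T : H →ₗ[ℂ] H) hT).symm ⟨T f, h⟩ = f
  rw [LinearEquiv.symm_apply_eq]
  rfl

@[simp]
theorem apply_invP (u : (invP T hT).domain) : T (invP T hT u) = u := by
  obtain ⟨_, f, rfl⟩ := u
  exact congrArg T (invP_apply f _)

theorem isResolvent_invP : IsResolvent (invP T hT) 0 T := by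
  refine ⟨fun f => ?_, fun g => ⟨apply_mem_invP_domain g, ?_⟩⟩
  · rw [zero_smul, add_zero, apply_invP]
  · rw [zero_smul, add_zero, invP_apply]

theorem re_inner_invP_nonneg (hpos : ∀ x, 0 ≤ (inner ℂ (T x) x).re) (u : (invP T hT).domain) :
    0 ≤ (inner ℂ (u : H) (invP T hT u)).re := by
  have := hpos (invP T hT u)
  rwa [apply_invP] at this

/-- The adjoint of the inverse of a self-adjoint bounded operator. -/
theorem adjoint_invP [CompleteSpace H] (hs : ∀ x y, inner ℂ (T x) y = inner ℂ x (T y))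
    (hd : Dense ((invP T hT).domain : Set H)) : (invP T hT).adjoint = invP T hT := by
  have hle : invP T hT ≤ (invP T hT).adjoint := by
    refine LinearPMap.IsFormalAdjoint.le_adjoint hd fun x y => ?_
    rw [← apply_invP y, ← hs, apply_invP]
  refine le_antisymm ?_ hle
  refine ⟨fun v hv => ?_, fun v w hvw => ?_⟩
  · have hv' : T ((invP T hT).adjoint ⟨v, hv⟩) = v := by
      refine ext_inner_right ℂ fun f => ?_
      have := LinearPMap.adjoint_isFormalAdjoint hd ⟨v, hv⟩
        ⟨T f, apply_mem_invP_domain (hT := hT) f⟩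
      rw [invP_apply] at this
      rw [hs]
      exact this
    rw [← hv']
    exact apply_mem_invP_domain _
  · have h2 := hle.2 (x := w) (y := v) hvw.symm
    exact h2.symm

end invP

theorem re_inner_resolvent {J : H →ₗ.[ℂ] H} {ζ : ℂ} {R : H →L[ℂ] H} (hR : IsResolvent J ζ R)
    (g : H) : ∃ h : R g ∈ J.domain,
      (inner ℂ (R g) g).re = (inner ℂ (R g) (J ⟨R g, h⟩)).re + ζ.re * ‖R g‖ ^ 2 := by
  obtain ⟨h, hg⟩ := hR.2 g
  refine ⟨h, ?_⟩
  have h1 : inner ℂ (R g) g = inner ℂ (R g) (J ⟨R g, h⟩) + ζ * ((‖R g‖ ^ 2 : ℝ) : ℂ) := by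
    have := congrArg (inner ℂ (R g)) hg
    rw [← this, inner_add_right, inner_smul_right, inner_self_eq_norm_sq_to_K]
    norm_cast
  rw [h1, Complex.add_re, Complex.re_mul_ofReal]

theorem re_inner_resolvent_nonneg {J : H →ₗ.[ℂ] H}
    (hacc : ∀ u : J.domain, 0 ≤ (inner ℂ (u : H) (J u)).re)
    {ζ : ℂ} (hζ : 0 < ζ.re) {R : H →L[ℂ] H} (hR : IsResolvent J ζ R) (g : H) :
    0 ≤ (inner ℂ (R g) g).re := by
  obtain ⟨h, h1⟩ := re_inner_resolvent hR g
  have h2 := hacc ⟨R g, h⟩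
  rw [h1]
  positivity

/-- Pair `g = J w + ζ w` with `w = R g`: accretivity gives `Re ζ ‖w‖² ≤ Re ⟨w, g⟩ ≤ ‖w‖ ‖g‖`. -/
theorem norm_resolvent_le {J : H →ₗ.[ℂ] H} (hacc : ∀ u : J.domain, 0 ≤ (inner ℂ (u : H) (J u)).re)
    {ζ : ℂ} {R : H →L[ℂ] H} (hR : IsResolvent J ζ R) (g : H) :
    ζ.re * ‖R g‖ ≤ ‖g‖ := by
  obtain ⟨h, h1⟩ := re_inner_resolvent hR g
  have h2 := hacc ⟨R g, h⟩
  have h3 : (inner ℂ (R g) g).re ≤ ‖R g‖ * ‖g‖ :=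
    (Complex.re_le_norm _).trans (norm_inner_le_norm _ _)
  have h4 : ζ.re * ‖R g‖ ^ 2 ≤ ‖R g‖ * ‖g‖ := by
    simp only at h2
    linarith
  rcases (norm_nonneg (R g)).eq_or_lt with h0 | h0
  · rw [← h0, mul_zero]
    exact norm_nonneg g
  · refine le_of_mul_le_mul_left ?_ h0
    calc ‖R g‖ * (ζ.re * ‖R g‖) = ζ.re * ‖R g‖ ^ 2 := by ring
      _ ≤ _ := h4

/-- M-accretivity rules out the default value `0` in `resolventOp` on the right half-plane. -/
theorem isResolvent_resolventOp {J : H →ₗ.[ℂ] H} (hJ : MAccretive J) {ζ : ℂ} (hζ : 0 < ζ.re) :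
    IsResolvent J ζ (resolventOp J ζ) := by
  obtain ⟨R, hR, -⟩ := hJ.2 ζ hζ
  have h : ∃ R, IsResolvent J ζ R := ⟨R, hR⟩
  rw [resolventOp, dif_pos h]
  exact h.choose_spec

/-- The inverse of an injective accretive bounded operator with dense range is m-accretive. -/
theorem mAccretive_invP [CompleteSpace H] {T : H →L[ℂ] H} {hT : Function.Injective T}
    (hpos : ∀ x, 0 ≤ (inner ℂ (T x) x).re) (hd : Dense ((invP T hT).domain : Set H)) :
    MAccretive (invP T hT) := by
  refine ⟨hd, fun ζ hζ => ?_⟩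
  -- The resolvent will be `T (1 + ζ T)⁻¹`. The factor `conj ζ` makes the operator coercive: its
  -- quadratic form has real part `Re ζ ‖x‖² + |ζ|² Re ⟨T x, x⟩`.
  have hB : IsUnit ((starRingEnd ℂ ζ) • ((1 : H →L[ℂ] H) + ζ • T)) := by
    refine ContinuousLinearMap.isUnit_of_forall_le_norm_inner_map _ (c := ⟨ζ.re, hζ.le⟩) hζ
      fun x => ?_
    refine le_trans ?_ (Complex.re_le_norm _)
    have : inner ℂ ((starRingEnd ℂ ζ • ((1 : H →L[ℂ] H) + ζ • T)) x) x
        = ζ * (‖x‖ ^ 2 : ℝ) + (Complex.normSq ζ : ℂ) * inner ℂ (T x) x := by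
      change inner ℂ (starRingEnd ℂ ζ • (x + ζ • T x)) x = _
      simp only [inner_smul_left, inner_add_left, inner_self_eq_norm_sq_to_K, Complex.conj_conj,
        Complex.normSq_eq_conj_mul_self, Complex.coe_algebraMap]
      push_cast
      ring
    rw [this, Complex.add_re, Complex.re_mul_ofReal, Complex.re_ofReal_mul]
    have h1 := mul_nonneg (Complex.normSq_nonneg ζ) (hpos x)
    change ‖x‖ ^ 2 * ζ.re ≤ _
    linarith
  obtain ⟨B, hBe⟩ := hB
  have hinv : ∀ g, (B : H →L[ℂ] H) ((↑B⁻¹ : H →L[ℂ] H) g) = g := fun g => by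
    rw [← mul_apply_eq_comp, B.mul_inv]; rfl
  have hinv' : ∀ g, (↑B⁻¹ : H →L[ℂ] H) ((B : H →L[ℂ] H) g) = g := fun g => by
    rw [← mul_apply_eq_comp, B.inv_mul]; rfl
  let R : H →L[ℂ] H := T.comp (starRingEnd ℂ ζ • (↑B⁻¹ : H →L[ℂ] H))
  have key : ∀ f, (B : H →L[ℂ] H) f = starRingEnd ℂ ζ • (f + ζ • T f) := fun f => by
    rw [hBe]; rfl
  have hR : IsResolvent (invP T hT) ζ R := by
    refine ⟨fun f => ?_, fun g => ⟨apply_mem_invP_domain _, ?_⟩⟩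
    · change T (starRingEnd ℂ ζ • (↑B⁻¹ : H →L[ℂ] H) _) = _
      have h1 := key (invP T hT f)
      rw [apply_invP] at h1
      rw [← map_smul, ← h1, hinv', apply_invP]
    · change invP T hT ⟨T (starRingEnd ℂ ζ • (↑B⁻¹ : H →L[ℂ] H) g), _⟩ + ζ • T _ = g
      rw [invP_apply]
      have h1 := key ((↑B⁻¹ : H →L[ℂ] H) g)
      rw [hinv] at h1
      conv_rhs => rw [h1]
      change starRingEnd ℂ ζ • _ + ζ • T (starRingEnd ℂ ζ • _) = _
      rw [smul_add, map_smul, smul_comm ζ]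
      rfl
  refine ⟨R, hR, R.opNorm_le_bound (by positivity) fun g => ?_⟩
  have := norm_resolvent_le (re_inner_invP_nonneg hpos) hR g
  rw [inv_mul_eq_div, le_div_iff₀ hζ]
  linarith

/-! #### Fractional powers of an m-accretive operator -/

section Balakrishnan

variable {J : H →ₗ.[ℂ] H}

theorem resolventOp_sub (hJ : MAccretive J) {s t : ℝ} (hs : 0 < s) (ht : 0 < t) (g : H) :
    resolventOp J s g - resolventOp J t g
      = ((t - s : ℝ) : ℂ) • resolventOp J s (resolventOp J t g) := by
  obtain ⟨h, hg⟩ := (isResolvent_resolventOp hJ (ζ := t) (by simpa using ht)).2 g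
  have h1 := (isResolvent_resolventOp hJ (ζ := s) (by simpa using hs)).1 ⟨resolventOp J t g, h⟩
  have h2 : J ⟨resolventOp J t g, h⟩ + (s : ℂ) • resolventOp J t g
      = g - ((t - s : ℝ) : ℂ) • resolventOp J t g := by
    conv_rhs => rw [← hg]
    push_cast
    rw [sub_smul]
    nth_rw 2 [hg]
    nth_rw 2 [hg]
    abel
  simp only at h1
  rw [h2, map_sub, map_smul, sub_eq_iff_eq_add'] at h1
  rw [h1, add_sub_cancel_right]

theorem norm_resolventOp_le (hJ : MAccretive J)
    (hacc : ∀ u : J.domain, 0 ≤ (inner ℂ (u : H) (J u)).re)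
    {t : ℝ} (ht : 0 < t) (g : H) :
    ‖resolventOp J t g‖ ≤ t⁻¹ * ‖g‖ := by
  have := norm_resolvent_le hacc (isResolvent_resolventOp hJ (ζ := t) (by simpa using ht)) g
  rw [Complex.ofReal_re] at this
  rw [inv_mul_eq_div, le_div_iff₀ ht]
  linarith

theorem continuousOn_resolventOp (hJ : MAccretive J)
    (hacc : ∀ u : J.domain, 0 ≤ (inner ℂ (u : H) (J u)).re)
    (g : H) :
    ContinuousOn (fun t : ℝ => resolventOp J t g) (Ioi 0) := by
  intro t ht
  have ht' : 0 < t := ht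
  apply ContinuousAt.continuousWithinAt
  rw [ContinuousAt, tendsto_iff_norm_sub_tendsto_zero]
  have hlim : Tendsto (fun s : ℝ => |t - s| * (s⁻¹ * (t⁻¹ * ‖g‖))) (𝓝 t) (𝓝 0) := by
    have h1 : Tendsto (fun s : ℝ => |t - s|) (𝓝 t) (𝓝 0) := by
      have : Continuous fun s : ℝ => |t - s| := by fun_prop
      simpa using this.tendsto t
    have h2 : Tendsto (fun s : ℝ => s⁻¹ * (t⁻¹ * ‖g‖)) (𝓝 t) (𝓝 (t⁻¹ * (t⁻¹ * ‖g‖))) :=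
      (tendsto_inv₀ ht'.ne').mul_const _
    simpa using h1.mul h2
  refine tendsto_of_tendsto_of_tendsto_of_le_of_le' tendsto_const_nhds hlim
    (Eventually.of_forall fun _ => norm_nonneg _) ?_
  filter_upwards [Ioi_mem_nhds ht'] with s hs
  have hs' : 0 < s := hs
  rw [resolventOp_sub hJ hs' ht', norm_smul, Complex.norm_real, Real.norm_eq_abs]
  gcongr
  refine (norm_resolventOp_le hJ hacc hs' _).trans ?_
  gcongr
  exact norm_resolventOp_le hJ hacc ht' g

/-- Since `(t + J)⁻¹ J u = u - t (t + J)⁻¹ u` and `t (t + J)⁻¹` is a contraction, the bound is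
uniform in `t`. It controls the Balakrishnan integrand near `t = 0`. -/
theorem norm_resolventOp_apply_le (hJ : MAccretive J)
    (hacc : ∀ u : J.domain, 0 ≤ (inner ℂ (u : H) (J u)).re)
    {t : ℝ} (ht : 0 < t) (u : J.domain) :
    ‖resolventOp J t (J u)‖ ≤ 2 * ‖(u : H)‖ := by
  have h1 := (isResolvent_resolventOp hJ (ζ := t) (by simpa using ht)).1 u
  rw [map_add, map_smul] at h1
  have h2 : resolventOp J t (J u) = (u : H) - (t : ℂ) • resolventOp J t (u : H) := by
    rw [← h1]
    simp only [h1]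
    nth_rw 1 [← h1]
    abel
  have h3 := norm_resolventOp_le hJ hacc ht (u : H)
  rw [h2]
  refine (norm_sub_le _ _).trans ?_
  rw [norm_smul, Complex.norm_real, Real.norm_eq_abs, abs_of_pos ht]
  have : t * ‖resolventOp J t (u : H)‖ ≤ ‖(u : H)‖ := by
    calc t * ‖resolventOp J t (u : H)‖ ≤ t * (t⁻¹ * ‖(u : H)‖) := by gcongr
      _ = ‖(u : H)‖ := by field_simp
  linarith

/-- The integrand is `O(t ^ (α - 1))` on `(0, 1]` by the uniform bound and `O(t ^ (α - 2))` on `(1,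
∞)` by the resolvent estimate. Hence the convergence condition in `balakrishnan` excludes nothing
from `D(J)`. -/
theorem integrableOn_balaIntegrand (hJ : MAccretive J)
    (hacc : ∀ u : J.domain, 0 ≤ (inner ℂ (u : H) (J u)).re)
    {α : ℝ} (hα0 : 0 < α) (hα1 : α < 1) (u : J.domain) :
    IntegrableOn (balaIntegrand J α (J u)) (Ioi 0) := by
  have hc : ContinuousOn (balaIntegrand J α (J u)) (Ioi 0) := by
    refine ContinuousOn.smul ?_ (continuousOn_resolventOp hJ hacc _)
    refine Complex.continuous_ofReal.comp_continuousOn fun t ht => ?_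
    exact (Real.continuousAt_rpow_const t (α - 1) (Or.inl (ne_of_gt ht))).continuousWithinAt
  have hn : ∀ t : ℝ, 0 < t → ‖balaIntegrand J α (J u) t‖ = t ^ (α - 1) * ‖resolventOp J t (J u)‖ := by
    intro t ht
    rw [balaIntegrand, norm_smul, Complex.norm_real, Real.norm_eq_abs,
      abs_of_pos (Real.rpow_pos_of_pos ht _)]
  rw [← Ioc_union_Ioi_eq_Ioi (zero_le_one' ℝ)]
  refine IntegrableOn.union ?_ ?_
  · have h1 : IntegrableOn (fun t : ℝ => t ^ (α - 1) * (2 * ‖(u : H)‖)) (Ioc 0 1) := by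
      refine Integrable.mul_const ?_ _
      have := intervalIntegral.intervalIntegrable_rpow' (a := 0) (b := 1) (r := α - 1) (by linarith)
      rwa [intervalIntegrable_iff_integrableOn_Ioc_of_le zero_le_one] at this
    refine Integrable.mono' h1
      ((hc.mono Ioc_subset_Ioi_self).aestronglyMeasurable measurableSet_Ioc) ?_
    refine (ae_restrict_iff' measurableSet_Ioc).2 (ae_of_all _ fun t ht => ?_)
    rw [hn t ht.1]
    have := norm_resolventOp_apply_le hJ hacc ht.1 u
    have := Real.rpow_pos_of_pos ht.1 (α - 1)
    gcongr
  · have h1 : IntegrableOn (fun t : ℝ => t ^ (α - 2) * ‖J u‖) (Ioi 1) :=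
      (integrableOn_Ioi_rpow_of_lt (by linarith) zero_lt_one).mul_const _
    refine Integrable.mono' h1
      ((hc.mono (Ioi_subset_Ioi zero_le_one)).aestronglyMeasurable measurableSet_Ioi) ?_
    refine (ae_restrict_iff' measurableSet_Ioi).2 (ae_of_all _ fun t ht => ?_)
    have ht0 : 0 < t := zero_lt_one.trans ht
    rw [hn t ht0]
    calc t ^ (α - 1) * ‖resolventOp J t (J u)‖ ≤ t ^ (α - 1) * (t⁻¹ * ‖J u‖) := by
          have := Real.rpow_pos_of_pos ht0 (α - 1)
          have := norm_resolventOp_le hJ hacc ht0 (J u)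
          gcongr
      _ = t ^ (α - 2) * ‖J u‖ := by
          rw [← mul_assoc, ← Real.rpow_neg_one t, ← Real.rpow_add ht0]
          congr 2
          ring

theorem balakrishnan_domain (hJ : MAccretive J)
    (hacc : ∀ u : J.domain, 0 ≤ (inner ℂ (u : H) (J u)).re)
    {α : ℝ} (hα0 : 0 < α) (hα1 : α < 1) :
    (balakrishnan J α).domain = J.domain :=
  le_antisymm (fun _ h => h.choose)
    (fun u hu => ⟨hu, integrableOn_balaIntegrand hJ hacc hα0 hα1 ⟨u, hu⟩⟩)

/-- The function `t ↦ (t + J)⁻¹ g` is decreasing in the sense of the inner product. -/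
theorem norm_sq_le_re_inner_resolventOp (hJ : MAccretive J)
    (hacc : ∀ u : J.domain, 0 ≤ (inner ℂ (u : H) (J u)).re)
    {s t : ℝ} (hs : 0 < s) (hst : s ≤ t) (g : H) :
    ‖resolventOp J t g‖ ^ 2 ≤ (inner ℂ (resolventOp J t g) (resolventOp J s g)).re := by
  have h1 := resolventOp_sub hJ hs (hs.trans_le hst) g
  have h2 := re_inner_resolvent_nonneg hacc (ζ := s) (by simpa using hs)
    (isResolvent_resolventOp hJ (by simpa using hs)) (resolventOp J t g)
  -- By the resolvent identity the difference is `(t - s) (s + J)⁻¹` applied to `(t + J)⁻¹ g`, and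
  -- `(s + J)⁻¹` is accretive, so pairing with `(t + J)⁻¹ g` gives a nonnegative real part.
  have h3 : resolventOp J s g = resolventOp J t g
      + ((t - s : ℝ) : ℂ) • resolventOp J s (resolventOp J t g) := by
    rw [← h1]; abel
  rw [h3, inner_add_right, inner_smul_right, inner_self_eq_norm_sq_to_K, Complex.add_re,
    Complex.re_ofReal_mul, ← inner_conj_symm, Complex.conj_re]
  have h4 : (((‖resolventOp J t g‖ : ℂ)) ^ 2).re = ‖resolventOp J t g‖ ^ 2 := by
    rw [← Complex.ofReal_pow, Complex.ofReal_re]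
  have h5 : 0 ≤ (t - s) * (inner ℂ (resolventOp J s (resolventOp J t g)) (resolventOp J t g)).re :=
    mul_nonneg (by linarith) h2
  change _ ≤ (((‖resolventOp J t g‖ : ℂ)) ^ 2).re + _
  rw [h4]
  linarith

/-- A quadratic estimate for the resolvent in terms of the fractional power. -/
theorem lintegral_sq_resolventOp_le [CompleteSpace H] (hJ : MAccretive J)
    (hacc : ∀ u : J.domain, 0 ≤ (inner ℂ (u : H) (J u)).re)
    {α : ℝ} (hα0 : 0 < α) (hα1 : α < 1) (u : J.domain) :
    ∫⁻ t in Ioi (0 : ℝ), ENNReal.ofReal (t ^ (2 * α - 1) * ‖resolventOp J t (J u)‖ ^ 2)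
      ≤ ENNReal.ofReal (α * ‖∫ t in Ioi (0 : ℝ), balaIntegrand J α (J u) t‖ ^ 2) := by
  have hint := integrableOn_balaIntegrand hJ hacc hα0 hα1 u
  set φ := balaIntegrand J α (J u) with hφ
  set I := ∫ t in Ioi (0 : ℝ), φ t with hI
  let L : H → H →L[ℝ] ℝ := fun c => Complex.reCLM.comp ((innerSL ℂ c).restrictScalars ℝ)
  have hL : ∀ c f, L c f = (inner ℂ c f).re := fun c f => rfl
  have hLφ : ∀ {s t : ℝ}, L (φ t) (φ s) = t ^ (α - 1) * (s ^ (α - 1) *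
      (inner ℂ (resolventOp J t (J u)) (resolventOp J s (J u))).re) := by
    intro s t
    simp only [hL, hφ, balaIntegrand, inner_smul_left, inner_smul_right, Complex.conj_ofReal,
      Complex.re_ofReal_mul]
    ring
  -- `L I (φ t)` is an integral over `s` of the nonnegative numbers `Re ⟨φ t, φ s⟩`. Only the part
  -- `s ≤ t` is kept, where monotonicity of the resolvent applies; `∫₀ᵗ s ^ (α - 1) ds = t ^ α / α`
  -- produces the constant. Integrating in `t` then turns the right side into `α ‖I‖²`.
  have key : ∀ t : ℝ, 0 < t → t ^ (2 * α - 1) * ‖resolventOp J t (J u)‖ ^ 2 ≤ α * L I (φ t) := by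
    intro t ht
    have h1 : L I (φ t) = ∫ s in Ioi (0 : ℝ), L (φ t) (φ s) := by
      rw [(L (φ t)).integral_comp_comm hint, hL, hL, ← inner_conj_symm, Complex.conj_re]
    have hpos : ∀ s : ℝ, 0 < s → 0 ≤ L (φ t) (φ s) := by
      intro s hs
      rw [hLφ]
      have ha := Real.rpow_pos_of_pos ht (α - 1)
      have hb := Real.rpow_pos_of_pos hs (α - 1)
      refine mul_nonneg ha.le (mul_nonneg hb.le ?_)
      rcases le_total s t with h | h
      · exact (sq_nonneg _).trans (norm_sq_le_re_inner_resolventOp hJ hacc hs h _)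
      · rw [← inner_conj_symm, Complex.conj_re]
        exact (sq_nonneg _).trans (norm_sq_le_re_inner_resolventOp hJ hacc ht h _)
    have hLi : IntegrableOn (fun s => L (φ t) (φ s)) (Ioi 0) := (L (φ t)).integrable_comp hint
    have hrp : IntegrableOn (fun s : ℝ => s ^ (α - 1)) (Ioc 0 t) := by
      have := intervalIntegral.intervalIntegrable_rpow' (a := 0) (b := t) (r := α - 1) (by linarith)
      rwa [intervalIntegrable_iff_integrableOn_Ioc_of_le ht.le] at this
    have h2 : ∫ s in Ioc (0 : ℝ) t, s ^ (α - 1) * (t ^ (α - 1) * ‖resolventOp J t (J u)‖ ^ 2)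
        ≤ L I (φ t) := by
      rw [h1]
      refine le_trans ?_ (setIntegral_mono_set hLi
        ((ae_restrict_iff' measurableSet_Ioi).2 (ae_of_all _ fun s hs => hpos s hs))
        (LE.le.eventuallyLE (show Ioc 0 t ≤ Ioi 0 from Ioc_subset_Ioi_self)))
      refine setIntegral_mono_on (hrp.mul_const _) (hLi.mono_set Ioc_subset_Ioi_self)
        measurableSet_Ioc fun s hs => ?_
      rw [hLφ]
      have := norm_sq_le_re_inner_resolventOp hJ hacc hs.1 hs.2 (J u)
      have ha := Real.rpow_pos_of_pos ht (α - 1)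
      have hb := Real.rpow_pos_of_pos hs.1 (α - 1)
      calc _ = t ^ (α - 1) * (s ^ (α - 1) * ‖resolventOp J t (J u)‖ ^ 2) := by ring
        _ ≤ _ := by gcongr
    rw [integral_mul_const, ← intervalIntegral.integral_of_le ht.le,
      integral_rpow (Or.inl (by linarith)), sub_add_cancel, Real.zero_rpow hα0.ne', sub_zero] at h2
    have h3 : t ^ α * t ^ (α - 1) = t ^ (2 * α - 1) := by
      rw [← Real.rpow_add ht]; congr 1; ring
    calc t ^ (2 * α - 1) * ‖resolventOp J t (J u)‖ ^ 2
        = α * (t ^ α / α * (t ^ (α - 1) * ‖resolventOp J t (J u)‖ ^ 2)) := by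
          rw [← h3]; field_simp
      _ ≤ _ := by gcongr
  have h4 : ∫ t in Ioi (0 : ℝ), α * L I (φ t) = α * ‖I‖ ^ 2 := by
    rw [integral_const_mul, (L I).integral_comp_comm hint, hL, inner_self_eq_norm_sq_to_K]
    congr 1
    change (((‖I‖ : ℂ)) ^ 2).re = _
    rw [← Complex.ofReal_pow, Complex.ofReal_re]
  rw [← h4, ofReal_integral_eq_lintegral_ofReal (((L I).integrable_comp hint).const_mul α)]
  · refine setLIntegral_mono_ae' measurableSet_Ioi (ae_of_all _ fun t ht => ?_)
    exact ENNReal.ofReal_le_ofReal (key t ht)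
  · refine (ae_restrict_iff' measurableSet_Ioi).2 (ae_of_all _ fun t ht => ?_)
    refine le_trans ?_ (key t ht)
    have := Real.rpow_pos_of_pos ht (2 * α - 1)
    change 0 ≤ _
    positivity

end Balakrishnan

end Operators

/-! ### Primitives and weak derivatives on `(a, b)` -/

section Sobolev

variable {a b : ℝ}

/-- The primitive `x ↦ ∫ₐˣ g` of a function on `(a, b)`, constant outside `(a, b)`. -/
def prim (a b : ℝ) (g : ℝ → ℂ) (x : ℝ) : ℂ := ∫ s in Iio x, g s ∂(mu a b)

theorem prim_congr {g g' : ℝ → ℂ} (h : g =ᵐ[mu a b] g') : prim a b g = prim a b g' :=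
  funext fun _ => integral_congr_ae (ae_restrict_of_ae h)

theorem norm_setIntegral_L2_le (g : L2 a b) {s : Set ℝ} (hs : MeasurableSet s) :
    ‖∫ x in s, g x ∂(mu a b)‖ ≤ √((mu a b).real s) * ‖g‖ := by
  have h := L2.inner_indicatorConstLp_one (𝕜 := ℂ) hs (measure_ne_top (mu a b) s) g
  rw [← h]
  refine (norm_inner_le_norm _ _).trans ?_
  rw [norm_indicatorConstLp (by norm_num) (by norm_num), norm_one, one_mul, Real.sqrt_eq_rpow]
  norm_num

theorem prim_sub_prim {g : ℝ → ℂ} (hg : Integrable g (mu a b)) {x y : ℝ} (h : x ≤ y) :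
    prim a b g y - prim a b g x = ∫ s in Ico x y, g s ∂(mu a b) := by
  rw [prim, prim, ← Iio_union_Ico_eq_Iio h, setIntegral_union _ measurableSet_Ico hg.integrableOn
    hg.integrableOn, add_sub_cancel_left]
  exact Set.disjoint_left.2 fun z hz hz' => not_lt.2 hz'.1 hz

/-- Cauchy–Schwarz on `[x, y)`. This Hölder bound gives both the continuity of primitives and the
compactness of `primL`. -/
theorem norm_prim_sub_le (g : L2 a b) {x y : ℝ} (h : x ≤ y) :
    ‖prim a b g y - prim a b g x‖ ≤ √(y - x) * ‖g‖ := by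
  rw [prim_sub_prim (integrable_L2 g) h]
  refine (norm_setIntegral_L2_le g measurableSet_Ico).trans ?_
  have : (mu a b).real (Ico x y) ≤ y - x := by
    have h1 : (mu a b) (Ico x y) ≤ ENNReal.ofReal (y - x) :=
      (Measure.restrict_apply_le _ _).trans_eq Real.volume_Ico
    exact ENNReal.toReal_le_of_le_ofReal (by linarith) h1
  gcongr

theorem continuous_prim (g : L2 a b) : Continuous (prim a b g) := by
  have key : ∀ x y, ‖prim a b g y - prim a b g x‖ ≤ √|y - x| * ‖g‖ := by
    intro x y
    rcases le_total x y with h | h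
    · rw [abs_of_nonneg (by linarith)]
      exact norm_prim_sub_le g h
    · rw [abs_sub_comm, norm_sub_rev, abs_of_nonneg (by linarith)]
      exact norm_prim_sub_le g h
  rw [continuous_iff_continuousAt]
  intro x
  rw [ContinuousAt, tendsto_iff_norm_sub_tendsto_zero]
  have h1 : Continuous fun y : ℝ => √|y - x| * ‖g‖ := by fun_prop
  exact squeeze_zero (fun _ => norm_nonneg _) (fun y => key x y) (by simpa using h1.tendsto x)

theorem norm_prim_le (g : L2 a b) (x : ℝ) : ‖prim a b g x‖ ≤ √((mu a b).real univ) * ‖g‖ := by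
  refine (norm_setIntegral_L2_le g measurableSet_Iio).trans ?_
  have : (mu a b).real (Iio x) ≤ (mu a b).real univ := measureReal_mono (subset_univ _)
  gcongr

theorem memLp_prim (g : L2 a b) : MemLp (prim a b g) 2 (mu a b) :=
  MemLp.of_bound (continuous_prim g).aestronglyMeasurable _ (ae_of_all _ (norm_prim_le g))

/-- The primitive as a bounded operator in `L²(a, b)`. -/
def primL (a b : ℝ) : L2 a b →L[ℂ] L2 a b :=
  LinearMap.mkContinuous
    { toFun := fun g => (memLp_prim g).toLp
      map_add' := fun g g' => by
        rw [← MemLp.toLp_add]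
        refine MemLp.toLp_congr _ _ (ae_of_all _ fun x => ?_)
        rw [prim_congr (Lp.coeFn_add g g'), Pi.add_apply]
        exact integral_add (integrable_L2 g).integrableOn (integrable_L2 g').integrableOn
      map_smul' := fun c g => by
        rw [RingHom.id_apply, ← MemLp.toLp_const_smul]
        refine MemLp.toLp_congr _ _ (ae_of_all _ fun x => ?_)
        rw [prim_congr (Lp.coeFn_smul c g)]
        exact integral_smul c _ }
    ((mu a b).real univ) (fun g => by
      have := Lp.norm_le_of_ae_bound (f := (memLp_prim g).toLp) (p := 2)
        (C := √((mu a b).real univ) * ‖g‖) (by positivity) (by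
          filter_upwards [(memLp_prim g).coeFn_toLp] with x hx
          rw [hx]
          exact norm_prim_le g x)
      refine this.trans_eq ?_
      have h2 : (measureUnivNNReal (mu a b) : ℝ) = (mu a b).real univ := rfl
      have h3 : (mu a b).real univ ^ (ENNReal.toReal 2)⁻¹ = √((mu a b).real univ) := by
        rw [Real.sqrt_eq_rpow]
        norm_num
      rw [h2, h3, ← mul_assoc, Real.mul_self_sqrt measureReal_nonneg])

theorem primL_coe (g : L2 a b) : primL a b g =ᵐ[mu a b] prim a b g :=
  (memLp_prim g).coeFn_toLp

/-- Fubini on the triangle `s < x`. This is integration by parts for merely integrable functions,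
the product of the total integrals being the boundary term. -/
theorem integral_prim_mul {g h : ℝ → ℂ} (hg : Integrable g (mu a b)) (hh : Integrable h (mu a b)) :
    ∫ x in Ioo a b, prim a b g x * h x
      = (∫ x in Ioo a b, g x) * (∫ x in Ioo a b, h x) - ∫ x in Ioo a b, g x * prim a b h x := by
  have h1 : ∀ x, prim a b g x * h x
      = ∫ s, (if s < x then g s * h x else 0) ∂(mu a b) := by
    intro x
    rw [prim, ← integral_indicator measurableSet_Iio, ← integral_mul_const]
    congr 1
    funext s
    by_cases hs : s < x <;> simp [indicator, hs]
  have h2 : ∀ s, ∫ x, (if s < x then g s * h x else 0) ∂(mu a b)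
      = g s * (∫ x in Ioo a b, h x) - g s * prim a b h s := by
    intro s
    have e1 : ∫ x, (if s < x then g s * h x else 0) ∂(mu a b)
        = g s * ∫ x in Ioi s, h x ∂(mu a b) := by
      rw [← integral_indicator measurableSet_Ioi, ← integral_const_mul]
      congr 1
      funext x
      by_cases hs : s < x <;> simp [indicator, hs]
    have e2 := integral_add_compl (μ := mu a b) (s := Iio s) measurableSet_Iio hh
    rw [compl_Iio, integral_Ici_eq_integral_Ioi] at e2
    rw [e1, ← mul_sub, ← e2, prim]
    ring
  have hint : Integrable (fun p : ℝ × ℝ => if p.2 < p.1 then g p.2 * h p.1 else 0)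
      ((mu a b).prod (mu a b)) := by
    have := (hh.mul_prod hg).indicator
      (measurableSet_lt measurable_snd measurable_fst : MeasurableSet {p : ℝ × ℝ | p.2 < p.1})
    refine this.congr (ae_of_all _ fun p => ?_)
    by_cases hp : p.2 < p.1 <;> simp [indicator, hp, mul_comm]
  calc ∫ x in Ioo a b, prim a b g x * h x
      = ∫ x, ∫ s, (if s < x then g s * h x else 0) ∂(mu a b) ∂(mu a b) :=
        integral_congr_ae (ae_of_all _ h1)
    _ = ∫ s, ∫ x, (if s < x then g s * h x else 0) ∂(mu a b) ∂(mu a b) :=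
        integral_integral_swap hint
    _ = ∫ s, (g s * (∫ x in Ioo a b, h x) - g s * prim a b h s) ∂(mu a b) :=
        integral_congr_ae (ae_of_all _ h2)
    _ = _ := by
        rw [integral_sub, integral_mul_const]
        · exact hg.mul_const _
        · refine ((hg.mul_const (∫ x in Ioo a b, h x)).sub (hint.integral_prod_right.congr (ae_of_all _ h2))).congr
            (ae_of_all _ fun s => ?_)
          simp

theorem prim_deriv {ψ : ℝ → ℂ} (hd : Differentiable ℝ ψ) (hc : Continuous (deriv ψ)) {x : ℝ}
    (hx : x ∈ Icc a b) : prim a b (deriv ψ) x = ψ x - ψ a := by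
  rw [prim, Measure.restrict_restrict measurableSet_Iio]
  have : Iio x ∩ Ioo a b = Ioo a x := by
    ext s
    simp only [mem_inter_iff, mem_Iio, mem_Ioo]
    constructor
    · rintro ⟨h1, h2, h3⟩; exact ⟨h2, h1⟩
    · rintro ⟨h1, h2⟩; exact ⟨h2, h1, h2.trans_le hx.2⟩
  rw [this, ← integral_Ioc_eq_integral_Ioo, ← intervalIntegral.integral_of_le hx.1]
  exact intervalIntegral.integral_deriv_eq_sub (fun y _ => hd y) (hc.intervalIntegrable _ _)

theorem integral_deriv_Ioo (hab : a ≤ b) {ψ : ℝ → ℂ} (hd : Differentiable ℝ ψ)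
    (hc : Continuous (deriv ψ)) : ∫ x in Ioo a b, deriv ψ x = ψ b - ψ a := by
  rw [← integral_Ioc_eq_integral_Ioo, ← intervalIntegral.integral_of_le hab]
  exact intervalIntegral.integral_deriv_eq_sub (fun y _ => hd y) (hc.intervalIntegrable _ _)

theorem integrable_of_continuous {ψ : ℝ → ℂ} (hc : Continuous ψ) : Integrable ψ (mu a b) :=
  (hc.integrableOn_Icc (a := a) (b := b)).mono_set Ioo_subset_Icc_self

theorem memLp_of_continuous {ψ : ℝ → ℂ} (hc : Continuous ψ) : MemLp ψ 2 (mu a b) := by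
  obtain ⟨C, hC⟩ := (isCompact_Icc (a := a) (b := b)).exists_bound_of_continuousOn hc.continuousOn
  refine MemLp.of_bound hc.aestronglyMeasurable C ?_
  exact (ae_restrict_iff' measurableSet_Ioo).2 (ae_of_all _ fun x hx => hC x (Ioo_subset_Icc_self hx))

theorem IsTest.eq_zero_left {φ : ℝ → ℂ} (h : IsTest a b φ) : φ a = 0 :=
  image_eq_zero_of_notMem_tsupport fun ha => lt_irrefl _ (h.2.2 ha).1

theorem IsTest.eq_zero_right {φ : ℝ → ℂ} (h : IsTest a b φ) : φ b = 0 :=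
  image_eq_zero_of_notMem_tsupport fun ha => lt_irrefl _ (h.2.2 ha).2

theorem IsTest.prim_deriv {φ : ℝ → ℂ} (h : IsTest a b φ) {x : ℝ} (hx : x ∈ Icc a b) :
    prim a b (deriv φ) x = φ x := by
  rw [FracOp.prim_deriv (h.1.differentiable (by simp)) h.deriv_cont hx, h.eq_zero_left, sub_zero]

theorem IsTest.integral_deriv {φ : ℝ → ℂ} (hab : a ≤ b) (h : IsTest a b φ) :
    ∫ x in Ioo a b, deriv φ x = 0 := by
  rw [integral_deriv_Ioo hab (h.1.differentiable (by simp)) h.deriv_cont, h.eq_zero_left,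
    h.eq_zero_right, sub_zero]

theorem HasWeakDeriv.congr {u u' v v' : ℝ → ℂ} (h : HasWeakDeriv a b u v) (hu : u =ᵐ[mu a b] u')
    (hv : v =ᵐ[mu a b] v') : HasWeakDeriv a b u' v' := by
  intro φ hφ
  rw [← integral_congr_ae (hu.mono fun x hx => by simp only [hx] : (fun x => u x * deriv φ x)
      =ᵐ[mu a b] fun x => u' x * deriv φ x), h φ hφ,
    integral_congr_ae (hv.mono fun x hx => by simp only [hx] : (fun x => v x * φ x)
      =ᵐ[mu a b] fun x => v' x * φ x)]

theorem hasWeakDeriv_prim (hab : a ≤ b) {g : ℝ → ℂ} (hg : Integrable g (mu a b)) :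
    HasWeakDeriv a b (prim a b g) g := by
  intro φ hφ
  rw [integral_prim_mul hg (integrable_of_continuous hφ.deriv_cont), hφ.integral_deriv hab, mul_zero,
    zero_sub]
  congr 1
  refine setIntegral_congr_fun measurableSet_Ioo fun x hx => ?_
  simp only [hφ.prim_deriv (Ioo_subset_Icc_self hx)]

/-- The primitive from `a` vanishes to the left of the support of `θ`, and to its right because the
total integral is zero. -/
theorem exists_isTest_deriv_eq (hab : a < b) {θ : ℝ → ℂ} (hθ : IsTest a b θ)
    (h0 : ∫ x in Ioo a b, θ x = 0) : ∃ φ, IsTest a b φ ∧ deriv φ = θ := by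
  have hc := hθ.1.continuous
  -- The midpoint is added so that the compact set is nonempty, and has a least and a greatest
  -- element, even when `θ = 0`.
  have hK : IsCompact (insert ((a + b) / 2) (tsupport θ)) := hθ.2.1.isCompact.insert _
  have hKs : insert ((a + b) / 2) (tsupport θ) ⊆ Ioo a b :=
    insert_subset ⟨by linarith, by linarith⟩ hθ.2.2
  obtain ⟨a', ha', hle⟩ := hK.exists_isLeast (insert_nonempty _ _)
  obtain ⟨b', hb', hge⟩ := hK.exists_isGreatest (insert_nonempty _ _)
  have hsupp : ∀ x, x ∉ Icc a' b' → θ x = 0 := fun x hx =>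
    image_eq_zero_of_notMem_tsupport fun h =>
      hx ⟨hle (mem_insert_of_mem _ h), hge (mem_insert_of_mem _ h)⟩
  have haa := (hKs ha').1
  have hbb := (hKs hb').2
  let φ : ℝ → ℂ := fun x => ∫ t in a..x, θ t
  have hd : ∀ x, HasDerivAt φ (θ x) x := fun x =>
    intervalIntegral.integral_hasDerivAt_right (hc.intervalIntegrable _ _)
      (hc.stronglyMeasurableAtFilter _ _) hc.continuousAt
  have hderiv : deriv φ = θ := funext fun x => (hd x).deriv
  have hzero : ∀ x, x ∉ Icc a' b' → φ x = 0 := by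
    intro x hx
    rcases lt_or_ge x a' with h | h
    · have : ∀ t ∈ uIcc a x, θ t = 0 := by
        intro t ht
        refine hsupp t fun h' => ?_
        have := ht.2
        rcases max_choice a x with h2 | h2 <;> rw [h2] at this <;> linarith [h'.1]
      exact (intervalIntegral.integral_congr this).trans (by simp)
    · have hx' : b' < x := by
        by_contra h3
        exact hx ⟨h, not_lt.1 h3⟩
      have e1 : ∫ t in a..b, θ t = 0 := by
        rw [intervalIntegral.integral_of_le hab.le, integral_Ioc_eq_integral_Ioo, h0]
      have e2 : ∫ t in b..x, θ t = 0 := by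
        have : ∀ t ∈ uIcc b x, θ t = 0 := by
          intro t ht
          refine hsupp t fun h' => ?_
          have := ht.1
          rcases min_choice b x with h2 | h2 <;> rw [h2] at this <;> linarith [h'.2]
        exact (intervalIntegral.integral_congr this).trans (by simp)
      change ∫ t in a..x, θ t = 0
      rw [← intervalIntegral.integral_add_adjacent_intervals (b := b)
        (hc.intervalIntegrable _ _) (hc.intervalIntegrable _ _), e1, e2, add_zero]
  have hts : tsupport φ ⊆ Icc a' b' := by
    refine closure_minimal (fun x hx => ?_) isClosed_Icc
    by_contra h
    exact hx (hzero x h)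
  refine ⟨φ, ⟨?_, ?_, fun x hx => ?_⟩, hderiv⟩
  · rw [contDiff_infty_iff_deriv, hderiv]
    exact ⟨fun x => (hd x).differentiableAt, hθ.1⟩
  · exact isCompact_Icc.of_isClosed_subset (isClosed_tsupport φ) hts
  · exact ⟨haa.trans_le (hts hx).1, (hts hx).2.trans_lt hbb⟩

theorem exists_isTest_integral_eq_one (hab : a < b) :
    ∃ η, IsTest a b η ∧ ∫ x in Ioo a b, η x = 1 := by
  let f : ContDiffBump ((a + b) / 2) := ⟨(b - a) / 8, (b - a) / 4, by linarith, by linarith⟩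
  let η : ℝ → ℂ := fun x => (f.normed volume x : ℂ)
  have hs : tsupport η ⊆ Metric.closedBall ((a + b) / 2) ((b - a) / 4) := by
    refine closure_minimal (fun x hx => ?_) Metric.isClosed_closedBall
    have : f.normed volume x ≠ 0 := fun h => hx (by simp [η, h])
    have h2 : x ∈ Function.support (f.normed volume) := this
    rw [f.support_normed_eq] at h2
    exact Metric.ball_subset_closedBall h2
  have hsub : Metric.closedBall ((a + b) / 2) ((b - a) / 4) ⊆ Ioo a b := by
    rw [Real.closedBall_eq_Icc]
    exact fun x hx => ⟨by linarith [hx.1], by linarith [hx.2]⟩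
  refine ⟨η, ⟨Complex.ofRealCLM.contDiff.comp f.contDiff_normed, ?_, hs.trans hsub⟩, ?_⟩
  · exact (isCompact_closedBall _ _).of_isClosed_subset (isClosed_tsupport η) hs
  · rw [setIntegral_eq_integral_of_forall_compl_eq_zero]
    · change ∫ x, ((f.normed volume x : ℝ) : ℂ) = 1
      rw [integral_complex_ofReal, f.integral_normed, Complex.ofReal_one]
    · exact fun x hx => image_eq_zero_of_notMem_tsupport fun h => hx (hsub (hs h))

theorem IsTest.sub_const_mul {φ ψ : ℝ → ℂ} (hφ : IsTest a b φ) (hψ : IsTest a b ψ) (c : ℂ) :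
    IsTest a b (fun x => φ x - c * ψ x) := by
  have hs : tsupport (fun x => φ x - c * ψ x) ⊆ tsupport φ ∪ tsupport ψ := by
    refine closure_minimal (fun x hx => ?_) ((isClosed_tsupport φ).union (isClosed_tsupport ψ))
    by_contra h
    rw [mem_union, not_or] at h
    exact hx (by simp [image_eq_zero_of_notMem_tsupport h.1, image_eq_zero_of_notMem_tsupport h.2])
  exact ⟨hφ.1.sub (contDiff_const.mul hψ.1),
    (hφ.2.1.isCompact.union hψ.2.1.isCompact).of_isClosed_subset (isClosed_tsupport _) hs,
    hs.trans (union_subset hφ.2.2 hψ.2.2)⟩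

/-- The lemma of du Bois-Reymond. -/
theorem ae_eq_const_of_integral_mul_deriv (hab : a < b) (h : L2 a b)
    (h0 : ∀ φ, IsTest a b φ → ∫ x in Ioo a b, h x * deriv φ x = 0) :
    ∃ c : ℂ, h =ᵐ[mu a b] fun _ => c := by
  obtain ⟨η, hη, hη1⟩ := exists_isTest_integral_eq_one hab
  let c : ℂ := ∫ x in Ioo a b, h x * η x
  refine ⟨c, ?_⟩
  let k : L2 a b := (memLp_of_continuous (continuous_const (y := c))).toLp
  have hk : k =ᵐ[mu a b] fun _ => c := MemLp.coeFn_toLp _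
  refine EventuallyEq.trans ?_ hk
  -- The function `ψ - (∫ ψ) η` has mean zero, hence is the derivative of a test function and is
  -- annihilated by `h`. So `h` acts on `ψ` as the constant `c = ∫ h η`.
  have hpair : ∀ ψ, IsTest a b ψ → ∫ x in Ioo a b, (h - k : L2 a b) x * ψ x = 0 := by
    intro ψ hψ
    have hθ := hψ.sub_const_mul hη (∫ x in Ioo a b, ψ x)
    obtain ⟨φ, hφ, hφd⟩ := exists_isTest_deriv_eq hab hθ (by
      rw [integral_sub (integrable_of_continuous hψ.1.continuous)
        ((integrable_of_continuous hη.1.continuous).const_mul _), integral_const_mul, hη1, mul_one,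
        sub_self])
    have e1 := h0 φ hφ
    rw [hφd] at e1
    have i1 := integrable_mul_of_compact h hψ.1.continuous hψ.2.1
    have i2 := integrable_mul_of_compact h hη.1.continuous hη.2.1
    have e2 : ∫ x in Ioo a b, h x * (ψ x - (∫ x in Ioo a b, ψ x) * η x)
        = (∫ x in Ioo a b, h x * ψ x) - (∫ x in Ioo a b, ψ x) * c := by
      rw [← integral_const_mul, ← integral_sub i1 (i2.const_mul _)]
      congr 1
      funext x
      ring
    rw [e2] at e1
    have e3 : ∫ x in Ioo a b, (h - k : L2 a b) x * ψ x
        = ∫ x in Ioo a b, (h x * ψ x - c * ψ x) := by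
      refine integral_congr_ae ?_
      filter_upwards [Lp.coeFn_sub h k, hk] with x hx hx'
      rw [hx, Pi.sub_apply, hx', sub_mul]
    rw [e3, integral_sub i1 ((integrable_of_continuous hψ.1.continuous).const_mul _),
      integral_const_mul, ← e1]
    ring
  -- Annihilating all test functions means being a weak derivative of `0`; uniqueness of weak
  -- derivatives then gives `h = k`.
  have hw : HasWeakDeriv a b (fun _ => 0) (h - k : L2 a b) := by
    intro ψ hψ
    rw [hpair ψ hψ]
    simp
  have hw0 : HasWeakDeriv a b (fun _ => 0) (0 : L2 a b) := by
    intro ψ hψ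
    have : ∫ x in Ioo a b, (0 : L2 a b) x * ψ x = 0 := by
      refine integral_eq_zero_of_ae ?_
      filter_upwards [Lp.coeFn_zero ℂ 2 (mu a b)] with x hx
      rw [hx]; simp
    rw [this]
    simp
  rw [sub_eq_zero.1 (hw.unique hw0)]

/-- A function with a weak derivative in `L²` is the primitive of its derivative, up to a
constant. -/
theorem HasWeakDeriv.exists_eq_prim (hab : a < b) {u v : L2 a b} (h : HasWeakDeriv a b u v) :
    ∃ c : ℂ, u =ᵐ[mu a b] fun x => prim a b v x + c := by
  obtain ⟨c, hc⟩ := ae_eq_const_of_integral_mul_deriv hab (u - primL a b v) (by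
    intro φ hφ
    have e1 := h φ hφ
    have e2 := hasWeakDeriv_prim hab.le (integrable_L2 v) φ hφ
    have e3 : ∫ x in Ioo a b, (u - primL a b v : L2 a b) x * deriv φ x
        = ∫ x in Ioo a b, (u x * deriv φ x - primL a b v x * deriv φ x) := by
      refine integral_congr_ae ?_
      filter_upwards [Lp.coeFn_sub u (primL a b v)] with x hx
      rw [hx, Pi.sub_apply, sub_mul]
    have e4 : ∫ x in Ioo a b, primL a b v x * deriv φ x
        = ∫ x in Ioo a b, prim a b v x * deriv φ x := by
      refine integral_congr_ae ?_
      filter_upwards [primL_coe v] with x hx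
      rw [hx]
    rw [e3, integral_sub (integrable_mul_of_compact _ hφ.deriv_cont hφ.2.1.deriv)
      (integrable_mul_of_compact _ hφ.deriv_cont hφ.2.1.deriv), e4, e1, e2, sub_self])
  refine ⟨c, ?_⟩
  filter_upwards [hc, Lp.coeFn_sub u (primL a b v), primL_coe v] with x h1 h2 h3
  rw [← h1, h2, Pi.sub_apply, h3]
  ring

/-- Integration by parts against the primitive of a function with mean value zero. -/
theorem HasWeakDeriv.integral_mul (hab : a < b) {u v : L2 a b} (h : HasWeakDeriv a b u v)
    {g : ℝ → ℂ} (hg : MemLp g 2 (mu a b)) (h0 : ∫ x in Ioo a b, g x = 0) :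
    ∫ x in Ioo a b, u x * g x = -∫ x in Ioo a b, v x * prim a b g x := by
  have hgi : Integrable g (mu a b) := hg.integrable (by norm_num)
  obtain ⟨c, hc⟩ := h.exists_eq_prim hab
  have hpg : Integrable (fun x => prim a b v x * g x) (mu a b) :=
    hgi.bdd_mul (continuous_prim v).aestronglyMeasurable (ae_of_all _ (norm_prim_le v))
  have e1 : ∫ x in Ioo a b, u x * g x = ∫ x in Ioo a b, (prim a b v x * g x + c * g x) := by
    refine integral_congr_ae ?_
    filter_upwards [hc] with x hx
    rw [hx, add_mul]
  rw [e1, integral_add hpg (hgi.const_mul c), integral_prim_mul (integrable_L2 v) hgi,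
    integral_const_mul, h0]
  ring

end Sobolev

/-! ### Mean-zero functions, the description of `H¹₀`, the product rule -/

section Sobolev

variable {a b : ℝ}

/-- The functions with mean value zero. -/
def meanZero (a b : ℝ) : Submodule ℂ (L2 a b) where
  carrier := {g | ∫ x in Ioo a b, g x = 0}
  zero_mem' := by
    refine integral_eq_zero_of_ae ?_
    filter_upwards [Lp.coeFn_zero ℂ 2 (mu a b)] with x hx
    rw [hx]
  add_mem' := by
    intro f g hf hg
    change ∫ x in Ioo a b, (f + g : L2 a b) x = 0
    rw [integral_congr_ae (Lp.coeFn_add f g)]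
    exact (integral_add (integrable_L2 f) (integrable_L2 g)).trans (by rw [hf, hg, add_zero])
  smul_mem' := by
    intro c f hf
    change ∫ x in Ioo a b, (c • f : L2 a b) x = 0
    rw [integral_congr_ae (Lp.coeFn_smul c f)]
    exact (integral_smul c _).trans (by rw [hf, smul_zero])

theorem mem_meanZero {g : L2 a b} : g ∈ meanZero a b ↔ ∫ x in Ioo a b, g x = 0 := Iff.rfl

theorem inner_eq_integral (f g : L2 a b) :
    inner ℂ f g = ∫ x in Ioo a b, starRingEnd ℂ (f x) * g x := by
  rw [L2.inner_def]
  refine integral_congr_ae (ae_of_all _ fun x => ?_)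
  simp [mul_comm]

theorem mem_meanZero_iff_inner {g : L2 a b} :
    g ∈ meanZero a b ↔ inner ℂ (indicatorConstLp 2 MeasurableSet.univ
      (measure_ne_top (mu a b) univ) (1 : ℂ)) g = 0 := by
  rw [L2.inner_indicatorConstLp_one, Measure.restrict_univ, mem_meanZero]

theorem isClosed_meanZero : IsClosed (meanZero a b : Set (L2 a b)) := by
  have : (meanZero a b : Set (L2 a b)) = {g | inner ℂ (indicatorConstLp 2 MeasurableSet.univ
      (measure_ne_top (mu a b) univ) (1 : ℂ)) g = 0} := by
    ext g
    exact mem_meanZero_iff_inner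
  rw [this]
  exact isClosed_eq (by fun_prop) continuous_const

/-- A test function as an element of `L²`. -/
def IsTest.toL2 {φ : ℝ → ℂ} (h : IsTest a b φ) : L2 a b :=
  (memLp_of_continuous h.1.continuous).toLp

/-- The derivative of a test function as an element of `L²`. -/
def IsTest.derivL2 {φ : ℝ → ℂ} (h : IsTest a b φ) : L2 a b :=
  (memLp_of_continuous h.deriv_cont).toLp

theorem IsTest.toL2_coe {φ : ℝ → ℂ} (h : IsTest a b φ) : h.toL2 =ᵐ[mu a b] φ :=
  MemLp.coeFn_toLp _

theorem IsTest.derivL2_coe {φ : ℝ → ℂ} (h : IsTest a b φ) : h.derivL2 =ᵐ[mu a b] deriv φ :=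
  MemLp.coeFn_toLp _

theorem IsTest.primL_derivL2 {φ : ℝ → ℂ} (h : IsTest a b φ) : primL a b h.derivL2 = h.toL2 := by
  apply Lp.ext
  have : ∀ᵐ x ∂(mu a b), x ∈ Ioo a b := ae_restrict_mem measurableSet_Ioo
  filter_upwards [primL_coe h.derivL2, h.toL2_coe, this] with x h1 h2 h3
  rw [h1, h2, prim_congr h.derivL2_coe, h.prim_deriv (Ioo_subset_Icc_self h3)]

theorem IsTest.derivL2_mem (hab : a ≤ b) {φ : ℝ → ℂ} (h : IsTest a b φ) :
    h.derivL2 ∈ meanZero a b := by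
  rw [mem_meanZero, integral_congr_ae h.derivL2_coe, h.integral_deriv hab]

theorem IsTest.star {φ : ℝ → ℂ} (h : IsTest a b φ) :
    IsTest a b (fun x => starRingEnd ℂ (φ x)) := by
  have hs : tsupport (fun x => starRingEnd ℂ (φ x)) ⊆ tsupport φ := by
    refine closure_mono fun x hx => ?_
    intro h0
    exact hx (by simp [h0])
  exact ⟨Complex.conjCLE.contDiff.comp h.1, h.2.1.isCompact.of_isClosed_subset
    (isClosed_tsupport _) hs, hs.trans h.2.2⟩

theorem deriv_star (φ : ℝ → ℂ) (x : ℝ) :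
    deriv (fun x => starRingEnd ℂ (φ x)) x = starRingEnd ℂ (deriv φ x) :=
  deriv.star

/-- The derivatives of test functions are dense in the space of functions with mean value zero. -/
theorem meanZero_le_of_isClosed (hab : a < b) (S : Submodule ℂ (L2 a b))
    (hS : IsClosed (S : Set (L2 a b))) (h : ∀ φ (hφ : IsTest a b φ), hφ.derivL2 ∈ S) :
    meanZero a b ≤ S := by
  have : CompleteSpace S := hS.completeSpace_coe
  -- A vector orthogonal to `S` is orthogonal to all `φ'`, hence constant by du Bois-Reymond, hence
  -- orthogonal to every mean-zero function.
  rw [← Submodule.orthogonal_orthogonal S]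
  intro g hg
  rw [Submodule.mem_orthogonal]
  intro f hf
  obtain ⟨c, hc⟩ := ae_eq_const_of_integral_mul_deriv hab f (by
    intro φ hφ
    have h1 := (Submodule.mem_orthogonal S f).1 hf _ (h _ hφ.star)
    rw [inner_eq_integral] at h1
    rw [← h1]
    refine integral_congr_ae ?_
    filter_upwards [hφ.star.derivL2_coe] with x hx
    rw [hx, deriv_star, Complex.conj_conj, mul_comm])
  rw [inner_eq_integral]
  have : ∫ x in Ioo a b, starRingEnd ℂ (f x) * g x = ∫ x in Ioo a b, starRingEnd ℂ c * g x := by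
    refine integral_congr_ae ?_
    filter_upwards [hc] with x hx
    rw [hx]
  rw [this, integral_const_mul, mem_meanZero.1 hg, mul_zero]

/-- The pairs `(primL g, g)` with `g` of mean zero form a closed subspace containing all pairs `(φ,
φ')`, so they contain the closure defining `H¹₀`. Conversely the derivatives `φ'` are dense in the
mean-zero functions and `primL` is continuous. -/
theorem mem_H10_iff (hab : a < b) {u : L2 a b} :
    u ∈ H10 a b ↔ ∃ g ∈ meanZero a b, primL a b g = u := by
  constructor
  · rintro ⟨⟨u', g⟩, hug, rfl⟩
    let S : Submodule ℂ (L2 a b × L2 a b) :=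
      (meanZero a b).map ((primL a b : L2 a b →ₗ[ℂ] L2 a b).prod LinearMap.id)
    have hS : (S : Set (L2 a b × L2 a b)) = {p | p.2 ∈ meanZero a b ∧ primL a b p.2 = p.1} := by
      ext ⟨p, q⟩
      constructor
      · rintro ⟨g, hg, h⟩
        cases h
        exact ⟨hg, rfl⟩
      · rintro ⟨h1, h2⟩
        exact ⟨q, h1, Prod.ext h2 rfl⟩
    have hcl : IsClosed (S : Set (L2 a b × L2 a b)) := by
      rw [hS]
      exact (isClosed_meanZero.preimage continuous_snd).inter
        (isClosed_eq (by fun_prop) (by fun_prop))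
    have hle : (Submodule.span ℂ (testGraph a b)).topologicalClosure ≤ S := by
      refine Submodule.topologicalClosure_minimal _ (Submodule.span_le.2 ?_) hcl
      rintro ⟨p, q⟩ ⟨φ, hφ, hp, hq⟩
      have h1 : p = hφ.toL2 := Lp.ext (hp.trans hφ.toL2_coe.symm)
      have h2 : q = hφ.derivL2 := Lp.ext (hq.trans hφ.derivL2_coe.symm)
      rw [hS, h1, h2]
      exact ⟨hφ.derivL2_mem hab.le, hφ.primL_derivL2⟩
    have : (u', g) ∈ (S : Set _) := hle hug
    rw [hS] at this
    exact ⟨g, this.1, this.2⟩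
  · rintro ⟨g, hg, rfl⟩
    let Φ : L2 a b →L[ℂ] L2 a b × L2 a b := (primL a b).prod (ContinuousLinearMap.id ℂ _)
    let S := (Submodule.span ℂ (testGraph a b)).topologicalClosure.comap (Φ : L2 a b →ₗ[ℂ] _)
    have hcl : IsClosed (S : Set (L2 a b)) :=
      (Submodule.isClosed_topologicalClosure _).preimage Φ.continuous
    have := meanZero_le_of_isClosed hab S hcl (fun φ hφ => by
      refine Submodule.le_topologicalClosure _ (Submodule.subset_span ⟨φ, hφ, ?_, hφ.derivL2_coe⟩)
      change (primL a b hφ.derivL2 : L2 a b) =ᵐ[mu a b] φ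
      rw [hφ.primL_derivL2]
      exact hφ.toL2_coe)
    exact ⟨Φ g, this hg, rfl⟩

theorem mem_weakDeriv_domain {u : L2 a b} :
    u ∈ (weakDeriv a b).domain ↔ ∃ v : L2 a b, HasWeakDeriv a b u v := Iff.rfl

theorem weakDeriv_apply {u v : L2 a b} (h : HasWeakDeriv a b u v)
    (hu : u ∈ (weakDeriv a b).domain) : weakDeriv a b ⟨u, hu⟩ = v := ofRel_eq ⟨u, hu⟩ h

theorem hasWeakDeriv_weakDeriv {u : L2 a b} (hu : u ∈ (weakDeriv a b).domain) :
    HasWeakDeriv a b u (weakDeriv a b ⟨u, hu⟩) :=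
  ofRel_spec (R := fun u v : L2 a b => HasWeakDeriv a b u v) ⟨u, hu⟩

theorem hasWeakDeriv_primL (hab : a ≤ b) (g : L2 a b) : HasWeakDeriv a b (primL a b g) g :=
  (hasWeakDeriv_prim hab (integrable_L2 g)).congr (primL_coe g).symm (ae_eq_refl _)

theorem primL_injective (hab : a ≤ b) : Function.Injective (primL a b) := by
  intro g g' h
  have h1 := hasWeakDeriv_primL hab g
  rw [h] at h1
  exact h1.unique (hasWeakDeriv_primL hab g')

theorem continuous_mul_of_tsupport_subset {s : Set ℝ} (hs : IsOpen s) {m χ : ℝ → ℂ}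
    (hm : ContinuousOn m s) (hχ : Continuous χ) (h : tsupport χ ⊆ s) :
    Continuous fun x => m x * χ x := by
  rw [continuous_iff_continuousAt]
  intro x
  by_cases hx : x ∈ tsupport χ
  · exact (hm.continuousAt (hs.mem_nhds (h hx))).mul hχ.continuousAt
  · have h1 : (fun x => m x * χ x) =ᶠ[𝓝 x] fun _ => 0 :=
      (notMem_tsupport_iff_eventuallyEq.1 hx).mono fun y hy => by simp [hy]
    exact continuousAt_const.congr h1.symm

/-- The product rule for weak derivatives. -/
theorem HasWeakDeriv.mul_contDiffOn (hab : a < b) {u v : L2 a b} (h : HasWeakDeriv a b u v)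
    {m : ℝ → ℂ} (hm : ContDiffOn ℝ 1 m (Icc a b)) :
    HasWeakDeriv a b (fun x => m x * u x) (fun x => deriv m x * u x + m x * v x) := by
  intro φ hφ
  have hm1 : ∀ x ∈ Ioo a b, HasDerivAt m (deriv m x) x := fun x hx =>
    ((hm.differentiableOn (by norm_num)).differentiableAt
      (Icc_mem_nhds hx.1 hx.2)).hasDerivAt
  have hmc : ContinuousOn (deriv m) (Ioo a b) :=
    (hm.mono Ioo_subset_Icc_self).continuousOn_deriv_of_isOpen isOpen_Ioo le_rfl
  -- The product `m φ` is only known to be `C¹`, so it need not be an admissible test function. It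
  -- is instead treated as the primitive of the mean-zero function `ψ'`, to which
  -- `HasWeakDeriv.integral_mul` applies.
  let ψ : ℝ → ℂ := fun x => m x * φ x
  let ψ' : ℝ → ℂ := fun x => deriv m x * φ x + m x * deriv φ x
  have hout : ∀ x, x ∉ tsupport φ → ∀ᶠ y in 𝓝 x, φ y = 0 := fun x hx =>
    notMem_tsupport_iff_eventuallyEq.1 hx
  have hψ : ∀ x, HasDerivAt ψ (ψ' x) x := by
    intro x
    by_cases hx : x ∈ tsupport φ
    · exact (hm1 x (hφ.2.2 hx)).mul ((hφ.1.differentiable (by simp)) x).hasDerivAt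
    · have h1 : ψ =ᶠ[𝓝 x] fun _ => 0 := (hout x hx).mono fun y hy => by simp [ψ, hy]
      have h2 : ψ' x = 0 := by
        have h3 : deriv φ x = 0 := by
          rw [Filter.EventuallyEq.deriv_eq (f := fun _ => (0 : ℂ)) (hout x hx), deriv_const]
        simp [ψ', h3, image_eq_zero_of_notMem_tsupport hx]
      rw [h2]
      exact (hasDerivAt_const x (0 : ℂ)).congr_of_eventuallyEq h1
  have hmφ' : Continuous fun x => m x * deriv φ x :=
    continuous_mul_of_tsupport_subset isOpen_Ioo (fun x hx => (hm1 x hx).continuousAt.continuousWithinAt)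
      hφ.deriv_cont (tsupport_deriv_subset.trans hφ.2.2)
  have hm'φ : Continuous fun x => deriv m x * φ x :=
    continuous_mul_of_tsupport_subset isOpen_Ioo hmc hφ.1.continuous hφ.2.2
  have hψ'c : Continuous ψ' := hm'φ.add hmφ'
  have hderiv : deriv ψ = ψ' := funext fun x => (hψ x).deriv
  have hd : Differentiable ℝ ψ := fun x => (hψ x).differentiableAt
  have hψa : ψ a = 0 := by simp [ψ, hφ.eq_zero_left]
  have hψb : ψ b = 0 := by simp [ψ, hφ.eq_zero_right]
  have hprim : ∀ x ∈ Ioo a b, prim a b ψ' x = ψ x := fun x hx => by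
    rw [← hderiv, prim_deriv hd (by rwa [hderiv]) (Ioo_subset_Icc_self hx), hψa, sub_zero]
  have hint : ∫ x in Ioo a b, ψ' x = 0 := by
    rw [← hderiv, integral_deriv_Ioo hab.le hd (by rwa [hderiv]), hψa, hψb, sub_zero]
  have key := h.integral_mul hab (memLp_of_continuous hψ'c) hint
  have e1 : ∫ x in Ioo a b, v x * prim a b ψ' x = ∫ x in Ioo a b, v x * ψ x :=
    setIntegral_congr_fun measurableSet_Ioo fun x hx => by simp only [hprim x hx]
  rw [e1] at key
  have hmφc : Continuous ψ := hd.continuous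
  have i1 : ∀ (f : L2 a b) {k : ℝ → ℂ}, Continuous k → Integrable (fun x => f x * k x) (mu a b) :=
    fun f k hk => by
      have := (Lp.memLp f).integrable_mul (memLp_of_continuous (a := a) (b := b) hk)
      exact this
  have e2 : ∫ x in Ioo a b, u x * ψ' x
      = (∫ x in Ioo a b, u x * (deriv m x * φ x)) + ∫ x in Ioo a b, u x * (m x * deriv φ x) := by
    rw [← integral_add (i1 u hm'φ) (i1 u hmφ')]
    refine integral_congr_ae (ae_of_all _ fun x => ?_)
    simp only [ψ']
    ring
  have e3 : ∫ x in Ioo a b, (deriv m x * u x + m x * v x) * φ x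
      = (∫ x in Ioo a b, u x * (deriv m x * φ x)) + ∫ x in Ioo a b, v x * ψ x := by
    rw [← integral_add (i1 u hm'φ) (i1 v hmφc)]
    refine integral_congr_ae (ae_of_all _ fun x => ?_)
    simp only [ψ]
    ring
  have e4 : ∫ x in Ioo a b, m x * u x * deriv φ x = ∫ x in Ioo a b, u x * (m x * deriv φ x) :=
    integral_congr_ae (ae_of_all _ fun x => by simp only; ring)
  rw [e4, e3]
  rw [e2] at key
  linear_combination key

end Sobolev

/-! ### Compactness of the primitive -/

section Compact

variable {a b : ℝ}

theorem norm_L2_le_of_ae_bound {f : L2 a b} {C : ℝ} (hC : 0 ≤ C)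
    (h : ∀ᵐ x ∂(mu a b), ‖f x‖ ≤ C) : ‖f‖ ≤ √((mu a b).real univ) * C := by
  refine (Lp.norm_le_of_ae_bound hC h).trans_eq ?_
  have h2 : (measureUnivNNReal (mu a b) : ℝ) = (mu a b).real univ := rfl
  have h3 : (mu a b).real univ ^ (ENNReal.toReal 2)⁻¹ = √((mu a b).real univ) := by
    rw [Real.sqrt_eq_rpow]
    norm_num
  rw [h2, h3]

/-- The approximation of the primitive by step functions. -/
def stepL (a b δ : ℝ) (N : ℕ) : L2 a b →L[ℂ] L2 a b :=
  ∑ j ∈ Finset.range N, (ContinuousLinearMap.toSpanSingleton ℂ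
    (indicatorConstLp 2 (measurableSet_Ico (a := a + j * δ) (b := a + (j + 1) * δ))
      (measure_ne_top (mu a b) _) (1 : ℂ))).comp
    (innerSL ℂ (indicatorConstLp 2 (measurableSet_Iio (a := a + j * δ))
      (measure_ne_top (mu a b) _) (1 : ℂ)))

theorem isCompactOperator_stepL (δ : ℝ) (N : ℕ) : IsCompactOperator (stepL a b δ N) := by
  have h : ∀ s : Finset ℕ, IsCompactOperator (∑ j ∈ s, (ContinuousLinearMap.toSpanSingleton ℂ
      (indicatorConstLp 2 (measurableSet_Ico (a := a + j * δ) (b := a + (j + 1) * δ))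
        (measure_ne_top (mu a b) _) (1 : ℂ))).comp
      (innerSL ℂ (indicatorConstLp 2 (measurableSet_Iio (a := a + j * δ))
        (measure_ne_top (mu a b) _) (1 : ℂ))) : L2 a b →L[ℂ] L2 a b) := by
    intro s
    induction s using Finset.induction_on with
    | empty => simpa using isCompactOperator_zero
    | insert j s hj ih =>
      rw [Finset.sum_insert hj]
      refine IsCompactOperator.add ?_ ih
      exact (isCompactOperator_of_locallyCompactSpace_rng
        (T := ContinuousLinearMap.toSpanSingleton ℂ _)).comp_clm _
  exact h _

theorem stepL_coe (δ : ℝ) (N : ℕ) (g : L2 a b) :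
    stepL a b δ N g =ᵐ[mu a b] fun x => ∑ j ∈ Finset.range N,
      prim a b g (a + j * δ) * (Ico (a + j * δ) (a + (j + 1) * δ)).indicator (fun _ => (1 : ℂ)) x := by
  rw [stepL, sum_apply]
  refine (Lp.coeFn_finsetSum _ _).trans ?_
  have h : ∀ j : ℕ, ∀ᵐ x ∂(mu a b), ((ContinuousLinearMap.toSpanSingleton ℂ
    (indicatorConstLp 2 (measurableSet_Ico (a := a + j * δ) (b := a + (j + 1) * δ))
      (measure_ne_top (mu a b) _) (1 : ℂ))).comp
    (innerSL ℂ (indicatorConstLp 2 (measurableSet_Iio (a := a + j * δ))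
      (measure_ne_top (mu a b) _) (1 : ℂ))) g : L2 a b) x =
      prim a b g (a + j * δ) *
        (Ico (a + j * δ) (a + (j + 1) * δ)).indicator (fun _ => (1 : ℂ)) x := by
    intro j
    rw [ContinuousLinearMap.comp_apply, innerSL_apply_apply, L2.inner_indicatorConstLp_one,
      ContinuousLinearMap.toSpanSingleton_apply]
    filter_upwards [Lp.coeFn_smul (prim a b g (a + j * δ)) (indicatorConstLp 2
      (measurableSet_Ico (a := a + j * δ) (b := a + (j + 1) * δ))
      (measure_ne_top (mu a b) _) (1 : ℂ)), indicatorConstLp_coeFn (p := 2)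
      (hs := measurableSet_Ico (a := a + j * δ) (b := a + (j + 1) * δ))
      (hμs := measure_ne_top (mu a b) _) (c := (1 : ℂ))] with x h1 h2
    rw [← prim, h1, Pi.smul_apply, h2, smul_eq_mul]
  filter_upwards [ae_all_iff.2 h] with x hx
  rw [Finset.sum_apply]
  exact Finset.sum_congr rfl fun j _ => hx j

/-- On each of the `N + 1` cells the primitive is replaced by its value at the left end, an error of
at most `√δ ‖g‖`. Thus `primL` is a norm limit of finite-rank operators. -/
theorem norm_primL_sub_stepL_le (hab : a < b) (N : ℕ) :
    ‖stepL a b ((b - a) / (N + 1)) (N + 1) - primL a b‖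
      ≤ √((mu a b).real univ) * √((b - a) / (N + 1)) := by
  refine ContinuousLinearMap.opNorm_le_bound _ (by positivity) fun g => ?_
  set δ := (b - a) / (N + 1) with hδ
  have hN : (0 : ℝ) < N + 1 := by positivity
  have hδ0 : 0 < δ := div_pos (by linarith) hN
  rw [mul_assoc]
  refine norm_L2_le_of_ae_bound (by positivity) ?_
  filter_upwards [Lp.coeFn_sub (stepL a b δ (N + 1) g) (primL a b g), stepL_coe δ (N + 1) g,
    primL_coe g, ae_restrict_mem measurableSet_Ioo] with x h1 h2 h3 hx
  rw [sub_apply, h1, Pi.sub_apply, h2, h3]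
  set k := ⌊(x - a) / δ⌋₊ with hk
  have hx0 : 0 ≤ (x - a) / δ := div_nonneg (by linarith [hx.1]) hδ0.le
  have hk1 : (k : ℝ) * δ ≤ x - a := by
    rw [← le_div_iff₀ hδ0]
    exact Nat.floor_le hx0
  have hk2 : x - a < (k + 1) * δ := by
    rw [← div_lt_iff₀ hδ0]
    exact Nat.lt_floor_add_one _
  have hkN : k < N + 1 := by
    rw [hk, Nat.floor_lt hx0, div_lt_iff₀ hδ0, hδ]
    push_cast
    rw [mul_div_cancel₀ _ hN.ne']
    linarith [hx.2]
  rw [Finset.sum_eq_single_of_mem k (Finset.mem_range.2 hkN)]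
  · rw [indicator_of_mem (show x ∈ Ico (a + k * δ) (a + (k + 1) * δ) from
      ⟨by linarith, by linarith⟩), mul_one, norm_sub_rev]
    refine (norm_prim_sub_le g (by linarith)).trans ?_
    have : x - (a + k * δ) ≤ δ := by linarith
    gcongr
  · intro j _ hj
    rw [indicator_of_notMem, mul_zero]
    rintro ⟨hj1, hj2⟩
    refine hj ?_
    have e1 : (j : ℝ) < k + 1 := lt_of_mul_lt_mul_right (by linarith : (j : ℝ) * δ < (k + 1) * δ) hδ0.le
    have e2 : (k : ℝ) < j + 1 := lt_of_mul_lt_mul_right (by linarith : (k : ℝ) * δ < (j + 1) * δ) hδ0.le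
    norm_cast at e1 e2
    omega

theorem isCompactOperator_primL (hab : a < b) : IsCompactOperator (primL a b) := by
  refine isCompactOperator_of_tendsto (l := atTop)
    (F := fun N : ℕ => stepL a b ((b - a) / (N + 1)) (N + 1)) ?_
    (Eventually.of_forall fun N => isCompactOperator_stepL _ _)
  rw [tendsto_iff_norm_sub_tendsto_zero]
  refine squeeze_zero (fun _ => norm_nonneg _) (fun N => norm_primL_sub_stepL_le hab N) ?_
  have h1 : Tendsto (fun N : ℕ => (b - a) / ((N : ℝ) + 1)) atTop (𝓝 0) :=
    tendsto_const_nhds.div_atTop (tendsto_natCast_atTop_atTop.atTop_add tendsto_const_nhds)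
  have h2 := ((Real.continuous_sqrt.tendsto 0).comp h1).const_mul (√((mu a b).real univ))
  simpa using h2

end Compact

/-! ### Polar decomposition -/

section Polar

variable {H : Type*} [NormedAddCommGroup H] [InnerProductSpace ℂ H] [CompleteSpace H]

/-- Take `T = (V V*)^(1/2)`: then `‖T f‖² = ⟨f, T² f⟩ = ⟨f, V V* f⟩ = ‖V* f‖²`. -/
theorem exists_isPositive_norm_eq (V : H →L[ℂ] H) :
    ∃ T : H →L[ℂ] H, T.IsPositive ∧ ∀ f, ‖T f‖ = ‖V.adjoint f‖ := by
  have hA : 0 ≤ V.comp V.adjoint := (ContinuousLinearMap.nonneg_iff_isPositive _).2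
    (ContinuousLinearMap.isPositive_self_comp_adjoint V)
  have hpos := (ContinuousLinearMap.nonneg_iff_isPositive _).1
    (CFC.sqrt_nonneg (V.comp V.adjoint))
  refine ⟨CFC.sqrt (V.comp V.adjoint), hpos, fun f => ?_⟩
  have h1 : inner ℂ (CFC.sqrt (V.comp V.adjoint) f) (CFC.sqrt (V.comp V.adjoint) f)
      = inner ℂ (V.adjoint f) (V.adjoint f) := by
    have h2 := congrArg (fun B : H →L[ℂ] H => B f) (CFC.sqrt_mul_sqrt_self (V.comp V.adjoint) hA)
    have h3 := hpos.isSymmetric f (CFC.sqrt (V.comp V.adjoint) f)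
    rw [ContinuousLinearMap.adjoint_inner_left]
    exact h3.trans (congrArg _ h2)
  rw [inner_self_eq_norm_sq_to_K, inner_self_eq_norm_sq_to_K] at h1
  have h2 : ‖CFC.sqrt (V.comp V.adjoint) f‖ ^ 2 = ‖V.adjoint f‖ ^ 2 := by exact_mod_cast h1
  exact (sq_eq_sq₀ (norm_nonneg _) (norm_nonneg _)).1 h2

/-- The polar decomposition, in the form `V = T X`, `T = V Y` with a positive operator `T` and
contractions `X`, `Y`. -/
theorem exists_polar (V : H →L[ℂ] H) :
    ∃ T X Y : H →L[ℂ] H, T.IsPositive ∧ (∀ f, ‖X f‖ ≤ ‖f‖) ∧ (∀ f, ‖Y f‖ ≤ ‖f‖) ∧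
      (∀ g, V g = T (X g)) ∧ ∀ g, T g = V (Y g) := by
  obtain ⟨T, hT, hn⟩ := exists_isPositive_norm_eq V
  -- As `T f` and `V* f` have equal norms, Douglas' lemma works in both directions with constant
  -- `1`: `V* = X T` and `T = Y V*`. The claimed factors are the adjoints of these.
  obtain ⟨X, hX, hXT⟩ := exists_clm_comp_eq (C := 1) (V.adjoint : H →ₗ[ℂ] H)
    (T : H →ₗ[ℂ] H) zero_le_one (fun f => by rw [one_mul]; exact (hn f).ge)
  obtain ⟨Y, hY, hYV⟩ := exists_clm_comp_eq (C := 1) (T : H →ₗ[ℂ] H)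
    (V.adjoint : H →ₗ[ℂ] H) zero_le_one (fun f => by rw [one_mul]; exact (hn f).le)
  have hs : ∀ x y, inner ℂ (T x) y = inner ℂ x (T y) := hT.isSymmetric
  have hle : ∀ {B : H →L[ℂ] H}, ‖B‖ ≤ 1 → ∀ f, ‖B.adjoint f‖ ≤ ‖f‖ := fun {B} hB f => by
    refine (B.adjoint.le_opNorm f).trans ?_
    rw [LinearIsometryEquiv.norm_map]
    nlinarith [norm_nonneg f]
  refine ⟨T, X.adjoint, Y.adjoint, hT, hle hX, hle hY, fun g => ?_, fun g => ?_⟩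
  · refine ext_inner_left ℂ fun f => ?_
    rw [← ContinuousLinearMap.adjoint_inner_left, ← hs, ContinuousLinearMap.adjoint_inner_right]
    congr 1
    exact (hXT f).symm
  · refine ext_inner_left ℂ fun f => ?_
    rw [← hs, ← ContinuousLinearMap.adjoint_inner_left V, ContinuousLinearMap.adjoint_inner_right]
    congr 1
    exact (hYV f).symm

end Polar

/-! ### The inverse square root of the Dirichlet Laplacian -/

section SquareRoot

variable {a b : ℝ}

/-- The inverse square root `T` of the Dirichlet Laplacian on `(a, b)`, and the isometry `U` onto
the functions with mean value zero for which `T f` is the primitive of `U f`. -/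
theorem exists_sqrt_dirichlet (hab : a < b) :
    ∃ T U : L2 a b →L[ℂ] L2 a b, Function.Injective T ∧
      (∀ x y, inner ℂ (T x) y = inner ℂ x (T y)) ∧ (∀ x, 0 ≤ (inner ℂ (T x) x).re) ∧
      IsCompactOperator T ∧ (∀ f, U f ∈ meanZero a b) ∧ (∀ f, primL a b (U f) = T f) ∧
      (∀ f, ‖U f‖ = ‖f‖) ∧ ∀ g ∈ meanZero a b, ∃ f, U f = g := by
  have hcs : CompleteSpace (meanZero a b) := isClosed_meanZero.completeSpace_coe
  let P : L2 a b →L[ℂ] L2 a b := (meanZero a b).starProjection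
  have hPm : ∀ f, P f ∈ meanZero a b := fun f => Submodule.starProjection_apply_mem _ f
  have hPid : ∀ g ∈ meanZero a b, P g = g := fun g hg => Submodule.starProjection_eq_self_iff.2 hg
  have hPn : ∀ f, ‖P f‖ ≤ ‖f‖ := fun f => by
    refine (P.le_opNorm f).trans ?_
    have : ‖P‖ ≤ 1 := Submodule.starProjection_norm_le _
    nlinarith [norm_nonneg f]
  -- The projection restricts the primitive to mean-zero functions, so the range of `V` is `H¹₀` and
  -- `V V*` is the inverse of the Dirichlet Laplacian.
  let V : L2 a b →L[ℂ] L2 a b := (primL a b).comp P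
  obtain ⟨T, X, Y, hTpos, hX, hY, hV, hT⟩ := exists_polar V
  have hTs : ∀ x y, inner ℂ (T x) y = inner ℂ x (T y) := hTpos.isSymmetric
  let U : L2 a b →L[ℂ] L2 a b := P.comp Y
  have hU : ∀ f, primL a b (U f) = T f := fun f => (hT f).symm
  -- The kernel of `T` is orthogonal to the range of `V`, which contains all test functions.
  have hinj : Function.Injective T := by
    rw [injective_iff_map_eq_zero]
    intro f hf
    have h0 : ∀ g ∈ meanZero a b, inner ℂ (primL a b g) f = 0 := by
      intro g hg
      have h1 : V g = primL a b g := by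
        change primL a b (P g) = _
        rw [hPid g hg]
      rw [← h1, hV, hTs, hf, inner_zero_right]
    have hw : HasWeakDeriv a b (fun _ => 0) f := by
      intro φ hφ
      have h1 := h0 _ (hφ.star.derivL2_mem hab.le)
      rw [hφ.star.primL_derivL2, inner_eq_integral] at h1
      have h2 : ∫ x in Ioo a b, f x * φ x = 0 := by
        rw [← h1]
        refine integral_congr_ae ?_
        filter_upwards [hφ.star.toL2_coe] with x hx
        rw [hx, Complex.conj_conj, mul_comm]
      rw [h2]
      simp
    have hw0 : HasWeakDeriv a b (fun _ => 0) (0 : L2 a b) := by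
      intro ψ hψ
      have : ∫ x in Ioo a b, (0 : L2 a b) x * ψ x = 0 := by
        refine integral_eq_zero_of_ae ?_
        filter_upwards [Lp.coeFn_zero ℂ 2 (mu a b)] with x hx
        rw [hx]; simp
      rw [this]
      simp
    exact hw.unique hw0
  refine ⟨T, U, hinj, hTs, fun x => ?_, ?_, fun f => hPm _, hU, fun f => ?_, fun g hg => ?_⟩
  · have := hTpos.2 x
    exact this
  · have : T = (primL a b).comp U := ContinuousLinearMap.ext fun f => (hU f).symm
    rw [this]
    exact (isCompactOperator_primL hab).comp_clm U
  · refine le_antisymm ((hPn _).trans (hY f)) ?_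
    -- The contraction `U` has the contraction `X` as a left inverse, so it is isometric.
    · have h1 : f = X (U f) := by
        apply hinj
        rw [← hV]
        change _ = primL a b (P (U f))
        rw [hPid (U f) (hPm (Y f)), hU]
      conv_lhs => rw [h1]
      exact hX _
  · refine ⟨X g, primL_injective hab.le ?_⟩
    rw [hU, ← hV]
    change primL a b (P g) = _
    rw [hPid g hg]

end SquareRoot

/-! ### Weakly singular integral operators -/

section Schur

/-- The Schur test in `L²`. -/
theorem lintegral_sq_kernel_le {X : Type*} [MeasurableSpace X] {μ : Measure X} [SFinite μ]
    {k : X × X → ℝ≥0∞} (hk : Measurable k) {f : X → ℝ≥0∞} (hf : AEMeasurable f μ) {M : ℝ≥0∞}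
    (h1 : ∀ᵐ x ∂μ, ∫⁻ y, k (x, y) ∂μ ≤ M) (h2 : ∀ᵐ y ∂μ, ∫⁻ x, k (x, y) ∂μ ≤ M) :
    ∫⁻ x, (∫⁻ y, k (x, y) * f y ∂μ) ^ 2 ∂μ ≤ M ^ 2 * ∫⁻ y, f y ^ 2 ∂μ := by
  have hsq : ∀ c : ℝ≥0∞, c ^ (1 / 2 : ℝ) * c ^ (1 / 2 : ℝ) = c := fun c => by
    rw [← ENNReal.rpow_add_of_nonneg _ _ (by norm_num) (by norm_num)]
    norm_num
  have hsq' : ∀ c : ℝ≥0∞, (c ^ (1 / 2 : ℝ)) ^ 2 = c := fun c => by rw [sq, hsq]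
  -- Cauchy–Schwarz after splitting the kernel as `k = k^(1/2) k^(1/2)`.
  have key : ∀ x, (∫⁻ y, k (x, y) * f y ∂μ) ^ 2
      ≤ (∫⁻ y, k (x, y) ∂μ) * ∫⁻ y, k (x, y) * f y ^ 2 ∂μ := by
    intro x
    have hkx : Measurable fun y => k (x, y) := hk.comp measurable_prodMk_left
    have hh := ENNReal.lintegral_mul_le_Lp_mul_Lq μ Real.HolderConjugate.two_two
      (f := fun y => k (x, y) ^ (1 / 2 : ℝ)) (g := fun y => k (x, y) ^ (1 / 2 : ℝ) * f y)
      (hkx.pow_const _).aemeasurable ((hkx.pow_const _).aemeasurable.mul hf)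
    have e1 : ∫⁻ y, ((fun y => k (x, y) ^ (1 / 2 : ℝ)) * fun y => k (x, y) ^ (1 / 2 : ℝ) * f y) y ∂μ
        = ∫⁻ y, k (x, y) * f y ∂μ := by
      refine lintegral_congr fun y => ?_
      rw [Pi.mul_apply, ← mul_assoc, hsq]
    have e2 : ∫⁻ y, (k (x, y) ^ (1 / 2 : ℝ)) ^ (2 : ℝ) ∂μ = ∫⁻ y, k (x, y) ∂μ := by
      refine lintegral_congr fun y => ?_
      rw [ENNReal.rpow_two, hsq']
    have e3 : ∫⁻ y, (k (x, y) ^ (1 / 2 : ℝ) * f y) ^ (2 : ℝ) ∂μ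
        = ∫⁻ y, k (x, y) * f y ^ 2 ∂μ := by
      refine lintegral_congr fun y => ?_
      rw [ENNReal.rpow_two, mul_pow, hsq']
    rw [e1, e2, e3] at hh
    calc (∫⁻ y, k (x, y) * f y ∂μ) ^ 2 ≤ _ := pow_le_pow_left' hh 2
      _ = _ := by rw [mul_pow, hsq', hsq']
  have hm : AEMeasurable (Function.uncurry fun x y => k (x, y) * f y ^ 2) (μ.prod μ) := by
    refine AEMeasurable.mul hk.aemeasurable ?_
    exact (hf.pow_const 2).comp_snd
  calc ∫⁻ x, (∫⁻ y, k (x, y) * f y ∂μ) ^ 2 ∂μ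
      ≤ ∫⁻ x, M * ∫⁻ y, k (x, y) * f y ^ 2 ∂μ ∂μ := by
        refine lintegral_mono_ae ?_
        filter_upwards [h1] with x hx
        exact (key x).trans (mul_le_mul_left hx _)
    _ = M * ∫⁻ x, ∫⁻ y, k (x, y) * f y ^ 2 ∂μ ∂μ := by
        rw [lintegral_const_mul'']
        exact hm.lintegral_prod_right'
    _ = M * ∫⁻ y, ∫⁻ x, k (x, y) * f y ^ 2 ∂μ ∂μ := by rw [lintegral_lintegral_swap hm]
    _ ≤ M * ∫⁻ y, M * f y ^ 2 ∂μ := by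
        refine mul_le_mul_right (lintegral_mono_ae ?_) _
        filter_upwards [h2] with y hy
        have hky : Measurable fun x => k (x, y) := hk.comp measurable_prodMk_right
        rw [lintegral_mul_const _ hky]
        gcongr
    _ = M ^ 2 * ∫⁻ y, f y ^ 2 ∂μ := by
        rw [lintegral_const_mul'' _ (hf.pow_const 2), ← mul_assoc, sq]

end Schur

section WeaklySingular

variable {a b β : ℝ}

/-- The mass of the kernel `|x - y| ^ (-β)`. -/
def singMass (a b β : ℝ) : ℝ≥0∞ :=
  ∫⁻ t in Ioo (-(b - a)) (b - a), ENNReal.ofReal (|t| ^ (-β))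

theorem singMass_lt_top (hab : a ≤ b) (hβ : β < 1) : singMass a b β < ⊤ := by
  have h1 : IntervalIntegrable (fun t : ℝ => |t| ^ (-β)) volume 0 (b - a) := by
    have := intervalIntegral.intervalIntegrable_rpow' (a := 0) (b := b - a) (r := -β) (by linarith)
    refine this.congr ?_
    intro t ht
    rw [uIoc_of_le (by linarith)] at ht
    simp only [abs_of_pos ht.1]
  have h2 : IntervalIntegrable (fun t : ℝ => |t| ^ (-β)) volume (-(b - a)) 0 := by
    have := (IntervalIntegrable.iff_comp_neg (by finiteness)).1 h1
    simpa using this.symm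
  have h3 := h2.trans h1
  rw [intervalIntegrable_iff_integrableOn_Ioo_of_le (by linarith)] at h3
  refine lt_of_le_of_lt (lintegral_mono fun t => ?_) h3.2
  rw [← ofReal_norm]
  exact ENNReal.ofReal_le_ofReal (le_abs_self _)

theorem lintegral_sing_le {x : ℝ} (hx : x ∈ Ioo a b) :
    ∫⁻ y in Ioo a b, ENNReal.ofReal (|x - y| ^ (-β)) ≤ singMass a b β := by
  have e : ∫⁻ y in Ioo a b, ENNReal.ofReal (|x - y| ^ (-β))
      = ∫⁻ y, (Ioo a b).indicator (fun y => ENNReal.ofReal (|x - y| ^ (-β))) y :=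
    (lintegral_indicator measurableSet_Ioo _).symm
  rw [e, ← lintegral_sub_left_eq_self _ x, singMass, ← lintegral_indicator measurableSet_Ioo]
  refine lintegral_mono fun t => ?_
  by_cases ht : x - t ∈ Ioo a b
  · rw [indicator_of_mem ht, indicator_of_mem]
    · simp
    · exact ⟨by linarith [ht.2, hx.1], by linarith [ht.1, hx.2]⟩
  · rw [indicator_of_notMem ht]
    exact zero_le

/-- Measurable kernels on `(a, b)` bounded by `|x - y| ^ (-β)`. -/
structure IsSing (a b β : ℝ) (κ : ℝ × ℝ → ℝ) : Prop where
  meas : Measurable κ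
  bound : ∀ x ∈ Ioo a b, ∀ y ∈ Ioo a b, |κ (x, y)| ≤ |x - y| ^ (-β)

/-- The integral operator with kernel `κ`. -/
def kerFun (a b : ℝ) (κ : ℝ × ℝ → ℝ) (f : ℝ → ℂ) (x : ℝ) : ℂ :=
  ∫ y in Ioo a b, (κ (x, y) : ℂ) * f y

variable {κ : ℝ × ℝ → ℝ} {f : ℝ → ℂ}

theorem lintegral_sing_sq_le (hf : MemLp f 2 (mu a b)) :
    ∫⁻ x in Ioo a b, (∫⁻ y in Ioo a b, ENNReal.ofReal (|x - y| ^ (-β)) * ‖f y‖ₑ) ^ 2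
      ≤ (singMass a b β * eLpNorm f 2 (mu a b)) ^ 2 := by
  have h := lintegral_sq_kernel_le (μ := mu a b) (M := singMass a b β)
    (k := fun p : ℝ × ℝ => ENNReal.ofReal (|p.1 - p.2| ^ (-β))) (by fun_prop)
    (f := fun y => ‖f y‖ₑ) hf.1.enorm
    ((ae_restrict_iff' measurableSet_Ioo).2 (ae_of_all _ fun x hx => lintegral_sing_le hx))
    ((ae_restrict_iff' measurableSet_Ioo).2 (ae_of_all _ fun y hy => by
      refine le_trans (le_of_eq ?_) (lintegral_sing_le (β := β) hy)
      refine lintegral_congr fun x => ?_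
      simp only [abs_sub_comm x y]))
  refine h.trans_eq ?_
  rw [mul_pow]
  congr 1
  rw [eLpNorm_eq_lintegral_rpow_enorm_toReal (by norm_num) (by norm_num)]
  simp only [ENNReal.toReal_ofNat, ENNReal.rpow_two]
  rw [← ENNReal.rpow_natCast, ← ENNReal.rpow_mul]
  norm_num

theorem ae_lintegral_sing_lt_top (hab : a ≤ b) (hβ : β < 1) (hf : MemLp f 2 (mu a b)) :
    ∀ᵐ x ∂(mu a b), ∫⁻ y in Ioo a b, ENNReal.ofReal (|x - y| ^ (-β)) * ‖f y‖ₑ < ⊤ := by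
  have h := lintegral_sing_sq_le (β := β) hf
  have hfin : ∫⁻ x in Ioo a b, (∫⁻ y in Ioo a b, ENNReal.ofReal (|x - y| ^ (-β)) * ‖f y‖ₑ) ^ 2
      ≠ ⊤ := by
    refine (h.trans_lt ?_).ne
    have h1 := singMass_lt_top hab hβ
    have h2 := hf.2
    finiteness
  have hm : AEMeasurable (fun x => (∫⁻ y in Ioo a b, ENNReal.ofReal (|x - y| ^ (-β)) * ‖f y‖ₑ) ^ 2)
      (mu a b) := by
    refine AEMeasurable.pow_const ?_ 2
    refine AEMeasurable.lintegral_prod_right' (f := fun p : ℝ × ℝ =>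
      ENNReal.ofReal (|p.1 - p.2| ^ (-β)) * ‖f p.2‖ₑ) ?_
    exact AEMeasurable.mul (by fun_prop) hf.1.enorm.comp_snd
  filter_upwards [ae_lt_top' hm hfin] with x hx
  exact lt_of_not_ge fun h' => by
    rw [top_le_iff.1 h'] at hx
    simp at hx

theorem IsSing.ae_le (hκ : IsSing a b β κ) {x : ℝ} (hx : x ∈ Ioo a b) :
    ∀ᵐ y ∂(mu a b), ‖(κ (x, y) : ℂ) * f y‖ₑ ≤ ENNReal.ofReal (|x - y| ^ (-β)) * ‖f y‖ₑ := by
  filter_upwards [ae_restrict_mem measurableSet_Ioo] with y hy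
  rw [enorm_mul]
  gcongr
  rw [← ofReal_norm, Complex.norm_real, Real.norm_eq_abs]
  exact ENNReal.ofReal_le_ofReal (hκ.bound x hx y hy)

theorem IsSing.aestronglyMeasurable (hκ : IsSing a b β κ) (hf : MemLp f 2 (mu a b)) :
    AEStronglyMeasurable (fun p : ℝ × ℝ => (κ p : ℂ) * f p.2) ((mu a b).prod (mu a b)) :=
  (Complex.measurable_ofReal.comp hκ.meas).aestronglyMeasurable.mul hf.1.comp_snd

theorem IsSing.ae_integrable (hab : a ≤ b) (hβ : β < 1) (hκ : IsSing a b β κ)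
    (hf : MemLp f 2 (mu a b)) :
    ∀ᵐ x ∂(mu a b), Integrable (fun y => (κ (x, y) : ℂ) * f y) (mu a b) := by
  filter_upwards [ae_lintegral_sing_lt_top hab hβ hf, ae_restrict_mem measurableSet_Ioo]
    with x hx hx'
  refine ⟨?_, (lintegral_mono_ae (hκ.ae_le hx')).trans_lt hx⟩
  exact ((Complex.measurable_ofReal.comp
    (hκ.meas.comp measurable_prodMk_left)).aestronglyMeasurable).mul hf.1

theorem IsSing.enorm_kerFun_le (hκ : IsSing a b β κ) {x : ℝ} (hx : x ∈ Ioo a b) :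
    ‖kerFun a b κ f x‖ₑ ≤ ∫⁻ y in Ioo a b, ENNReal.ofReal (|x - y| ^ (-β)) * ‖f y‖ₑ :=
  (enorm_integral_le_lintegral_enorm _).trans (lintegral_mono_ae (hκ.ae_le hx))

theorem IsSing.kerFun_aestronglyMeasurable (hκ : IsSing a b β κ) (hf : MemLp f 2 (mu a b)) :
    AEStronglyMeasurable (kerFun a b κ f) (mu a b) :=
  (hκ.aestronglyMeasurable hf).integral_prod_right'

theorem IsSing.eLpNorm_kerFun_le (hκ : IsSing a b β κ) (hf : MemLp f 2 (mu a b)) :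
    eLpNorm (kerFun a b κ f) 2 (mu a b) ≤ singMass a b β * eLpNorm f 2 (mu a b) := by
  have h : eLpNorm (kerFun a b κ f) 2 (mu a b) ^ 2 ≤ (singMass a b β * eLpNorm f 2 (mu a b)) ^ 2 := by
    refine le_trans ?_ (lintegral_sing_sq_le (β := β) hf)
    rw [eLpNorm_eq_lintegral_rpow_enorm_toReal (by norm_num) (by norm_num)]
    simp only [ENNReal.toReal_ofNat, ENNReal.rpow_two]
    rw [← ENNReal.rpow_natCast, ← ENNReal.rpow_mul]
    norm_num
    refine setLIntegral_mono_ae' measurableSet_Ioo (ae_of_all _ fun x hx => ?_)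
    gcongr
    exact hκ.enorm_kerFun_le hx
  exact (ENNReal.pow_le_pow_left_iff (by norm_num)).1 h

theorem IsSing.memLp_kerFun (hab : a ≤ b) (hβ : β < 1) (hκ : IsSing a b β κ)
    (hf : MemLp f 2 (mu a b)) : MemLp (kerFun a b κ f) 2 (mu a b) := by
  refine ⟨hκ.kerFun_aestronglyMeasurable hf, (hκ.eLpNorm_kerFun_le hf).trans_lt ?_⟩
  exact ENNReal.mul_lt_top (singMass_lt_top hab hβ) hf.2

end WeaklySingular

/-! ### Boundedness of the fractional integral -/

section FractionalIntegral

variable {a b P σ : ℝ}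

/-- Because `P` is an endpoint, `x ↦ |x - P|` is an isometry of `[a, b]`. This allows kernels in the
variable `r` to be compared with `|x - y| ^ (-β)`. -/
theorem abs_sub_endpoint (hP : P = a ∨ P = b) {x y : ℝ} (hx : x ∈ Icc a b) (hy : y ∈ Icc a b) :
    |(|x - P| - |y - P|)| = |x - y| := by
  rcases hP with rfl | rfl
  · rw [abs_of_nonneg (by linarith [hx.1] : 0 ≤ x - P), abs_of_nonneg (by linarith [hy.1] : 0 ≤ y - P)]
    congr 1; ring
  · rw [abs_of_nonpos (by linarith [hx.2] : x - P ≤ 0), abs_of_nonpos (by linarith [hy.2] : y - P ≤ 0),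
      abs_sub_comm]
    congr 1; ring

/-- The kernel of the fractional integral. -/
def intKernel (P σ : ℝ) (p : ℝ × ℝ) : ℝ :=
  if |p.2 - P| < |p.1 - P| then (|p.1 - P| - |p.2 - P|) ^ (σ - 1) else 0

theorem isSing_intKernel (hP : P = a ∨ P = b) (σ : ℝ) : IsSing a b (1 - σ) (intKernel P σ) := by
  refine ⟨?_, fun x hx y hy => ?_⟩
  · unfold intKernel
    exact Measurable.ite (measurableSet_lt (by fun_prop) (by fun_prop)) (by fun_prop)
      measurable_const
  · rw [intKernel]
    split_ifs with h
    · simp only at h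
      rw [neg_sub, abs_of_nonneg (Real.rpow_nonneg (by linarith) _),
        ← abs_sub_endpoint hP (Ioo_subset_Icc_self hx) (Ioo_subset_Icc_self hy),
        abs_of_pos (by linarith : 0 < |x - P| - |y - P|)]
    · rw [abs_zero]
      positivity

theorem measurableSet_nearSet (a b P x : ℝ) : MeasurableSet (nearSet a b P x) :=
  measurableSet_Ioo.inter
    (measurableSet_lt (by fun_prop : Measurable fun s : ℝ => |s - P|) measurable_const)

theorem indicator_fracIntKernel (f : ℝ → ℂ) (x s : ℝ) :
    (nearSet a b P x).indicator (fracIntKernel P σ f x) s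
      = (Ioo a b).indicator (fun y => (intKernel P σ (x, y) : ℂ) * f y) s := by
  by_cases hs : s ∈ Ioo a b
  · by_cases h : |s - P| < |x - P|
    · rw [indicator_of_mem (show s ∈ nearSet a b P x from ⟨hs, h⟩), indicator_of_mem hs,
        fracIntKernel, intKernel, if_pos h, mul_comm]
    · rw [indicator_of_notMem (fun h' : s ∈ nearSet a b P x => h h'.2), indicator_of_mem hs,
        intKernel, if_neg h]
      simp
  · rw [indicator_of_notMem (fun h' : s ∈ nearSet a b P x => hs h'.1), indicator_of_notMem hs]

/-- The fractional integral is defined on all of `L²(a, b)` and bounded. -/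
theorem exists_fracInt_bound (hab : a ≤ b) (hP : P = a ∨ P = b) (hσ0 : 0 ≤ σ) :
    ∃ C : ℝ, 0 ≤ C ∧ ∀ f : L2 a b, ∃ h : f ∈ (fracInt a b P σ).domain,
      ‖fracInt a b P σ ⟨f, h⟩‖ ≤ C * ‖f‖ := by
  rcases hσ0.eq_or_lt with h0 | h0
  · refine ⟨1, zero_le_one, fun f => ?_⟩
    rw [fracInt, if_pos h0.symm]
    exact ⟨trivial, by rw [one_mul]; exact le_rfl⟩
  · have hβ : 1 - σ < 1 := by linarith
    have hκ := isSing_intKernel (a := a) (b := b) hP σ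
    have hM := singMass_lt_top hab hβ
    refine ⟨|1 / Real.Gamma σ| * (singMass a b (1 - σ)).toReal, by positivity, fun f => ?_⟩
    have hm := (hκ.memLp_kerFun hab hβ (Lp.memLp f)).const_mul ((1 / Real.Gamma σ : ℝ) : ℂ)
    have hkf : ∀ x, ∫ s in nearSet a b P x, fracIntKernel P σ f x s
        = kerFun a b (intKernel P σ) f x := by
      intro x
      rw [← integral_indicator (measurableSet_nearSet a b P x), kerFun,
        ← integral_indicator measurableSet_Ioo]
      exact integral_congr_ae (ae_of_all _ fun s => indicator_fracIntKernel _ _ _)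
    rw [fracInt, if_neg h0.ne']
    have hrel : (∀ᵐ x ∂(mu a b), IntegrableOn (fracIntKernel P σ f x) (nearSet a b P x)) ∧
        (hm.toLp : L2 a b) =ᵐ[mu a b] fun x =>
          ((1 / Real.Gamma σ : ℝ) : ℂ) * ∫ s in nearSet a b P x, fracIntKernel P σ f x s := by
      constructor
      · filter_upwards [hκ.ae_integrable hab hβ (Lp.memLp f)] with x hx
        rw [← integrable_indicator_iff (measurableSet_nearSet a b P x)]
        refine ((integrable_indicator_iff measurableSet_Ioo).2 hx).congr (ae_of_all _ fun s => ?_)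
        exact (indicator_fracIntKernel _ _ _).symm
      · filter_upwards [hm.coeFn_toLp] with x hx
        rw [hx, hkf]
    refine ⟨⟨hm.toLp, hrel⟩, ?_⟩
    rw [ofRel_eq _ hrel, Lp.norm_toLp]
    have e1 : eLpNorm (fun x => ((1 / Real.Gamma σ : ℝ) : ℂ) * kerFun a b (intKernel P σ) f x) 2
        (mu a b) = ‖((1 / Real.Gamma σ : ℝ) : ℂ)‖ₑ * eLpNorm (kerFun a b (intKernel P σ) f) 2
        (mu a b) := eLpNorm_const_smul ((1 / Real.Gamma σ : ℝ) : ℂ)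
          (kerFun a b (intKernel P σ) f) 2 (mu a b)
    rw [e1, ENNReal.toReal_mul, mul_assoc]
    have e2 : ‖((1 / Real.Gamma σ : ℝ) : ℂ)‖ₑ.toReal = |1 / Real.Gamma σ| := by
      rw [toReal_enorm, Complex.norm_real, Real.norm_eq_abs]
    rw [e2]
    gcongr
    rw [Lp.norm_def, ← ENNReal.toReal_mul]
    exact ENNReal.toReal_mono (ENNReal.mul_lt_top hM (Lp.memLp f).2).ne
      (hκ.eLpNorm_kerFun_le (Lp.memLp f))

end FractionalIntegral

/-! ### The fractional derivative on `H¹₀(a, b)` -/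

section FractionalDerivative

variable {a b P α : ℝ}

/-- The kernel of the (truncated, if `ε > 0`) fractional derivative, acting on the derivative of
a function. -/
def derivKernel (P α ε : ℝ) (p : ℝ × ℝ) : ℝ :=
  if |p.1 - P| < |p.2 - P| then (max ε (|p.2 - P| - |p.1 - P|)) ^ (-α) else 0

theorem derivKernel_nonneg {ε : ℝ} (hε : 0 ≤ ε) (p : ℝ × ℝ) : 0 ≤ derivKernel P α ε p := by
  rw [derivKernel]
  split_ifs with h
  · exact Real.rpow_nonneg (le_max_of_le_left hε) _
  · exact le_rfl

theorem isSing_derivKernel (hP : P = a ∨ P = b) (hα : 0 < α) {ε : ℝ} (hε : 0 ≤ ε) :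
    IsSing a b α (derivKernel P α ε) := by
  refine ⟨?_, fun x hx y hy => ?_⟩
  · unfold derivKernel
    exact Measurable.ite (measurableSet_lt (by fun_prop) (by fun_prop)) (by fun_prop)
      measurable_const
  · rw [abs_of_nonneg (derivKernel_nonneg hε _), derivKernel]
    split_ifs with h
    · simp only at h ⊢
      rw [← abs_sub_endpoint hP (Ioo_subset_Icc_self hx) (Ioo_subset_Icc_self hy),
        abs_sub_comm (|x - P|), abs_of_pos (by linarith : 0 < |y - P| - |x - P|)]
      exact Real.rpow_le_rpow_of_nonpos (by linarith) (le_max_right _ _) (by linarith)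
    · positivity

/-- The sign relating a function in `H¹₀` to the integral of its derivative beyond a point. -/
def sgn (a P : ℝ) : ℂ := if P = a then -1 else 1

theorem norm_sgn (a P : ℝ) : ‖sgn a P‖ = 1 := by
  rw [sgn]; split_ifs <;> simp

theorem integral_radial (hab : a ≤ b) (hP : P = a ∨ P = b) {E : Type*} [NormedAddCommGroup E]
    [NormedSpace ℝ E] (F : ℝ → E) : ∫ s in Ioo a b, F |s - P| = ∫ t in Ioo 0 (b - a), F t := by
  rw [← integral_Ioc_eq_integral_Ioo, ← intervalIntegral.integral_of_le hab,
    ← integral_Ioc_eq_integral_Ioo, ← intervalIntegral.integral_of_le (by linarith : 0 ≤ b - a)]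
  rcases hP with rfl | rfl
  · have h : ∫ s in P..b, F |s - P| = ∫ s in P..b, F (s - P) := by
      refine intervalIntegral.integral_congr fun s hs => ?_
      rw [uIcc_of_le hab] at hs
      simp only [abs_of_nonneg (sub_nonneg.2 hs.1)]
    rw [h, intervalIntegral.integral_comp_sub_right, sub_self]
  · have h : ∫ s in a..P, F |s - P| = ∫ s in a..P, F (P - s) := by
      refine intervalIntegral.integral_congr fun s hs => ?_
      rw [uIcc_of_le hab] at hs
      simp only [abs_of_nonpos (sub_nonpos.2 hs.2), neg_sub]
    rw [h, intervalIntegral.integral_comp_sub_left, sub_self]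

/-- The part of the line beyond `x`, seen from `P`. -/
def beyond (P x : ℝ) : Set ℝ := {y | |x - P| < |y - P|}

theorem measurableSet_beyond (P x : ℝ) : MeasurableSet (beyond P x) :=
  measurableSet_lt measurable_const (by fun_prop)

theorem abs_sub_endpoint_lt (hP : P = a ∨ P = b) {x : ℝ} (hx : x ∈ Ioo a b) :
    |x - P| < b - a := by
  rw [abs_lt]
  rcases hP with rfl | rfl
  · exact ⟨by linarith [hx.1, hx.2], by linarith [hx.2]⟩
  · exact ⟨by linarith [hx.1, hx.2], by linarith [hx.1, hx.2]⟩

/-- A function in `H¹₀` as the integral of its derivative over the points beyond `x`. -/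
theorem prim_eq_beyond (hab : a < b) (hP : P = a ∨ P = b) {g : ℝ → ℂ} (hg : Integrable g (mu a b))
    (h0 : ∫ x in Ioo a b, g x = 0) {x : ℝ} (hx : x ∈ Ioo a b) :
    prim a b g x = sgn a P * ∫ y in beyond P x, g y ∂(mu a b) := by
  have hae : ∀ {s t : Set ℝ}, MeasurableSet s → MeasurableSet t → (∀ y ∈ Ioo a b, y ∈ s ↔ y ∈ t) →
      ∫ y in s, g y ∂(mu a b) = ∫ y in t, g y ∂(mu a b) := by
    intro s t hs ht h
    rw [← integral_indicator hs, ← integral_indicator ht]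
    refine integral_congr_ae ?_
    filter_upwards [ae_restrict_mem measurableSet_Ioo] with y hy
    by_cases hys : y ∈ s
    · rw [indicator_of_mem hys, indicator_of_mem ((h y hy).1 hys)]
    · rw [indicator_of_notMem hys, indicator_of_notMem (fun h' => hys ((h y hy).2 h'))]
  have hsum := integral_add_compl (μ := mu a b) (s := Iio x) measurableSet_Iio hg
  rw [compl_Iio, integral_Ici_eq_integral_Ioi] at hsum
  change _ = ∫ x in Ioo a b, g x at hsum
  rw [h0] at hsum
  rw [sgn]
  rcases hP with rfl | rfl
  · rw [if_pos rfl, hae (measurableSet_beyond _ _) (measurableSet_Ioi (a := x))]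
    · rw [prim]
      linear_combination hsum
    · intro y hy
      rw [beyond, mem_ofPred_eq, abs_of_pos (sub_pos.2 hx.1), abs_of_pos (sub_pos.2 hy.1), mem_Ioi]
      constructor <;> intro h <;> linarith
  · rw [if_neg hab.ne', one_mul, hae (measurableSet_beyond _ _) (measurableSet_Iio (a := x)), prim]
    intro y hy
    rw [beyond, mem_ofPred_eq, abs_of_neg (sub_neg.2 hx.2), abs_of_neg (sub_neg.2 hy.2), mem_Iio]
    constructor <;> intro h <;> linarith

/-- With `A = max ε (τ - r)` the integral runs over `(r + A, d)` and equals `(A ^ (-α) - (d - r) ^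
(-α)) / α`. The separate term `(d - r) ^ (-α)` in the truncated derivative is what cancels the
contribution of the upper limit. -/
theorem integral_rpow_tail {r ε τ d : ℝ} (hα : 0 < α) (hr : 0 ≤ r) (hε : 0 < ε)
    (hεd : r + ε ≤ d) (hτd : τ < d) :
    α * (∫ t in Ioo 0 d, if r + ε < t ∧ τ ≤ t then (t - r) ^ (-(α + 1)) else 0)
      + (d - r) ^ (-α) = (max ε (τ - r)) ^ (-α) := by
  set A := max ε (τ - r) with hA
  have hA0 : 0 < A := lt_max_of_lt_left hε
  have hAd : r + A ≤ d := by
    rcases max_choice ε (τ - r) with h | h <;> rw [hA, h] <;> linarith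
  have e1 : ∫ t in Ioo 0 d, (if r + ε < t ∧ τ ≤ t then (t - r) ^ (-(α + 1)) else 0)
      = ∫ t in Ioo 0 d, (Ioc (r + A) d).indicator (fun t => (t - r) ^ (-(α + 1))) t := by
    refine integral_congr_ae ?_
    filter_upwards [ae_restrict_mem measurableSet_Ioo,
      ae_restrict_of_ae (Measure.ae_ne volume (r + A))] with t ht hne
    by_cases h : r + ε < t ∧ τ ≤ t
    · rw [if_pos h, indicator_of_mem]
      refine ⟨lt_of_le_of_ne ?_ hne.symm, ht.2.le⟩
      rcases max_choice ε (τ - r) with h' | h' <;> rw [hA, h'] <;> linarith [h.1, h.2]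
    · rw [if_neg h, indicator_of_notMem]
      rintro ⟨h1, -⟩
      exact h ⟨by linarith [le_max_left ε (τ - r)], by linarith [le_max_right ε (τ - r)]⟩
  have e2 : ∫ t in Ioo 0 d, (Ioc (r + A) d).indicator (fun t => (t - r) ^ (-(α + 1))) t
      = ∫ t in (r + A)..d, (t - r) ^ (-(α + 1)) := by
    rw [← integral_Ioc_eq_integral_Ioo, setIntegral_indicator measurableSet_Ioc,
      intervalIntegral.integral_of_le hAd]
    congr 2
    ext t
    constructor
    · exact fun h => h.2
    · exact fun h => ⟨⟨by linarith [h.1], h.2⟩, h⟩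
  have e3 : ∫ t in (r + A)..d, (t - r) ^ (-(α + 1)) = ((d - r) ^ (-α) - A ^ (-α)) / (-α) := by
    rw [intervalIntegral.integral_comp_sub_right (fun t => t ^ (-(α + 1))), add_sub_cancel_left,
      integral_rpow]
    · norm_num
    · refine Or.inr ⟨by linarith, fun h => ?_⟩
      rw [uIcc_of_le (by linarith)] at h
      linarith [h.1]
  rw [e1, e2, e3]
  field_simp
  ring

/-- The truncated fractional derivative of a function in `H¹₀` as a weakly singular integral of
its derivative. -/
theorem truncDeriv_eq_kerFun (hab : a < b) (hP : P = a ∨ P = b) (hα0 : 0 < α) {ε : ℝ} (hε : 0 < ε)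
    {g u : L2 a b} (h0 : ∫ x in Ioo a b, g x = 0) (hu : u =ᵐ[mu a b] prim a b g) {x : ℝ}
    (hx : x ∈ Ioo a b) (hux : u x = prim a b g x) (hxε : |x - P| ≤ (b - a) - ε) :
    truncDeriv a b P α ε u x
      = ((1 / Real.Gamma (1 - α) : ℝ) : ℂ) * (sgn a P * kerFun a b (derivKernel P α ε) g x) := by
  have hg := integrable_L2 g
  set r := |x - P| with hr
  set d := b - a with hd
  -- Up to the sign `sgn a P`, `u x - u s` is the integral of `g` over the `y` with `r < |y - P| ≤
  -- |s - P|`. `K` combines this with the singular weight in `s`; the gap `ε` keeps the weight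
  -- bounded, so Fubini applies.
  let K : ℝ → ℝ → ℂ := fun s y => if (r + ε < |s - P| ∧ |y - P| ≤ |s - P|) ∧ r < |y - P| then
    (((|s - P| - r) ^ (-(α + 1)) : ℝ) : ℂ) * g y else 0
  have hint : Integrable (Function.uncurry K) ((mu a b).prod (mu a b)) := by
    have hb : Integrable (fun p : ℝ × ℝ => (if (r + ε < |p.1 - P| ∧ |p.2 - P| ≤ |p.1 - P|) ∧
        r < |p.2 - P| then (((|p.1 - P| - r) ^ (-(α + 1)) : ℝ) : ℂ) else 0) * g p.2)
        ((mu a b).prod (mu a b)) := by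
      refine Integrable.bdd_mul (c := ε ^ (-(α + 1))) ?_ ?_ (ae_of_all _ fun p => ?_)
      · exact hg.comp_snd (mu a b)
      · refine Measurable.aestronglyMeasurable (Measurable.ite ?_ ?_ measurable_const)
        · refine MeasurableSet.inter (MeasurableSet.inter ?_ ?_) ?_
          · exact measurableSet_lt (f := fun _ : ℝ × ℝ => r + ε) (g := fun p => |p.1 - P|)
              (by fun_prop) (by fun_prop)
          · exact measurableSet_le (f := fun p : ℝ × ℝ => |p.2 - P|) (g := fun p => |p.1 - P|)
              (by fun_prop) (by fun_prop)
          · exact measurableSet_lt (f := fun _ : ℝ × ℝ => r) (g := fun p => |p.2 - P|)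
              (by fun_prop) (by fun_prop)
        · fun_prop
      · split_ifs with h
        · rw [Complex.norm_real, Real.norm_eq_abs, abs_of_nonneg
            (Real.rpow_nonneg (by linarith [h.1.1]) _)]
          exact Real.rpow_le_rpow_of_nonpos hε (by linarith [h.1.1]) (by linarith)
        · rw [norm_zero]; positivity
    refine hb.congr (ae_of_all _ fun p => ?_)
    simp only [Function.uncurry, K]
    split_ifs <;> simp
  have hdiff : ∀ᵐ s ∂(mu a b), s ∈ farSet a b P ε x → (u x - u s) /
      (((|s - P| - r) ^ (α + 1) : ℝ) : ℂ) = sgn a P * ∫ y, K s y ∂(mu a b) := by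
    filter_upwards [hu, ae_restrict_mem measurableSet_Ioo] with s hs hs' hfar
    have h1 : r + ε < |s - P| := hfar.2
    rw [hux, hs, prim_eq_beyond hab hP hg h0 hx, prim_eq_beyond hab hP hg h0 hs', ← mul_sub,
      mul_div_assoc]
    congr 1
    have hsub : beyond P s ⊆ beyond P x := fun y hy => by
      have : |s - P| < |y - P| := hy
      change |x - P| < |y - P|
      linarith
    have h2 : (∫ y in beyond P x, g y ∂(mu a b)) - ∫ y in beyond P s, g y ∂(mu a b)
        = ∫ y in beyond P x \ beyond P s, g y ∂(mu a b) := by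
      rw [setIntegral_sdiff (measurableSet_beyond P s) hg.integrableOn hsub]
    rw [h2, ← integral_indicator ((measurableSet_beyond P x).diff (measurableSet_beyond P s)),
      div_eq_inv_mul, ← integral_const_mul]
    refine integral_congr_ae (ae_of_all _ fun y => ?_)
    have h3 : y ∈ beyond P x \ beyond P s ↔ (r + ε < |s - P| ∧ |y - P| ≤ |s - P|) ∧ r < |y - P| := by
      rw [Set.mem_sdiff, beyond, beyond, mem_ofPred_eq, mem_ofPred_eq, not_lt]
      tauto
    simp only [K]
    by_cases h4 : y ∈ beyond P x \ beyond P s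
    · rw [indicator_of_mem h4, if_pos (h3.1 h4), Real.rpow_neg (by linarith), Complex.ofReal_inv]
    · rw [indicator_of_notMem h4, if_neg (fun h => h4 (h3.2 h)), mul_zero]
  have hfar : ∫ s in farSet a b P ε x, (u x - u s) / (((|s - P| - r) ^ (α + 1) : ℝ) : ℂ)
      = sgn a P * ∫ y, ∫ s, K s y ∂(mu a b) ∂(mu a b) := by
    rw [← integral_integral_swap hint, ← integral_const_mul, ← integral_indicator
      (measurableSet_farSet a b P ε x), ← integral_indicator measurableSet_Ioo]
    have := (ae_restrict_iff' measurableSet_Ioo).1 hdiff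
    refine integral_congr_ae ?_
    filter_upwards [this] with s hs
    by_cases h1 : s ∈ farSet a b P ε x
    · rw [indicator_of_mem h1, indicator_of_mem h1.1, hs h1.1 h1]
    · rw [indicator_of_notMem h1]
      by_cases h2 : s ∈ Ioo a b
      · rw [indicator_of_mem h2]
        have : ∀ y, K s y = 0 := fun y => if_neg fun h => h1 ⟨h2, h.1.1⟩
        simp [this]
      · rw [indicator_of_notMem h2]
  -- Integrating in `s` first gives the tail integral with `τ = |y - P|`: the kernel `max(ε, τ - r)
  -- ^ (-α)` minus the endpoint term, which later cancels against the second term of `truncDeriv`.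
  have hinner : ∀ᵐ y ∂(mu a b), (α : ℂ) * ∫ s, K s y ∂(mu a b) =
      (derivKernel P α ε (x, y) : ℂ) * g y
        - (((d - r) ^ (-α) : ℝ) : ℂ) * (beyond P x).indicator g y := by
    filter_upwards [ae_restrict_mem measurableSet_Ioo] with y hy
    by_cases h1 : r < |y - P|
    · have e1 : ∫ s, K s y ∂(mu a b) = ((∫ s in Ioo a b, if r + ε < |s - P| ∧ |y - P| ≤ |s - P| then
          (|s - P| - r) ^ (-(α + 1)) else 0 : ℝ) : ℂ) * g y := by
        rw [← integral_complex_ofReal, ← integral_mul_const]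
        refine integral_congr_ae (ae_of_all _ fun s => ?_)
        simp only [K, h1, and_true]
        split_ifs <;> simp
      have e2 := integral_radial hab.le hP (fun t => if r + ε < t ∧ |y - P| ≤ t then
          (t - r) ^ (-(α + 1)) else 0)
      have e3 := integral_rpow_tail hα0 (abs_nonneg (x - P)) hε (by linarith : r + ε ≤ d)
        (abs_sub_endpoint_lt hP hy)
      have e4 : derivKernel P α ε (x, y) = (max ε (|y - P| - r)) ^ (-α) := if_pos h1
      rw [e1, e2, indicator_of_mem (show y ∈ beyond P x from h1), e4, ← e3]
      push_cast
      ring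
    · have e1 : ∀ s, K s y = 0 := fun s => if_neg fun h => h1 h.2
      have e4 : derivKernel P α ε (x, y) = 0 := if_neg h1
      rw [indicator_of_notMem (show y ∉ beyond P x from h1), e4]
      simp [e1]
  have hK := (isSing_derivKernel (a := a) (b := b) hP hα0 hε.le).bound x hx
  have hi2 : Integrable (fun y => (((d - r) ^ (-α) : ℝ) : ℂ) * (beyond P x).indicator g y)
      (mu a b) := (hg.indicator (measurableSet_beyond P x)).const_mul _
  have hi1 : Integrable (fun y => (derivKernel P α ε (x, y) : ℂ) * g y) (mu a b) := by
    have := ((hint.integral_prod_right.const_mul (α : ℂ)).congr hinner).add hi2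
    refine this.congr (ae_of_all _ fun y => ?_)
    simp
  have hfin : (α : ℂ) * ∫ y, ∫ s, K s y ∂(mu a b) ∂(mu a b)
      = kerFun a b (derivKernel P α ε) g x
        - (((d - r) ^ (-α) : ℝ) : ℂ) * ∫ y in beyond P x, g y ∂(mu a b) := by
    rw [← integral_const_mul, integral_congr_ae hinner, integral_sub hi1 hi2, integral_const_mul,
      integral_indicator (measurableSet_beyond P x)]
    rfl
  rw [truncDeriv, if_pos hxε, hfar, hux, prim_eq_beyond hab hP hg h0 hx]
  push_cast
  linear_combination (sgn a P / (Real.Gamma (1 - α) : ℂ)) * hfin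

end FractionalDerivative

/-! ### Convergence of the truncated derivatives on `H¹₀` -/

section FractionalDerivativeDomain

variable {a b P α : ℝ}

/-- The majorant does not depend on `ε`. In the branch near the far end, `q = d - r < ε`, so the
factor multiplying `u x / α` is at most `q ^ (-α)` in modulus. Every `y` beyond `x` satisfies `|x -
y| < q`, so `q ^ (-α) |u x|` is absorbed by the weakly singular integral. -/
theorem enorm_truncDeriv_le (hab : a < b) (hP : P = a ∨ P = b) (hα0 : 0 < α) {ε : ℝ} (hε : 0 < ε)
    {g u : L2 a b} (h0 : ∫ x in Ioo a b, g x = 0) (hu : u =ᵐ[mu a b] prim a b g) {x : ℝ}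
    (hx : x ∈ Ioo a b) (hux : u x = prim a b g x) :
    ‖truncDeriv a b P α ε u x‖ₑ ≤ (‖((1 / Real.Gamma (1 - α) : ℝ) : ℂ)‖ₑ + ‖(1 / α : ℂ)‖ₑ) *
      ∫⁻ y in Ioo a b, ENNReal.ofReal (|x - y| ^ (-α)) * ‖g y‖ₑ := by
  have hs : ‖sgn a P‖ₑ = 1 := by rw [← ofReal_norm, norm_sgn, ENNReal.ofReal_one]
  by_cases hxε : |x - P| ≤ (b - a) - ε
  · rw [truncDeriv_eq_kerFun hab hP hα0 hε h0 hu hx hux hxε, enorm_mul, enorm_mul, hs, one_mul]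
    gcongr
    · exact le_self_add
    · exact (isSing_derivKernel hP hα0 hε.le).enorm_kerFun_le hx
  · rw [truncDeriv, if_neg hxε]
    push Not at hxε
    have hr := abs_sub_endpoint_lt hP hx
    set q := (b - a) - |x - P| with hq
    have hq0 : 0 < q := by linarith
    have h1 : ‖((1 / ε ^ α - 1 / q ^ α : ℝ) : ℂ)‖ₑ ≤ ENNReal.ofReal (q ^ (-α)) := by
      rw [← ofReal_norm, Complex.norm_real, Real.norm_eq_abs]
      refine ENNReal.ofReal_le_ofReal ?_
      have h2 : 1 / ε ^ α ≤ 1 / q ^ α :=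
        one_div_le_one_div_of_le (by positivity) (Real.rpow_le_rpow hq0.le (by linarith) hα0.le)
      have h3 : 0 ≤ 1 / ε ^ α := by positivity
      rw [abs_of_nonpos (by linarith), Real.rpow_neg hq0.le, inv_eq_one_div]
      linarith
    have h2 : ‖u x‖ₑ * ENNReal.ofReal (q ^ (-α))
        ≤ ∫⁻ y in Ioo a b, ENNReal.ofReal (|x - y| ^ (-α)) * ‖g y‖ₑ := by
      rw [hux, prim_eq_beyond hab hP (integrable_L2 g) h0 hx, enorm_mul, hs, one_mul, mul_comm]
      calc ENNReal.ofReal (q ^ (-α)) * ‖∫ y in beyond P x, g y ∂(mu a b)‖ₑ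
          ≤ ENNReal.ofReal (q ^ (-α)) * ∫⁻ y in beyond P x, ‖g y‖ₑ ∂(mu a b) := by
            gcongr
            exact enorm_integral_le_lintegral_enorm _
        _ = ∫⁻ y in beyond P x, ENNReal.ofReal (q ^ (-α)) * ‖g y‖ₑ ∂(mu a b) := by
            rw [lintegral_const_mul' _ _ ENNReal.ofReal_ne_top]
        _ ≤ ∫⁻ y in beyond P x, ENNReal.ofReal (|x - y| ^ (-α)) * ‖g y‖ₑ ∂(mu a b) := by
            refine lintegral_mono_ae ?_
            filter_upwards [ae_restrict_mem (measurableSet_beyond P x),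
              ae_restrict_of_ae (ae_restrict_mem measurableSet_Ioo)] with y hy hy'
            have hy1 : |x - P| < |y - P| := hy
            have hy2 := abs_sub_endpoint_lt hP hy'
            gcongr ENNReal.ofReal ?_ * _
            rw [← abs_sub_endpoint hP (Ioo_subset_Icc_self hx) (Ioo_subset_Icc_self hy'),
              abs_sub_comm (|x - P|), abs_of_pos (by linarith : 0 < |y - P| - |x - P|)]
            exact Real.rpow_le_rpow_of_nonpos (by linarith) (by linarith) (by linarith)
        _ ≤ _ := setLIntegral_le_lintegral _ _
    calc ‖u x / (α : ℂ) * ((1 / ε ^ α - 1 / q ^ α : ℝ) : ℂ)‖ₑ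
        = ‖(1 / α : ℂ)‖ₑ * (‖u x‖ₑ * ‖((1 / ε ^ α - 1 / q ^ α : ℝ) : ℂ)‖ₑ) := by
          rw [← enorm_mul, ← enorm_mul]
          congr 1
          ring
      _ ≤ _ := by
          gcongr
          · exact le_add_self
          · exact le_trans (by gcongr) h2

theorem aestronglyMeasurable_truncDeriv (hab : a < b) (hP : P = a ∨ P = b) (hα0 : 0 < α) {ε : ℝ}
    (hε : 0 < ε) {g u : L2 a b} (h0 : ∫ x in Ioo a b, g x = 0) (hu : u =ᵐ[mu a b] prim a b g) :
    AEStronglyMeasurable (truncDeriv a b P α ε u) (mu a b) := by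
  have hS : MeasurableSet {x : ℝ | |x - P| ≤ (b - a) - ε} :=
    measurableSet_le (by fun_prop : Measurable fun x : ℝ => |x - P|) measurable_const
  have h1 := ((isSing_derivKernel (a := a) (b := b) (P := P) hP hα0 hε.le).kerFun_aestronglyMeasurable
    (Lp.memLp g)).const_mul (sgn a P) |>.const_mul ((1 / Real.Gamma (1 - α) : ℝ) : ℂ)
  have h2 : AEStronglyMeasurable (fun x => u x / (α : ℂ) *
      ((1 / ε ^ α - 1 / ((b - a) - |x - P|) ^ α : ℝ) : ℂ)) (mu a b) := by
    refine AEStronglyMeasurable.mul ?_ (Measurable.aestronglyMeasurable (by fun_prop))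
    simp_rw [div_eq_mul_inv]
    exact (Lp.memLp u).1.mul_const _
  classical
  refine (AEStronglyMeasurable.piecewise hS h1.restrict h2.restrict).congr ?_
  filter_upwards [hu, ae_restrict_mem measurableSet_Ioo] with x hux hx
  by_cases hxε : |x - P| ≤ (b - a) - ε
  · rw [piecewise_eq_of_mem _ _ _ (show x ∈ {x : ℝ | |x - P| ≤ (b - a) - ε} from hxε),
      truncDeriv_eq_kerFun hab hP hα0 hε h0 hu hx hux hxε]
  · rw [piecewise_eq_of_notMem _ _ _ (show x ∉ {x : ℝ | |x - P| ≤ (b - a) - ε} from hxε),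
      truncDeriv, if_neg hxε]

theorem eLpNorm_two (μ : Measure ℝ) (f : ℝ → ℂ) :
    eLpNorm f 2 μ = (∫⁻ x, ‖f x‖ₑ ^ 2 ∂μ) ^ (1 / 2 : ℝ) := by
  rw [eLpNorm_eq_lintegral_rpow_enorm_toReal (by norm_num) (by norm_num)]
  simp

theorem tendsto_kerFun_derivKernel (hP : P = a ∨ P = b) (hα0 : 0 < α) {g : L2 a b}
    {x : ℝ} (hx : x ∈ Ioo a b)
    (hN : ∫⁻ y in Ioo a b, ENNReal.ofReal (|x - y| ^ (-α)) * ‖g y‖ₑ < ⊤) :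
    Tendsto (fun ε => kerFun a b (derivKernel P α ε) g x) (𝓝[>] 0)
      (𝓝 (kerFun a b (derivKernel P α 0) g x)) := by
  have hbm : AEStronglyMeasurable (fun y => |x - y| ^ (-α) * ‖g y‖) (mu a b) :=
    (Measurable.aestronglyMeasurable (by fun_prop)).mul (Lp.memLp g).1.norm
  refine tendsto_integral_filter_of_dominated_convergence (fun y => |x - y| ^ (-α) * ‖g y‖)
    ?_ ?_ ⟨hbm, ?_⟩ ?_
  · filter_upwards [self_mem_nhdsWithin] with ε hε
    exact ((Complex.measurable_ofReal.comp ((isSing_derivKernel (a := a) (b := b) hP hα0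
      (le_of_lt hε)).meas.comp measurable_prodMk_left)).aestronglyMeasurable).mul (Lp.memLp g).1
  · filter_upwards [self_mem_nhdsWithin] with ε hε
    filter_upwards [ae_restrict_mem measurableSet_Ioo] with y hy
    rw [norm_mul, Complex.norm_real, Real.norm_eq_abs]
    gcongr
    exact (isSing_derivKernel hP hα0 (le_of_lt hε)).bound x hx y hy
  · refine lt_of_le_of_lt (lintegral_mono fun y => ?_) hN
    rw [enorm_mul, enorm_norm, Real.enorm_of_nonneg (by positivity)]
  · refine ae_of_all _ fun y => ?_
    refine tendsto_const_nhds.congr' ?_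
    by_cases h : |x - P| < |y - P|
    · have : Iio (|y - P| - |x - P|) ∈ 𝓝[>] (0 : ℝ) :=
        mem_nhdsWithin_of_mem_nhds (Iio_mem_nhds (by linarith))
      filter_upwards [self_mem_nhdsWithin, this] with ε h1 h2
      simp only [derivKernel, if_pos h]
      rw [mem_Iio] at h2
      rw [max_eq_right h2.le, max_eq_right (by linarith)]
    · refine Eventually.of_forall fun ε => ?_
      simp only [derivKernel, if_neg h]

/-- Functions in `H¹₀` belong to the domain of the fractional derivative. -/
theorem exists_fracDeriv_eq (hab : a < b) (hP : P = a ∨ P = b) (hα0 : 0 < α) (hα1 : α < 1)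
    {g u : L2 a b} (h0 : ∫ x in Ioo a b, g x = 0) (hu : u =ᵐ[mu a b] prim a b g) :
    ∃ h : u ∈ (fracDeriv a b P α).domain, fracDeriv a b P α ⟨u, h⟩ =ᵐ[mu a b]
      fun x => ((1 / Real.Gamma (1 - α) : ℝ) : ℂ) *
        (sgn a P * kerFun a b (derivKernel P α 0) g x) := by
  have hκ := isSing_derivKernel (a := a) (b := b) (P := P) hP hα0 le_rfl
  have hD := ((hκ.memLp_kerFun hab.le hα1 (Lp.memLp g)).const_mul (sgn a P)).const_mul
    ((1 / Real.Gamma (1 - α) : ℝ) : ℂ)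
  set D := fun x => ((1 / Real.Gamma (1 - α) : ℝ) : ℂ) *
    (sgn a P * kerFun a b (derivKernel P α 0) g x) with hDdef
  set N := fun x => ∫⁻ y in Ioo a b, ENNReal.ofReal (|x - y| ^ (-α)) * ‖g y‖ₑ with hN
  set C := ‖((1 / Real.Gamma (1 - α) : ℝ) : ℂ)‖ₑ + ‖(1 / α : ℂ)‖ₑ with hC
  have hCtop : C ≠ ⊤ := by finiteness
  have hNfin : ∫⁻ x in Ioo a b, N x ^ 2 ≠ ⊤ := by
    refine ((lintegral_sing_sq_le (β := α) (Lp.memLp g)).trans_lt ?_).ne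
    have h1 := singMass_lt_top hab.le hα1
    have h2 := (Lp.memLp g).2
    finiteness
  have hle : ∀ ε : ℝ, 0 < ε → ∀ᵐ x ∂(mu a b), ‖truncDeriv a b P α ε u x‖ₑ ≤ C * N x := by
    intro ε hε
    filter_upwards [hu, ae_restrict_mem measurableSet_Ioo] with x hux hx
    exact enorm_truncDeriv_le hab hP hα0 hε h0 hu hx hux
  have hDle : ∀ᵐ x ∂(mu a b), ‖D x‖ₑ ≤ C * N x := by
    filter_upwards [ae_restrict_mem measurableSet_Ioo] with x hx
    have hs : ‖sgn a P‖ₑ = 1 := by rw [← ofReal_norm, norm_sgn, ENNReal.ofReal_one]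
    rw [hDdef, enorm_mul, enorm_mul, hs, one_mul]
    gcongr
    · exact le_self_add
    · exact hκ.enorm_kerFun_le hx
  have hmeas := fun (ε : ℝ) (hε : 0 < ε) =>
    aestronglyMeasurable_truncDeriv (P := P) hab hP hα0 hε h0 hu
  have hrel : (∀ᶠ ε in 𝓝[>] (0 : ℝ), MemLp (truncDeriv a b P α ε u) 2 (mu a b)) ∧
      Tendsto (fun ε : ℝ => eLpNorm (fun x => truncDeriv a b P α ε u x - (hD.toLp D : L2 a b) x) 2
        (mu a b)) (𝓝[>] 0) (𝓝 0) := by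
    constructor
    · filter_upwards [self_mem_nhdsWithin] with ε hε
      refine ⟨hmeas ε hε, ?_⟩
      rw [eLpNorm_two]
      refine ENNReal.rpow_lt_top_of_nonneg (by norm_num) ?_
      have h1 : ∫⁻ x in Ioo a b, ‖truncDeriv a b P α ε u x‖ₑ ^ 2
          ≤ C ^ 2 * ∫⁻ x in Ioo a b, N x ^ 2 := by
        rw [← lintegral_const_mul' _ _ (by finiteness)]
        refine lintegral_mono_ae ?_
        filter_upwards [hle ε hε] with x hx
        rw [← mul_pow]
        gcongr
      exact (h1.trans_lt (by finiteness)).ne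
    -- Dominated convergence with majorant `(2 C N)²`, integrable by the Schur test. For fixed `x`
    -- the branch near the far end plays no role once `ε < d - r`.
    · have h2 : Tendsto (fun ε : ℝ => ∫⁻ x in Ioo a b, ‖truncDeriv a b P α ε u x - D x‖ₑ ^ 2)
          (𝓝[>] 0) (𝓝 (∫⁻ _ in Ioo a b, 0)) := by
        refine tendsto_lintegral_filter_of_dominated_convergence'
          (fun x => (2 * C) ^ 2 * N x ^ 2) ?_ ?_ ?_ ?_
        · filter_upwards [self_mem_nhdsWithin] with ε hε
          exact (((hmeas ε hε).sub hD.1).enorm).pow_const 2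
        · filter_upwards [self_mem_nhdsWithin] with ε hε
          filter_upwards [hle ε hε, hDle] with x h1 h2
          rw [← mul_pow]
          gcongr
          refine (enorm_sub_le).trans ((add_le_add h1 h2).trans_eq ?_)
          ring
        · rw [lintegral_const_mul' _ _ (by finiteness)]
          finiteness
        · filter_upwards [hu, ae_restrict_mem measurableSet_Ioo,
            ae_lintegral_sing_lt_top hab.le hα1 (Lp.memLp g)] with x hux hx hNx
          have h3 : Tendsto (fun ε => truncDeriv a b P α ε u x) (𝓝[>] 0) (𝓝 (D x)) := by
            refine (((tendsto_kerFun_derivKernel hP hα0 hx hNx).const_mul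
              (sgn a P)).const_mul ((1 / Real.Gamma (1 - α) : ℝ) : ℂ)).congr' ?_
            have : Iio ((b - a) - |x - P|) ∈ 𝓝[>] (0 : ℝ) :=
              mem_nhdsWithin_of_mem_nhds (Iio_mem_nhds (by linarith [abs_sub_endpoint_lt hP hx]))
            filter_upwards [self_mem_nhdsWithin, this] with ε h1 h2
            rw [mem_Iio] at h2
            rw [truncDeriv_eq_kerFun hab hP hα0 h1 h0 hu hx hux (by linarith)]
          have h4 := ENNReal.Tendsto.pow (n := 2) (h3.sub_const (D x)).enorm
          simpa using h4
      rw [lintegral_zero] at h2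
      have h5 := (ENNReal.continuous_rpow_const (y := (1 / 2 : ℝ))).tendsto 0 |>.comp h2
      rw [ENNReal.zero_rpow_of_pos (by norm_num)] at h5
      refine h5.congr fun ε => ?_
      rw [Function.comp_apply, ← eLpNorm_two]
      refine eLpNorm_congr_ae ?_
      filter_upwards [hD.coeFn_toLp] with x hx
      rw [hx]
  refine ⟨⟨hD.toLp D, hrel⟩, ?_⟩
  have h : fracDeriv a b P α ⟨u, ⟨hD.toLp D, hrel⟩⟩ = hD.toLp D := ofRel_eq _ hrel
  rw [h]
  exact hD.coeFn_toLp

end FractionalDerivativeDomain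

/-! ### Fourier coefficients of weakly singular convolutions -/

section Oscillatory

theorem norm_exp_I_mul (ξ s : ℝ) : ‖Complex.exp (Complex.I * ξ * s)‖ = 1 := by
  rw [show Complex.I * ξ * s = ((ξ * s : ℝ) : ℂ) * Complex.I by push_cast; ring]
  exact Complex.norm_exp_ofReal_mul_I _

/-- One integration by parts: the boundary terms contribute `δ ^ (-α) + d ^ (-α)` and the total
variation of `s ^ (-α)` contributes `δ ^ (-α) - d ^ (-α)`, all divided by `|ξ|`. -/
theorem norm_integral_rpow_mul_exp_le_of_pos {α δ d ξ : ℝ} (hα0 : 0 < α) (hδ : 0 < δ)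
    (hδd : δ ≤ d) (hξ : ξ ≠ 0) :
    ‖∫ s in δ..d, ((s ^ (-α) : ℝ) : ℂ) * Complex.exp (Complex.I * ξ * s)‖
      ≤ 2 * δ ^ (-α) / |ξ| := by
  have hne : Complex.I * (ξ : ℂ) ≠ 0 := by simp [hξ]
  have hv : ∀ s ∈ uIcc δ d, HasDerivAt
      (fun s : ℝ => Complex.exp (Complex.I * ξ * s) / (Complex.I * ξ))
      (Complex.exp (Complex.I * ξ * s)) s := by
    intro s _
    have h1 : HasDerivAt (fun s : ℝ => Complex.I * ξ * (s : ℂ)) (Complex.I * ξ) s := by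
      simpa using (Complex.ofRealCLM.hasDerivAt (x := s)).const_mul (Complex.I * (ξ : ℂ))
    have h2 := h1.cexp.div_const (Complex.I * (ξ : ℂ))
    rwa [mul_div_cancel_right₀ _ hne] at h2
  have hpos : ∀ s ∈ uIcc δ d, 0 < s := fun s hs => by
    rw [uIcc_of_le hδd] at hs
    exact hδ.trans_le hs.1
  have hu : ∀ s ∈ uIcc δ d, HasDerivAt (fun s : ℝ => ((s ^ (-α) : ℝ) : ℂ))
      (((-α * s ^ (-α - 1) : ℝ)) : ℂ) s := by
    intro s hs
    exact (Real.hasDerivAt_rpow_const (Or.inl (hpos s hs).ne')).ofReal_comp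
  have hcr : ContinuousOn (fun s : ℝ => -α * s ^ (-α - 1)) (uIcc δ d) := by
    refine continuousOn_const.mul fun s hs => ?_
    exact (Real.continuousAt_rpow_const s _ (Or.inl (hpos s hs).ne')).continuousWithinAt
  have hexpc : Continuous fun s : ℝ => Complex.exp (Complex.I * ξ * s) := by fun_prop
  have hcu : ContinuousOn (fun s : ℝ => ((-α * s ^ (-α - 1) : ℝ) : ℂ)) (uIcc δ d) :=
    Complex.continuous_ofReal.comp_continuousOn hcr
  rw [intervalIntegral.integral_mul_deriv_eq_deriv_mul hu hv hcu.intervalIntegrable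
    (hexpc.intervalIntegrable _ _)]
  have hn : ∀ s : ℝ, ‖Complex.exp (Complex.I * ξ * s) / (Complex.I * ξ)‖ = 1 / |ξ| := by
    intro s
    rw [norm_div, norm_exp_I_mul, norm_mul, Complex.norm_I, one_mul, Complex.norm_real,
      Real.norm_eq_abs]
  have hn2 : ∀ s : ℝ, 0 < s → ‖((s ^ (-α) : ℝ) : ℂ)‖ = s ^ (-α) := by
    intro s hs
    rw [Complex.norm_real, Real.norm_eq_abs, abs_of_pos (Real.rpow_pos_of_pos hs _)]
  have h3 : ‖∫ s in δ..d, ((-α * s ^ (-α - 1) : ℝ) : ℂ) *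
      (Complex.exp (Complex.I * ξ * s) / (Complex.I * ξ))‖ ≤ (δ ^ (-α) - d ^ (-α)) / |ξ| := by
    refine (intervalIntegral.norm_integral_le_integral_norm hδd).trans_eq ?_
    have : ∫ s in δ..d, ‖((-α * s ^ (-α - 1) : ℝ) : ℂ) *
        (Complex.exp (Complex.I * ξ * s) / (Complex.I * ξ))‖
        = ∫ s in δ..d, (-1 / |ξ|) * (-α * s ^ (-α - 1)) := by
      refine intervalIntegral.integral_congr fun s hs => ?_
      rw [norm_mul, hn, Complex.norm_real, Real.norm_eq_abs, abs_of_nonpos]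
      · ring
      · have := Real.rpow_pos_of_pos (hpos s hs) (-α - 1)
        nlinarith
    rw [this, intervalIntegral.integral_const_mul, intervalIntegral.integral_eq_sub_of_hasDerivAt
      (fun s hs => Real.hasDerivAt_rpow_const (Or.inl (hpos s hs).ne')) hcr.intervalIntegrable]
    ring
  have hd0 : 0 < d := hδ.trans_le hδd
  calc _ ≤ ‖((d ^ (-α) : ℝ) : ℂ) * (Complex.exp (Complex.I * ξ * d) / (Complex.I * ξ))‖
        + ‖((δ ^ (-α) : ℝ) : ℂ) * (Complex.exp (Complex.I * ξ * δ) / (Complex.I * ξ))‖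
        + (δ ^ (-α) - d ^ (-α)) / |ξ| :=
        (norm_sub_le _ _).trans (add_le_add (norm_sub_le _ _) h3)
    _ = 2 * δ ^ (-α) / |ξ| := by
        rw [norm_mul, norm_mul, hn, hn, hn2 _ hd0, hn2 _ hδ]
        ring

theorem norm_integral_rpow_mul_exp_le_rpow {α d : ℝ} (hα1 : α < 1) (hd : 0 ≤ d) (ξ : ℝ) :
    ‖∫ s in (0 : ℝ)..d, ((s ^ (-α) : ℝ) : ℂ) * Complex.exp (Complex.I * ξ * s)‖
      ≤ d ^ (1 - α) / (1 - α) := by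
  refine (intervalIntegral.norm_integral_le_integral_norm hd).trans_eq ?_
  have : ∫ s in (0 : ℝ)..d, ‖((s ^ (-α) : ℝ) : ℂ) * Complex.exp (Complex.I * ξ * s)‖
      = ∫ s in (0 : ℝ)..d, s ^ (-α) := by
    refine intervalIntegral.integral_congr fun s hs => ?_
    rw [uIcc_of_le hd] at hs
    rw [norm_mul, norm_exp_I_mul, mul_one, Complex.norm_real, Real.norm_eq_abs,
      abs_of_nonneg (Real.rpow_nonneg hs.1 _)]
  rw [this, integral_rpow (Or.inl (by linarith)), Real.zero_rpow (by linarith)]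
  rw [show -α + 1 = 1 - α by ring, sub_zero]

/-- The Fourier transform of a truncated power. -/
theorem norm_integral_rpow_mul_exp_le {α d ξ : ℝ} (hα0 : 0 < α) (hα1 : α < 1) (hd : 0 < d)
    (hξ : ξ ≠ 0) :
    ‖∫ s in (0 : ℝ)..d, ((s ^ (-α) : ℝ) : ℂ) * Complex.exp (Complex.I * ξ * s)‖
      ≤ (1 / (1 - α) + 2) * |ξ| ^ (α - 1) := by
  have hξ' : 0 < |ξ| := abs_pos.2 hξ
  have h1α : 0 < 1 - α := by linarith
  have e1 : (|ξ|⁻¹) ^ (1 - α) = |ξ| ^ (α - 1) := by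
    rw [Real.inv_rpow hξ'.le, ← Real.rpow_neg hξ'.le]
    congr 1; ring
  have e2 : (|ξ|⁻¹) ^ (-α) / |ξ| = |ξ| ^ (α - 1) := by
    rw [Real.inv_rpow hξ'.le, ← Real.rpow_neg hξ'.le, neg_neg, Real.rpow_sub_one hξ'.ne']
  have hp := Real.rpow_pos_of_pos hξ' (α - 1)
  -- The integral is split at `s = 1 / |ξ|`: absolute values below it, oscillation above it. Both
  -- pieces scale as `|ξ| ^ (α - 1)`.
  rcases le_total d |ξ|⁻¹ with h | h
  · refine (norm_integral_rpow_mul_exp_le_rpow hα1 hd.le ξ).trans ?_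
    have : d ^ (1 - α) ≤ |ξ| ^ (α - 1) := e1 ▸ Real.rpow_le_rpow hd.le h h1α.le
    calc d ^ (1 - α) / (1 - α) ≤ |ξ| ^ (α - 1) / (1 - α) := by gcongr
      _ ≤ (1 / (1 - α) + 2) * |ξ| ^ (α - 1) := by
        rw [add_mul, one_div, div_eq_inv_mul]
        linarith
  · have hi : ∀ x y : ℝ, IntervalIntegrable
        (fun s : ℝ => ((s ^ (-α) : ℝ) : ℂ) * Complex.exp (Complex.I * ξ * s)) volume x y := by
      intro x y
      refine IntervalIntegrable.mul_continuousOn ?_ (by fun_prop)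
      have h := intervalIntegral.intervalIntegrable_rpow' (a := x) (b := y) (r := -α) (by linarith)
      exact ⟨h.1.ofReal, h.2.ofReal⟩
    rw [← intervalIntegral.integral_add_adjacent_intervals (hi 0 |ξ|⁻¹) (hi |ξ|⁻¹ d)]
    refine (norm_add_le _ _).trans ((add_le_add
      (norm_integral_rpow_mul_exp_le_rpow hα1 (inv_nonneg.2 hξ'.le) ξ)
      (norm_integral_rpow_mul_exp_le_of_pos hα0 (inv_pos.2 hξ') h hξ)).trans_eq ?_)
    rw [e1, mul_div_assoc, e2]
    ring

end Oscillatory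

/-! ### Fourier coefficients on the extended interval -/

section Modes

variable {a b : ℝ}

/-- The frequencies of the interval `(a, b)` extended by its length on both sides. -/
def freq (a b : ℝ) (n : ℤ) : ℝ := 2 * Real.pi * n / ((b + (b - a)) - (a - (b - a)))

theorem freq_ne_zero (hab : a < b) {n : ℤ} (hn : n ≠ 0) : freq a b n ≠ 0 := by
  have h1 : (b + (b - a)) - (a - (b - a)) ≠ 0 := by
    have : 0 < (b + (b - a)) - (a - (b - a)) := by linarith
    exact this.ne'
  have h2 : (n : ℝ) ≠ 0 := by exact_mod_cast hn
  have h3 := Real.pi_ne_zero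
  rw [freq]
  positivity

theorem freq_zero : freq a b 0 = 0 := by simp [freq]

theorem fourierCoeffOn_eq_freq (hab : a - (b - a) < b + (b - a)) (F : ℝ → ℂ) (n : ℤ) :
    fourierCoeffOn hab F n = (1 / ((b + (b - a)) - (a - (b - a)))) •
      ∫ x in Ioo (a - (b - a)) (b + (b - a)), Complex.exp (Complex.I * (-freq a b n : ℝ) * x) * F x := by
  rw [fourierCoeffOn_eq_integral, intervalIntegral.integral_of_le hab.le,
    integral_Ioc_eq_integral_Ioo]
  congr 2
  funext x
  rw [fourier_coe_apply, smul_eq_mul, freq]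
  congr 2
  push_cast
  ring

theorem lintegral_sq_eq_tsum (hab : a < b) {F : ℝ → ℂ}
    (hF : MemLp F 2 (mu (a - (b - a)) (b + (b - a)))) :
    ∫⁻ x in Ioo (a - (b - a)) (b + (b - a)), ‖F x‖ₑ ^ 2
      = ENNReal.ofReal ((b + (b - a)) - (a - (b - a)))⁻¹ *
        ∑' n : ℤ, ‖∫ x in Ioo (a - (b - a)) (b + (b - a)),
          Complex.exp (Complex.I * (-freq a b n : ℝ) * x) * F x‖ₑ ^ 2 := by
  have hab' : a - (b - a) < b + (b - a) := by linarith
  have hF' : MemLp F 2 (volume.restrict (Ioc (a - (b - a)) (b + (b - a)))) := by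
    rwa [← restrict_Ioo_eq_restrict_Ioc]
  have h := hasSum_sq_fourierCoeffOn hab' hF'
  set ℓ := (b + (b - a)) - (a - (b - a)) with hℓ
  have hℓ0 : 0 < ℓ := by linarith
  have h1 : ∫⁻ x in Ioo (a - (b - a)) (b + (b - a)), ‖F x‖ₑ ^ 2
      = ENNReal.ofReal (∫ x in (a - (b - a))..(b + (b - a)), ‖F x‖ ^ 2) := by
    rw [intervalIntegral.integral_of_le hab'.le, integral_Ioc_eq_integral_Ioo,
      ofReal_integral_eq_lintegral_ofReal]
    · refine lintegral_congr fun x => ?_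
      rw [ENNReal.ofReal_pow (norm_nonneg _), ofReal_norm]
    · exact hF.integrable_norm_pow (by norm_num)
    · exact ae_of_all _ fun x => by positivity
  have h2 : ∫ x in (a - (b - a))..(b + (b - a)), ‖F x‖ ^ 2
      = ℓ * ∑' n : ℤ, ‖fourierCoeffOn hab' F n‖ ^ 2 := by
    rw [h.tsum_eq, smul_eq_mul, ← mul_assoc, mul_inv_cancel₀ hℓ0.ne', one_mul]
  rw [h1, h2, ENNReal.ofReal_mul hℓ0.le,
    ENNReal.ofReal_tsum_of_nonneg (fun n => by positivity) h.summable,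
    ← ENNReal.tsum_mul_left, ← ENNReal.tsum_mul_left]
  refine tsum_congr fun n => ?_
  rw [fourierCoeffOn_eq_freq, norm_smul, mul_pow, ENNReal.ofReal_mul (by positivity), ← mul_assoc,
    ← ENNReal.ofReal_mul hℓ0.le, ENNReal.ofReal_pow (norm_nonneg _), ofReal_norm]
  congr 2
  rw [← hℓ, Real.norm_eq_abs, abs_of_pos (by positivity)]
  field_simp

/-- The exponential with the `n`-th frequency. -/
def mode (a b : ℝ) (n : ℤ) : L2 a b :=
  (memLp_of_continuous (a := a) (b := b) (ψ := fun x : ℝ =>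
    Complex.exp (Complex.I * (freq a b n : ℝ) * x)) (by fun_prop)).toLp

theorem inner_mode (n : ℤ) (h : L2 a b) : inner ℂ (mode a b n) h
    = ∫ x in Ioo a b, Complex.exp (Complex.I * (-freq a b n : ℝ) * x) * h x := by
  rw [inner_eq_integral]
  refine integral_congr_ae ?_
  filter_upwards [(memLp_of_continuous (a := a) (b := b) (ψ := fun x : ℝ =>
    Complex.exp (Complex.I * (freq a b n : ℝ) * x)) (by fun_prop)).coeFn_toLp] with x hx
  rw [mode, hx, ← Complex.exp_conj]
  simp

/-- Parseval on the extended interval for the extension of `h` by zero. Restricted to `(a, b)` the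
exponentials are no longer orthogonal, but they form a tight frame whose constant is the extended
length `3 (b - a)`. -/
theorem tsum_inner_mode (hab : a < b) (h : L2 a b) :
    ∑' n : ℤ, ‖inner ℂ (mode a b n) h‖ₑ ^ 2
      = ENNReal.ofReal ((b + (b - a)) - (a - (b - a))) * ‖h‖ₑ ^ 2 := by
  have hsub : Ioo a b ⊆ Ioo (a - (b - a)) (b + (b - a)) :=
    Ioo_subset_Ioo (by linarith) (by linarith)
  have hr : (mu (a - (b - a)) (b + (b - a))).restrict (Ioo a b) = mu a b := by
    rw [Measure.restrict_restrict measurableSet_Ioo, inter_eq_left.2 hsub]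
  have hF : MemLp ((Ioo a b).indicator h) 2 (mu (a - (b - a)) (b + (b - a))) := by
    rw [memLp_indicator_iff_restrict measurableSet_Ioo, hr]
    exact Lp.memLp h
  have h1 := lintegral_sq_eq_tsum hab hF
  set ℓ := (b + (b - a)) - (a - (b - a)) with hℓ
  have hℓ0 : 0 < ℓ := by linarith
  have h2 : ∫⁻ x in Ioo (a - (b - a)) (b + (b - a)), ‖(Ioo a b).indicator h x‖ₑ ^ 2
      = ‖h‖ₑ ^ 2 := by
    have e1 : ∀ x, ‖(Ioo a b).indicator h x‖ₑ ^ 2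
        = (Ioo a b).indicator (fun x => ‖h x‖ₑ ^ 2) x := by
      intro x
      by_cases hx : x ∈ Ioo a b
      · rw [indicator_of_mem hx, indicator_of_mem hx]
      · rw [indicator_of_notMem hx, indicator_of_notMem hx]; simp
    simp_rw [e1]
    rw [lintegral_indicator measurableSet_Ioo, hr, Lp.enorm_def, eLpNorm_two,
      ← ENNReal.rpow_natCast, ← ENNReal.rpow_mul]
    norm_num
  have h3 : ∀ n : ℤ, ∫ x in Ioo (a - (b - a)) (b + (b - a)),
      Complex.exp (Complex.I * (-freq a b n : ℝ) * x) * (Ioo a b).indicator h x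
      = inner ℂ (mode a b n) h := by
    intro n
    rw [inner_mode]
    let f : ℝ → ℂ := h
    refine Eq.trans ?_ (congrArg (fun ν : Measure ℝ =>
      ∫ x, Complex.exp (Complex.I * (-freq a b n : ℝ) * x) * f x ∂ν) hr)
    refine Eq.trans ?_ (integral_indicator (μ := mu (a - (b - a)) (b + (b - a)))
      (f := fun x : ℝ => Complex.exp (Complex.I * (-freq a b n : ℝ) * x) * f x) measurableSet_Ioo)
    refine integral_congr_ae (ae_of_all _ fun x => ?_)
    by_cases hx : x ∈ Ioo a b
    · simp only [indicator_of_mem hx, f]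
    · simp only [indicator_of_notMem hx, mul_zero]
  simp_rw [h3] at h1
  rw [← h2, h1, ← mul_assoc, ← ENNReal.ofReal_mul hℓ0.le, mul_inv_cancel₀ hℓ0.ne',
    ENNReal.ofReal_one, one_mul]

/-- Integration by parts leaves no boundary terms, since the primitive of a mean-zero function
vanishes at both ends. Hence no periodicity of the exponential on `(a, b)` is needed. -/
theorem inner_mode_primL (n : ℤ) {g : L2 a b} (hg : g ∈ meanZero a b) :
    inner ℂ (mode a b n) g = Complex.I * freq a b n * inner ℂ (mode a b n) (primL a b g) := by
  rw [mem_meanZero] at hg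
  set ξ := freq a b n with hξ
  set ψ : ℝ → ℂ := fun x => Complex.exp (Complex.I * (-ξ : ℝ) * x) with hψ
  have hd : ∀ x, HasDerivAt ψ (-(Complex.I * ξ) * ψ x) x := by
    intro x
    have h1 : HasDerivAt (fun s : ℝ => Complex.I * (-ξ : ℝ) * (s : ℂ)) (Complex.I * (-ξ : ℝ)) x := by
      simpa using (Complex.ofRealCLM.hasDerivAt (x := x)).const_mul (Complex.I * ((-ξ : ℝ) : ℂ))
    refine h1.cexp.congr_deriv ?_
    rw [hψ]
    push_cast
    ring
  have hdd : deriv ψ = fun x => -(Complex.I * ξ) * ψ x := funext fun x => (hd x).deriv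
  have hψc : Continuous ψ := by fun_prop
  have hc : Continuous (deriv ψ) := by rw [hdd]; fun_prop
  have h1 := integral_prim_mul (integrable_L2 g) (integrable_of_continuous (a := a) (b := b) hc)
  rw [hg, zero_mul, zero_sub] at h1
  have h2 : ∫ x in Ioo a b, g x * prim a b (deriv ψ) x = ∫ x in Ioo a b, ψ x * g x := by
    have h3 : ∫ x in Ioo a b, g x * prim a b (deriv ψ) x
        = ∫ x in Ioo a b, (ψ x * g x - ψ a * g x) := by
      refine setIntegral_congr_fun measurableSet_Ioo fun x hx => ?_
      rw [prim_deriv (fun x => (hd x).differentiableAt) hc (Ioo_subset_Icc_self hx)]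
      ring
    have hint : Integrable (fun x => ψ x * g x) (mu a b) := by
      obtain ⟨C, hC⟩ : ∃ C : ℝ, ∀ x, ‖ψ x‖ ≤ C := ⟨1, fun x => (norm_exp_I_mul _ _).le⟩
      exact (integrable_L2 g).bdd_mul (c := C) hψc.aestronglyMeasurable (ae_of_all _ hC)
    rw [h3, integral_sub hint ((integrable_L2 g).const_mul _), integral_const_mul, hg, mul_zero,
      sub_zero]
  have h4 : ∫ x in Ioo a b, prim a b g x * deriv ψ x
      = -(Complex.I * ξ) * ∫ x in Ioo a b, ψ x * (primL a b g) x := by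
    rw [← integral_const_mul]
    refine integral_congr_ae ?_
    filter_upwards [primL_coe g] with x hx
    rw [hx, hdd]
    ring
  rw [inner_mode, inner_mode]
  change ∫ x in Ioo a b, ψ x * g x = Complex.I * ξ * ∫ x in Ioo a b, ψ x * (primL a b g) x
  rw [h4, h2] at h1
  linear_combination h1

end Modes

/-! ### The fractional derivative as a convolution -/

section Extension

variable {a b P α : ℝ}

/-- The function `t ^ (-α)` on `(0, d)`, extended by zero. -/
def powKer (α d t : ℝ) : ℝ := (Ioo 0 d).indicator (fun t => t ^ (-α)) t

theorem abs_powKer_le (α d t : ℝ) : |powKer α d t| ≤ |t| ^ (-α) := by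
  rw [powKer]
  by_cases ht : t ∈ Ioo 0 d
  · rw [indicator_of_mem ht, abs_of_pos ht.1, abs_of_pos (Real.rpow_pos_of_pos ht.1 _)]
  · rw [indicator_of_notMem ht, abs_zero]
    positivity

theorem measurable_powKer (α d : ℝ) : Measurable (powKer α d) :=
  Measurable.indicator (by fun_prop) measurableSet_Ioo

theorem integrable_powKer (hα1 : α < 1) {d : ℝ} (hd : 0 ≤ d) : Integrable (powKer α d) := by
  have h := intervalIntegral.intervalIntegrable_rpow' (a := 0) (b := d) (r := -α) (by linarith)
  rw [intervalIntegrable_iff_integrableOn_Ioo_of_le hd] at h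
  exact (integrable_indicator_iff measurableSet_Ioo).2 h

/-- The direction towards `P`. -/
def dir (a P : ℝ) : ℝ := if P = a then -1 else 1

theorem abs_dir (a P : ℝ) : |dir a P| = 1 := by
  rw [dir]; split_ifs <;> simp

theorem dir_sq (a P : ℝ) : dir a P * dir a P = 1 := by
  rw [dir]; split_ifs <;> norm_num

/-- At `ε = 0` the kernel depends only on `|y - P| - |x - P| = dir a P * (x - y)`. Cutting the power
off at `b - a` costs nothing, as this difference stays below `b - a`. -/
theorem derivKernel_eq_powKer (hab : a < b) (hP : P = a ∨ P = b) {x y : ℝ} (hx : x ∈ Ioo a b)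
    (hy : y ∈ Ioo a b) : derivKernel P α 0 (x, y) = powKer α (b - a) (dir a P * (x - y)) := by
  have key : |y - P| - |x - P| = dir a P * (x - y) := by
    rcases hP with rfl | rfl
    · rw [dir, if_pos rfl, abs_of_pos (sub_pos.2 hx.1), abs_of_pos (sub_pos.2 hy.1)]
      ring
    · rw [dir, if_neg hab.ne', abs_of_neg (sub_neg.2 hx.2), abs_of_neg (sub_neg.2 hy.2)]
      ring
  have hlt := abs_sub_endpoint_lt hP hy
  rw [derivKernel, powKer]
  simp only
  by_cases h : |x - P| < |y - P|
  · rw [if_pos h, indicator_of_mem, key, max_eq_right]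
    · rw [← key]; linarith
    · rw [← key]
      exact ⟨by linarith, by linarith [abs_nonneg (x - P)]⟩
  · rw [if_neg h, indicator_of_notMem]
    rw [← key]
    exact fun h' => h (by linarith [h'.1])

/-- The convolution of `g` with a truncated power. -/
def powConv (a b P α : ℝ) (g : ℝ → ℂ) (x : ℝ) : ℂ :=
  ∫ y in Ioo a b, (powKer α (b - a) (dir a P * (x - y)) : ℂ) * g y

theorem kerFun_eq_powConv (hab : a < b) (hP : P = a ∨ P = b) (g : ℝ → ℂ) {x : ℝ}
    (hx : x ∈ Ioo a b) : kerFun a b (derivKernel P α 0) g x = powConv a b P α g x := by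
  refine setIntegral_congr_fun measurableSet_Ioo fun y hy => ?_
  simp only [derivKernel_eq_powKer hab hP hx hy]

theorem memLp_powConv (hab : a < b) (hα1 : α < 1) {g : ℝ → ℂ} (hg : MemLp g 2 (mu a b)) :
    MemLp (powConv a b P α g) 2 (mu (a - (b - a)) (b + (b - a))) := by
  have hsub : Ioo a b ⊆ Ioo (a - (b - a)) (b + (b - a)) :=
    Ioo_subset_Ioo (by linarith) (by linarith)
  have hr : (mu (a - (b - a)) (b + (b - a))).restrict (Ioo a b) = mu a b := by
    rw [Measure.restrict_restrict measurableSet_Ioo, inter_eq_left.2 hsub]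
  have hF : MemLp ((Ioo a b).indicator g) 2 (mu (a - (b - a)) (b + (b - a))) := by
    rwa [memLp_indicator_iff_restrict measurableSet_Ioo, hr]
  have hκ : IsSing (a - (b - a)) (b + (b - a)) α
      fun p => powKer α (b - a) (dir a P * (p.1 - p.2)) := by
    refine ⟨(measurable_powKer _ _).comp (by fun_prop), fun x _ y _ => ?_⟩
    refine (abs_powKer_le _ _ _).trans_eq ?_
    rw [abs_mul, abs_dir, one_mul]
  refine (memLp_congr_ae (ae_of_all _ fun x => ?_)).1 (hκ.memLp_kerFun (by linarith) hα1 hF)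
  let f : ℝ → ℂ := fun y => (powKer α (b - a) (dir a P * (x - y)) : ℂ) * g y
  refine Eq.trans ?_ ((integral_indicator (μ := mu (a - (b - a)) (b + (b - a))) (f := f)
    measurableSet_Ioo).trans (congrArg (fun ν : Measure ℝ => ∫ y, f y ∂ν) hr))
  refine integral_congr_ae (ae_of_all _ fun y => ?_)
  by_cases hy : y ∈ Ioo a b
  · simp only [indicator_of_mem hy, f]
  · simp only [indicator_of_notMem hy, mul_zero]

/-- The kernel has reach `b - a`, so the convolution lives in the interval extended by `b - a` on
both sides. This is why that extension suffices for its coefficients to be values of a Fourier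
transform on the line. -/
theorem powConv_eq_zero (g : ℝ → ℂ) {x : ℝ}
    (hx : x ∉ Ioo (a - (b - a)) (b + (b - a))) : powConv a b P α g x = 0 := by
  refine setIntegral_eq_zero_of_forall_eq_zero fun y hy => ?_
  have : dir a P * (x - y) ∉ Ioo 0 (b - a) := by
    intro h
    have h1 : |x - y| < b - a := by
      have := h.2
      rwa [← abs_of_pos h.1, abs_mul, abs_dir, one_mul] at this
    rw [abs_lt] at h1
    exact hx ⟨by linarith [h1.1, hy.1], by linarith [h1.2, hy.2]⟩
  rw [powKer, indicator_of_notMem this]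
  simp

theorem integral_exp_mul_powKer (hab : a < b) (P ξ : ℝ) :
    ∫ s : ℝ, Complex.exp (Complex.I * ξ * s) * (powKer α (b - a) (dir a P * s) : ℂ)
      = ∫ s in (0 : ℝ)..(b - a), ((s ^ (-α) : ℝ) : ℂ) *
        Complex.exp (Complex.I * (dir a P * ξ : ℝ) * s) := by
  have h1 := Measure.integral_comp_mul_left (fun s : ℝ =>
    Complex.exp (Complex.I * (dir a P * ξ : ℝ) * s) * (powKer α (b - a) s : ℂ)) (dir a P)
  rw [abs_inv, abs_dir, inv_one, one_smul] at h1
  rw [intervalIntegral.integral_of_le (by linarith), integral_Ioc_eq_integral_Ioo]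
  have h2 : ∫ s : ℝ, Complex.exp (Complex.I * (dir a P * ξ : ℝ) * s) * (powKer α (b - a) s : ℂ)
      = ∫ s in Ioo 0 (b - a), ((s ^ (-α) : ℝ) : ℂ) *
        Complex.exp (Complex.I * (dir a P * ξ : ℝ) * s) := by
    rw [← integral_indicator measurableSet_Ioo]
    refine integral_congr_ae (ae_of_all _ fun s => ?_)
    simp only [powKer]
    by_cases hs : s ∈ Ioo 0 (b - a)
    · rw [indicator_of_mem hs, indicator_of_mem hs, mul_comm]
    · rw [indicator_of_notMem hs, indicator_of_notMem hs]
      simp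
  rw [← h2, ← h1]
  refine integral_congr_ae (ae_of_all _ fun s => ?_)
  simp only
  congr 2
  have h3 : ((dir a P : ℝ) : ℂ) * (dir a P : ℝ) = 1 := by exact_mod_cast dir_sq a P
  push_cast
  linear_combination (-(Complex.I * ξ * s)) * h3

/-- The Fourier coefficients of a convolution. -/
theorem integral_exp_mul_powConv (hab : a < b) (hα1 : α < 1) {g : ℝ → ℂ}
    (hg : Integrable g (mu a b)) (P ξ : ℝ) :
    ∫ x in Ioo (a - (b - a)) (b + (b - a)), Complex.exp (Complex.I * ξ * x) * powConv a b P α g x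
      = (∫ x in Ioo a b, Complex.exp (Complex.I * ξ * x) * g x) *
        ∫ s in (0 : ℝ)..(b - a), ((s ^ (-α) : ℝ) : ℂ) *
          Complex.exp (Complex.I * (dir a P * ξ : ℝ) * s) := by
  rw [← integral_exp_mul_powKer hab, setIntegral_eq_integral_of_forall_compl_eq_zero
    (fun x hx => by rw [powConv_eq_zero g hx, mul_zero]), ← integral_indicator measurableSet_Ioo]
  have hexp : ∀ {f : ℝ → ℂ}, Integrable f →
      Integrable fun x : ℝ => Complex.exp (Complex.I * ξ * x) * f x := fun hf =>
    hf.bdd_mul (c := 1) (Continuous.aestronglyMeasurable (by fun_prop))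
      (ae_of_all _ fun x => (norm_exp_I_mul _ _).le)
  have h1 : Integrable ((Ioo a b).indicator fun x : ℝ => Complex.exp (Complex.I * ξ * x) * g x) := by
    have h := hexp ((integrable_indicator_iff measurableSet_Ioo).2 hg)
    refine h.congr (ae_of_all _ fun x => ?_)
    by_cases hx : x ∈ Ioo a b
    · simp only [indicator_of_mem hx]
    · simp only [indicator_of_notMem hx, mul_zero]
  have h2 : Integrable fun s : ℝ =>
      Complex.exp (Complex.I * ξ * s) * (powKer α (b - a) (dir a P * s) : ℂ) := by
    refine hexp (Integrable.ofReal (𝕜 := ℂ) ?_)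
    refine (integrable_powKer hα1 (by linarith)).comp_mul_left' ?_
    intro h
    have := abs_dir a P
    rw [h, abs_zero] at this
    exact zero_ne_one this
  -- Both factors carry the exponential, which is multiplicative, so the integral of their
  -- convolution is the Fourier integral of `powConv`.
  have h3 := integral_convolution (ContinuousLinearMap.mul ℂ ℂ) h1 h2
  rw [ContinuousLinearMap.mul_apply'] at h3
  rw [← h3]
  refine integral_congr_ae (ae_of_all _ fun x => ?_)
  simp only [convolution_def, ContinuousLinearMap.mul_apply', powConv]
  rw [← integral_const_mul, ← integral_indicator measurableSet_Ioo]
  refine integral_congr_ae (ae_of_all _ fun y => ?_)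
  by_cases hy : y ∈ Ioo a b
  · simp only [indicator_of_mem hy]
    have : Complex.exp (Complex.I * ξ * x) = Complex.exp (Complex.I * ξ * y) *
        Complex.exp (Complex.I * ξ * (x - y : ℝ)) := by
      rw [← Complex.exp_add]
      congr 1
      push_cast
      ring
    rw [this]
    ring
  · simp only [indicator_of_notMem hy, zero_mul]

theorem enorm_integral_exp_mul_powConv_le (hab : a < b) (hα0 : 0 < α) (hα1 : α < 1) (P : ℝ) (n : ℤ)
    (hn : n ≠ 0) (g : L2 a b) :
    ‖∫ x in Ioo (a - (b - a)) (b + (b - a)),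
        Complex.exp (Complex.I * (-freq a b n : ℝ) * x) * powConv a b P α g x‖ₑ
      ≤ ENNReal.ofReal ((1 / (1 - α) + 2) * |freq a b n| ^ (α - 1)) *
        ‖inner ℂ (mode a b n) g‖ₑ := by
  rw [integral_exp_mul_powConv hab hα1 (integrable_L2 g), ← inner_mode, enorm_mul, mul_comm]
  gcongr
  rw [← ofReal_norm]
  refine ENNReal.ofReal_le_ofReal ?_
  have h1 : dir a P * -freq a b n ≠ 0 := by
    refine mul_ne_zero ?_ (neg_ne_zero.2 (freq_ne_zero hab hn))
    intro h
    have := abs_dir a P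
    rw [h, abs_zero] at this
    exact zero_ne_one this
  refine (norm_integral_rpow_mul_exp_le hα0 hα1 (by linarith : 0 < b - a) h1).trans_eq ?_
  rw [abs_mul, abs_dir, one_mul, abs_neg]

end Extension

/-! ### Domination of the fractional derivative by the fractional power -/

section Estimate

variable {a b P α : ℝ} {T U : L2 a b →L[ℂ] L2 a b} {hT : Function.Injective T}

/-- With `w = (t + J)⁻¹ f` one has `f = J w + t w`, so `U f = w' + t U w`, and the coefficient of
`w'` is `iξ` times that of `w`. This is the splitting of real interpolation between `L²` and `H¹₀`.
-/
theorem norm_inner_mode_le (hm : ∀ f, U f ∈ meanZero a b)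
    (hU : ∀ f, primL a b (U f) = T f) (hJ : MAccretive (invP T hT)) (f : L2 a b) (n : ℤ) {t : ℝ}
    (ht : 0 < t) :
    ‖inner ℂ (mode a b n) (U f)‖
      ≤ |freq a b n| * ‖inner ℂ (mode a b n) (resolventOp (invP T hT) t f)‖
        + t * ‖inner ℂ (mode a b n) (U (resolventOp (invP T hT) t f))‖ := by
  obtain ⟨h, hf⟩ := (isResolvent_resolventOp hJ (ζ := t) (by simpa using ht)).2 f
  set w := resolventOp (invP T hT) t f with hw
  have h1 : T (invP T hT ⟨w, h⟩) = w := apply_invP _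
  have h2 : U f = U (invP T hT ⟨w, h⟩) + (t : ℂ) • U w := by
    conv_lhs => rw [← hf]
    rw [map_add, map_smul]
  rw [h2, inner_add_right, inner_smul_right, inner_mode_primL n (hm _), hU, h1]
  refine (norm_add_le _ _).trans_eq ?_
  rw [norm_mul, norm_mul, norm_mul, Complex.norm_I, one_mul, Complex.norm_real, Complex.norm_real,
    Real.norm_eq_abs, Real.norm_eq_abs, abs_of_pos ht]

/-- For `0 < t < |ξ|` the factor `t` in the splitting may be replaced by `|ξ|`. Squaring and
integrating over this range against `t ^ (2α - 1)`, whose mass is `|ξ| ^ (2α) / (2α)`, gives the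
weight and the constant `4α`. -/
theorem enorm_inner_mode_sq_le (hα0 : 0 < α) (hm : ∀ f, U f ∈ meanZero a b)
    (hU : ∀ f, primL a b (U f) = T f) (hJ : MAccretive (invP T hT)) (f : L2 a b) {n : ℤ}
    (hn : freq a b n ≠ 0) :
    ENNReal.ofReal (|freq a b n| ^ (2 * α - 2)) * ‖inner ℂ (mode a b n) (U f)‖ₑ ^ 2
      ≤ ENNReal.ofReal (4 * α) * ∫⁻ t in Ioi (0 : ℝ), ENNReal.ofReal (t ^ (2 * α - 1)) *
        (‖inner ℂ (mode a b n) (resolventOp (invP T hT) t f)‖ₑ ^ 2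
          + ‖inner ℂ (mode a b n) (U (resolventOp (invP T hT) t f))‖ₑ ^ 2) := by
  set ξ := |freq a b n| with hξ
  have hξ0 : 0 < ξ := abs_pos.2 hn
  set p := fun t : ℝ => ‖inner ℂ (mode a b n) (resolventOp (invP T hT) t f)‖ with hp
  set q := fun t : ℝ => ‖inner ℂ (mode a b n) (U (resolventOp (invP T hT) t f))‖ with hq
  set m := ‖inner ℂ (mode a b n) (U f)‖ with hmdef
  have h1 : ∀ t ∈ Ioo 0 ξ, m ^ 2 ≤ 2 * ξ ^ 2 * (p t ^ 2 + q t ^ 2) := by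
    intro t ht
    have h2 : m ≤ ξ * (p t + q t) := by
      refine (norm_inner_mode_le hm hU hJ f n ht.1).trans ?_
      rw [mul_add]
      gcongr
      exact ht.2.le
    have hp0 : 0 ≤ p t := norm_nonneg _
    have hq0 : 0 ≤ q t := norm_nonneg _
    calc m ^ 2 ≤ (ξ * (p t + q t)) ^ 2 := by gcongr
      _ = ξ ^ 2 * (p t + q t) ^ 2 := by ring
      _ ≤ ξ ^ 2 * (2 * (p t ^ 2 + q t ^ 2)) := by
        gcongr
        nlinarith [sq_nonneg (p t - q t)]
      _ = _ := by ring
  have hint : ∫⁻ t in Ioo 0 ξ, ENNReal.ofReal (t ^ (2 * α - 1))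
      = ENNReal.ofReal (ξ ^ (2 * α) / (2 * α)) := by
    have h := intervalIntegral.intervalIntegrable_rpow' (a := 0) (b := ξ) (r := 2 * α - 1)
      (by linarith)
    rw [intervalIntegrable_iff_integrableOn_Ioo_of_le hξ0.le] at h
    rw [← ofReal_integral_eq_lintegral_ofReal h]
    · rw [← integral_Ioc_eq_integral_Ioo, ← intervalIntegral.integral_of_le hξ0.le,
        integral_rpow (Or.inl (by linarith)), sub_add_cancel, Real.zero_rpow (by positivity), sub_zero]
    · filter_upwards [ae_restrict_mem measurableSet_Ioo] with t ht
      exact Real.rpow_nonneg ht.1.le _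
  have h3 : ENNReal.ofReal (ξ ^ (2 * α) / (2 * α)) * ENNReal.ofReal (m ^ 2)
      ≤ ENNReal.ofReal (2 * ξ ^ 2) * ∫⁻ t in Ioi (0 : ℝ), ENNReal.ofReal (t ^ (2 * α - 1)) *
        ENNReal.ofReal (p t ^ 2 + q t ^ 2) := by
    rw [← hint, ← lintegral_mul_const' _ _ ENNReal.ofReal_ne_top,
      ← lintegral_const_mul' _ _ ENNReal.ofReal_ne_top]
    refine le_trans ?_ (lintegral_mono_set (s := Ioo 0 ξ) fun t ht => ht.1)
    refine setLIntegral_mono_ae' measurableSet_Ioo (ae_of_all _ fun t ht => ?_)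
    rw [mul_left_comm]
    gcongr
    rw [← ENNReal.ofReal_mul (by positivity)]
    exact ENNReal.ofReal_le_ofReal (h1 t ht)
  have e1 : ∀ z : ℂ, ‖z‖ₑ ^ 2 = ENNReal.ofReal (‖z‖ ^ 2) := fun z => by
    rw [ENNReal.ofReal_pow (norm_nonneg _), ofReal_norm]
  have e2 : ∀ t, ENNReal.ofReal (p t ^ 2) + ENNReal.ofReal (q t ^ 2)
      = ENNReal.ofReal (p t ^ 2 + q t ^ 2) := fun t =>
    (ENNReal.ofReal_add (by positivity) (by positivity)).symm
  simp_rw [e1]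
  change _ * ENNReal.ofReal (m ^ 2) ≤ _ * ∫⁻ t in Ioi (0 : ℝ), _ *
    (ENNReal.ofReal (p t ^ 2) + ENNReal.ofReal (q t ^ 2))
  simp_rw [e2]
  have e3 : ENNReal.ofReal (ξ ^ (2 * α - 2))
      = ENNReal.ofReal (2 * α / ξ ^ 2) * ENNReal.ofReal (ξ ^ (2 * α) / (2 * α)) := by
    rw [← ENNReal.ofReal_mul (by positivity), Real.rpow_sub hξ0, Real.rpow_two]
    congr 1
    field_simp
  calc _ = ENNReal.ofReal (2 * α / ξ ^ 2) *
        (ENNReal.ofReal (ξ ^ (2 * α) / (2 * α)) * ENNReal.ofReal (m ^ 2)) := by rw [e3, mul_assoc]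
    _ ≤ _ := mul_le_mul_right h3 _
    _ = _ := by
      rw [← mul_assoc, ← ENNReal.ofReal_mul (by positivity)]
      congr 2
      field_simp
      norm_num

/-- The fractional derivative is bounded relative to the fractional power of the same order. -/
theorem exists_lintegral_kerFun_le (hab : a < b) (hP : P = a ∨ P = b) (hα0 : 0 < α) (hα1 : α < 1)
    (hm : ∀ f, U f ∈ meanZero a b) (hU : ∀ f, primL a b (U f) = T f) (hn : ∀ f, ‖U f‖ = ‖f‖)
    (hJ : MAccretive (invP T hT))
    (hacc : ∀ u : (invP T hT).domain, 0 ≤ (inner ℂ (u : L2 a b) (invP T hT u)).re) :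
    ∃ C : ℝ, 0 ≤ C ∧ ∀ f : L2 a b,
      ∫⁻ x in Ioo a b, ‖kerFun a b (derivKernel P α 0) (U f) x‖ₑ ^ 2
        ≤ ENNReal.ofReal (C * ‖∫ t in Ioi (0 : ℝ), balaIntegrand (invP T hT) α f t‖ ^ 2) := by
  set ℓ := (b + (b - a)) - (a - (b - a)) with hℓ
  have hℓ0 : 0 < ℓ := by linarith
  set M := (1 / (1 - α) + 2) ^ 2 * (4 * α) with hM
  have h1α : 0 < 1 - α := by linarith
  refine ⟨ℓ⁻¹ * (M * (2 * ℓ * α)), by positivity, fun f => ?_⟩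
  have hsub : Ioo a b ⊆ Ioo (a - (b - a)) (b + (b - a)) :=
    Ioo_subset_Ioo (by linarith) (by linarith)
  have hfin : ∀ n : ℤ, ‖∫ x in Ioo (a - (b - a)) (b + (b - a)),
      Complex.exp (Complex.I * (-freq a b n : ℝ) * x) * powConv a b P α (U f) x‖ₑ ^ 2
      ≤ ENNReal.ofReal M * ∫⁻ t in Ioi (0 : ℝ), ENNReal.ofReal (t ^ (2 * α - 1)) *
        (‖inner ℂ (mode a b n) (resolventOp (invP T hT) t f)‖ₑ ^ 2
          + ‖inner ℂ (mode a b n) (U (resolventOp (invP T hT) t f))‖ₑ ^ 2) := by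
    intro n
    by_cases h0 : n = 0
    -- The zero frequency, where the oscillatory bound is not available, contributes nothing because
    -- `U f` has mean zero.
    · have h1 : ∫ x in Ioo a b, Complex.exp (Complex.I * (-freq a b n : ℝ) * x) * U f x = 0 := by
        have := mem_meanZero.1 (hm f)
        simpa [h0, freq_zero] using this
      rw [integral_exp_mul_powConv hab hα1 (integrable_L2 (U f)), h1, zero_mul]
      simp
    · have hξ := freq_ne_zero hab h0
      have hξ0 : 0 < |freq a b n| := abs_pos.2 hξ
      refine (pow_le_pow_left' (enorm_integral_exp_mul_powConv_le hab hα0 hα1 P n h0 (U f)) 2).trans ?_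
      rw [mul_pow, ← ENNReal.ofReal_pow (by positivity), mul_pow, ← Real.rpow_natCast (_ ^ _),
        ← Real.rpow_mul hξ0.le, ENNReal.ofReal_mul (by positivity), mul_assoc,
        show (α - 1) * ((2 : ℕ) : ℝ) = 2 * α - 2 by push_cast; ring, hM,
        ENNReal.ofReal_mul (by positivity), mul_assoc]
      exact mul_le_mul_right (enorm_inner_mode_sq_le hα0 hm hU hJ f hξ) _
  have hres := continuousOn_resolventOp hJ hacc f
  have hmeas : ∀ n : ℤ, AEMeasurable (fun t : ℝ => ENNReal.ofReal (t ^ (2 * α - 1)) *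
      (‖inner ℂ (mode a b n) (resolventOp (invP T hT) t f)‖ₑ ^ 2
        + ‖inner ℂ (mode a b n) (U (resolventOp (invP T hT) t f))‖ₑ ^ 2))
      (volume.restrict (Ioi 0)) := by
    intro n
    have h1 : ContinuousOn (fun t : ℝ =>
        (inner ℂ (mode a b n) (resolventOp (invP T hT) t f) : ℂ)) (Ioi 0) :=
      (innerSL ℂ (mode a b n)).continuous.comp_continuousOn hres
    have h2 : ContinuousOn (fun t : ℝ =>
        (inner ℂ (mode a b n) (U (resolventOp (invP T hT) t f)) : ℂ)) (Ioi 0) :=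
      (innerSL ℂ (mode a b n)).continuous.comp_continuousOn (U.continuous.comp_continuousOn hres)
    have h3 := (((h1.aemeasurable (μ := volume) measurableSet_Ioi).enorm).pow_const 2).add
      (((h2.aemeasurable (μ := volume) measurableSet_Ioi).enorm).pow_const 2)
    exact AEMeasurable.mul (f := fun t : ℝ => ENNReal.ofReal (t ^ (2 * α - 1)))
      (Measurable.aemeasurable (by fun_prop)) h3
  have hUn : ∀ h : L2 a b, ‖U h‖ₑ = ‖h‖ₑ := fun h => by rw [← ofReal_norm, hn, ofReal_norm]
  calc ∫⁻ x in Ioo a b, ‖kerFun a b (derivKernel P α 0) (U f) x‖ₑ ^ 2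
      = ∫⁻ x in Ioo a b, ‖powConv a b P α (U f) x‖ₑ ^ 2 := by
        refine setLIntegral_congr_fun measurableSet_Ioo fun x hx => ?_
        simp only [kerFun_eq_powConv hab hP _ hx]
    _ ≤ ∫⁻ x in Ioo (a - (b - a)) (b + (b - a)), ‖powConv a b P α (U f) x‖ₑ ^ 2 :=
        lintegral_mono_set hsub
    _ ≤ ENNReal.ofReal ℓ⁻¹ * ∑' n : ℤ, ENNReal.ofReal M * ∫⁻ t in Ioi (0 : ℝ),
          ENNReal.ofReal (t ^ (2 * α - 1)) *
          (‖inner ℂ (mode a b n) (resolventOp (invP T hT) t f)‖ₑ ^ 2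
            + ‖inner ℂ (mode a b n) (U (resolventOp (invP T hT) t f))‖ₑ ^ 2) := by
        rw [lintegral_sq_eq_tsum hab (memLp_powConv hab hα1 (Lp.memLp (U f)))]
        gcongr with n
        exact hfin n
    -- Summation over `n` under the integral: the frame identity is used for the resolvent and for
    -- its image under `U`, which has the same norm; hence the factor `2ℓ`.
    _ = ENNReal.ofReal ℓ⁻¹ * (ENNReal.ofReal M * ∫⁻ t in Ioi (0 : ℝ),
          ENNReal.ofReal (2 * ℓ) * ENNReal.ofReal (t ^ (2 * α - 1) *
            ‖resolventOp (invP T hT) t f‖ ^ 2)) := by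
        rw [ENNReal.tsum_mul_left, ← lintegral_tsum hmeas]
        congr 2
        refine setLIntegral_congr_fun measurableSet_Ioi fun t ht => ?_
        rw [ENNReal.tsum_mul_left, ENNReal.tsum_add, tsum_inner_mode hab, tsum_inner_mode hab, hUn,
          ← hℓ, ENNReal.ofReal_mul (Real.rpow_nonneg (le_of_lt ht) _),
          ENNReal.ofReal_pow (norm_nonneg _), ofReal_norm, ENNReal.ofReal_mul zero_le_two,
          ENNReal.ofReal_ofNat]
        ring
    _ ≤ ENNReal.ofReal ℓ⁻¹ * (ENNReal.ofReal M * (ENNReal.ofReal (2 * ℓ) *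
          ENNReal.ofReal (α * ‖∫ t in Ioi (0 : ℝ), balaIntegrand (invP T hT) α f t‖ ^ 2))) := by
        rw [lintegral_const_mul' _ _ ENNReal.ofReal_ne_top]
        gcongr
        -- The quadratic estimate is applied to `u = T f`, for which `J u = f`.
        have h := lintegral_sq_resolventOp_le hJ hacc hα0 hα1
          ⟨T f, apply_mem_invP_domain (hT := hT) f⟩
        rwa [invP_apply] at h
    _ = _ := by
        rw [← ENNReal.ofReal_mul (by positivity), ← ENNReal.ofReal_mul (by positivity),
          ← ENNReal.ofReal_mul (by positivity)]
        congr 1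
        ring

end Estimate

/-! ### Multiplication operators on `L²` and `H¹` -/

section Multiplication

variable {a b : ℝ}

/-- Multiplication by a bounded function is a bounded operator on `L²`. -/
theorem exists_clm_mulOp {m : ℝ → ℂ} (hm : MemLp m ⊤ (mu a b)) :
    ∃ M : L2 a b →L[ℂ] L2 a b, ‖M‖ ≤ (eLpNorm m ⊤ (mu a b)).toReal ∧
      (∀ f : L2 a b, M f =ᵐ[mu a b] fun x => m x * f x) ∧
      ∀ f : L2 a b, ∃ h : f ∈ (mulOp a b m).domain, mulOp a b m ⟨f, h⟩ = M f := by
  set C := (eLpNorm m ⊤ (mu a b)).toReal with hC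
  have hmC : ∀ᵐ x ∂(mu a b), ‖m x‖ ≤ C := by
    filter_upwards [ae_le_eLpNormEssSup (f := m) (μ := mu a b)] with x hx
    rw [hC, eLpNorm_exponent_top, ← toReal_enorm]
    exact ENNReal.toReal_mono (by rw [← eLpNorm_exponent_top]; exact hm.2.ne) hx
  have hle : ∀ f : L2 a b, ∀ᵐ x ∂(mu a b), ‖m x * f x‖ ≤ C * ‖f x‖ := fun f => by
    filter_upwards [hmC] with x hx
    rw [norm_mul]
    gcongr
  have hmem : ∀ f : L2 a b, MemLp (fun x => m x * f x) 2 (mu a b) := fun f =>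
    (Lp.memLp f).of_le_mul (hm.1.mul (Lp.memLp f).1) (hle f)
  have hdom : ∀ f : L2 a b, f ∈ (mulOp a b m).domain := fun f =>
    ⟨(hmem f).toLp, (hmem f).coeFn_toLp⟩
  have hspec : ∀ f : L2 a b, mulOp a b m ⟨f, hdom f⟩ =ᵐ[mu a b] fun x => m x * f x := fun f =>
    ofRel_spec (R := fun f g : L2 a b => g =ᵐ[mu a b] fun x => m x * f x) ⟨f, hdom f⟩
  let A : L2 a b →ₗ[ℂ] L2 a b :=
    { toFun := fun f => mulOp a b m ⟨f, hdom f⟩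
      map_add' := fun f g => (mulOp a b m).map_add ⟨f, hdom f⟩ ⟨g, hdom g⟩
      map_smul' := fun c f => (mulOp a b m).map_smul c ⟨f, hdom f⟩ }
  have hA : ∀ f, ‖A f‖ ≤ C * ‖f‖ := fun f => by
    refine Lp.norm_le_mul_norm_of_ae_le_mul ?_
    filter_upwards [hspec f, hle f] with x h1 h2
    change ‖mulOp a b m ⟨f, hdom f⟩ x‖ ≤ _
    rwa [h1]
  exact ⟨A.mkContinuous C hA, A.mkContinuous_norm_le ENNReal.toReal_nonneg hA, hspec,
    fun f => ⟨hdom f, rfl⟩⟩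

theorem memLp_top_of_continuousOn {m : ℝ → ℂ} (hm : ContinuousOn m (Icc a b)) :
    MemLp m ⊤ (mu a b) := by
  obtain ⟨C, hC⟩ := isCompact_Icc.exists_bound_of_continuousOn hm
  exact memLp_top_of_bound ((hm.mono Ioo_subset_Icc_self).aestronglyMeasurable measurableSet_Ioo) C
    ((ae_restrict_iff' measurableSet_Ioo).2 (ae_of_all _ fun x hx => hC x (Ioo_subset_Icc_self hx)))

theorem memLp_top_deriv (hab : a < b) {m : ℝ → ℂ} (hm : ContDiffOn ℝ 1 m (Icc a b)) :
    MemLp (deriv m) ⊤ (mu a b) := by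
  have h := memLp_top_of_continuousOn
    (hm.continuousOn_derivWithin (uniqueDiffOn_Icc hab) le_rfl)
  refine (memLp_congr_ae ?_).1 h
  refine (ae_restrict_iff' measurableSet_Ioo).2 (ae_of_all _ fun x hx => ?_)
  exact derivWithin_of_mem_nhds (Icc_mem_nhds hx.1 hx.2)

/-- `H¹(a, b)` is invariant under multiplication by `C¹` functions. -/
theorem mem_weakDeriv_domain_of_mul (hab : a < b) {m : ℝ → ℂ} (hm : ContDiffOn ℝ 1 m (Icc a b))
    {u w : L2 a b} (hu : u ∈ (weakDeriv a b).domain) (hw : w =ᵐ[mu a b] fun x => m x * u x) :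
    w ∈ (weakDeriv a b).domain := by
  have h := (hasWeakDeriv_weakDeriv hu).mul_contDiffOn hab hm
  set v := weakDeriv a b ⟨u, hu⟩
  obtain ⟨M, -, hM, -⟩ := exists_clm_mulOp (memLp_top_of_continuousOn hm.continuousOn)
  obtain ⟨N, -, hN, -⟩ := exists_clm_mulOp (memLp_top_deriv hab hm)
  refine mem_weakDeriv_domain.2 ⟨N u + M v, h.congr hw.symm ?_⟩
  filter_upwards [hM v, hN u, Lp.coeFn_add (N u) (M v)] with x h1 h2 h3
  rw [h3, Pi.add_apply, h1, h2]

end Multiplication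

/-! ### The adjoint of `U` and weak differentiation -/

section DivergenceForm

variable {a b : ℝ} {T U : L2 a b →L[ℂ] L2 a b}

theorem prim_conj (g : ℝ → ℂ) (x : ℝ) :
    prim a b (fun y => starRingEnd ℂ (g y)) x = starRingEnd ℂ (prim a b g x) := by
  rw [prim, prim]
  exact integral_conj

/-- The adjoint of differentiation on `H¹₀` is minus differentiation on `H¹`. -/
theorem adjoint_apply_of_mem (hab : a < b) (hs : ∀ x y, inner ℂ (T x) y = inner ℂ x (T y))
    (hm : ∀ f, U f ∈ meanZero a b) (hU : ∀ f, primL a b (U f) = T f) {v w : L2 a b}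
    (hv : HasWeakDeriv a b v w) : U.adjoint v = T (-w) := by
  refine ext_inner_left ℂ fun z => ?_
  rw [ContinuousLinearMap.adjoint_inner_right, ← hs, inner_neg_right, inner_eq_integral,
    inner_eq_integral]
  have hg : MemLp (fun x => starRingEnd ℂ (U z x)) 2 (mu a b) := (Lp.memLp (U z)).star
  have h0 : ∫ x in Ioo a b, starRingEnd ℂ (U z x) = 0 := by
    rw [integral_conj, mem_meanZero.1 (hm z), map_zero]
  have h := hv.integral_mul hab hg h0
  have e1 : ∫ x in Ioo a b, starRingEnd ℂ (U z x) * v x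
      = ∫ x in Ioo a b, v x * starRingEnd ℂ (U z x) := by simp_rw [mul_comm]
  rw [e1, h]
  congr 1
  refine integral_congr_ae ?_
  filter_upwards [primL_coe (U z)] with x hx
  rw [prim_conj, ← hx, hU, mul_comm]

/-- The conjugate of `φ'` has mean zero, so it equals `U z` for some `z`, and then `T z` is the
conjugate of `φ`; pairing the hypothesis with `z` is the weak derivative identity. This converse to
`adjoint_apply_of_mem` keeps the domain of `J* G J` from exceeding `H²`. -/
theorem hasWeakDeriv_of_adjoint_eq (hs : ∀ x y, inner ℂ (T x) y = inner ℂ x (T y))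
    (hU : ∀ f, primL a b (U f) = T f) (hr : ∀ g ∈ meanZero a b, ∃ f, U f = g) (hab : a ≤ b)
    {v w : L2 a b} (hv : U.adjoint v = T w) : HasWeakDeriv a b v (-w : L2 a b) := by
  intro φ hφ
  obtain ⟨z, hz⟩ := hr _ (hφ.star.derivL2_mem hab)
  have hTz : T z = hφ.star.toL2 := by rw [← hU, hz, hφ.star.primL_derivL2]
  have h : inner ℂ (U z) v = inner ℂ (T z) w := by
    rw [← ContinuousLinearMap.adjoint_inner_right, hv, hs]
  rw [hz, hTz, inner_eq_integral, inner_eq_integral] at h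
  have e1 : ∫ x in Ioo a b, v x * deriv φ x
      = ∫ x in Ioo a b, starRingEnd ℂ (hφ.star.derivL2 x) * v x := by
    refine integral_congr_ae ?_
    filter_upwards [hφ.star.derivL2_coe] with x hx
    rw [hx, deriv_star]
    simp [mul_comm]
  have e2 : -∫ x in Ioo a b, (-w : L2 a b) x * φ x
      = ∫ x in Ioo a b, starRingEnd ℂ (hφ.star.toL2 x) * w x := by
    rw [← integral_neg]
    refine integral_congr_ae ?_
    filter_upwards [hφ.star.toL2_coe, Lp.coeFn_neg w] with x hx hw
    rw [hx, hw]
    simp [mul_comm]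
  rw [e1, e2, h]

end DivergenceForm

/-! ### Partially defined operators: products, sums, fractional powers -/

section PartialMaps

variable {H : Type*} [NormedAddCommGroup H] [InnerProductSpace ℂ H]

theorem mem_mulP_domain_of_eq {S T : H →ₗ.[ℂ] H} {f g : H} (hg : ∃ h, T ⟨f, h⟩ = g) :
    f ∈ (mulP S T).domain ↔ g ∈ S.domain := by
  obtain ⟨h, rfl⟩ := hg
  exact ⟨fun ⟨_, h'⟩ => h', fun h' => ⟨h, h'⟩⟩

theorem mulP_apply_of_eq {S T : H →ₗ.[ℂ] H} {f g k : H} (hg : ∃ h, T ⟨f, h⟩ = g)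
    (hk : ∃ h, S ⟨g, h⟩ = k) : ∃ h, mulP S T ⟨f, h⟩ = k := by
  obtain ⟨h, rfl⟩ := hg
  obtain ⟨h', rfl⟩ := hk
  exact ⟨⟨h, h'⟩, rfl⟩

theorem add_apply_of_eq {S T : H →ₗ.[ℂ] H} {f g k : H} (hg : ∃ h, S ⟨f, h⟩ = g)
    (hk : ∃ h, T ⟨f, h⟩ = k) : ∃ h, (S + T) ⟨f, h⟩ = g + k := by
  obtain ⟨h, rfl⟩ := hg
  obtain ⟨h', rfl⟩ := hk
  exact ⟨⟨h, h'⟩, rfl⟩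

theorem pmap_eq_of_forall {A B : H →ₗ.[ℂ] H} {S : Submodule ℂ H} (hA : A.domain = S)
    (hB : B.domain = S) (h : ∀ u ∈ S, ∃ v, (∃ h, A ⟨u, h⟩ = v) ∧ ∃ h, B ⟨u, h⟩ = v) : A = B := by
  refine LinearPMap.ext (hA.trans hB.symm) fun u hu hu' => ?_
  obtain ⟨v, ⟨h1, e1⟩, ⟨h2, e2⟩⟩ := h u (hA ▸ hu)
  exact e1.trans e2.symm

/-- For symmetric `T` the orthogonal complement of the range is the kernel. -/
theorem dense_range_of_injective [CompleteSpace H] {T : H →L[ℂ] H}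
    (hT : Function.Injective T) (hs : ∀ x y, inner ℂ (T x) y = inner ℂ x (T y)) :
    Dense ((invP T hT).domain : Set H) := by
  rw [Submodule.dense_iff_topologicalClosure_eq_top, Submodule.topologicalClosure_eq_top_iff,
    Submodule.eq_bot_iff]
  intro x hx
  rw [Submodule.mem_orthogonal] at hx
  apply hT
  rw [map_zero]
  refine ext_inner_left ℂ fun y => ?_
  rw [← hs, inner_zero_right]
  exact hx _ (apply_mem_invP_domain y)

theorem norm_balakrishnan {J : H →ₗ.[ℂ] H} {α : ℝ} (hα0 : 0 < α) (hα1 : α < 1) {f g : H}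
    (hg : ∃ h, J ⟨f, h⟩ = g) (hf : f ∈ (balakrishnan J α).domain) :
    ‖∫ t in Ioi (0 : ℝ), balaIntegrand J α g t‖
      = Real.pi / Real.sin (α * Real.pi) * ‖balakrishnan J α ⟨f, hf⟩‖ := by
  obtain ⟨h, rfl⟩ := hg
  have hsin : 0 < Real.sin (α * Real.pi) :=
    Real.sin_pos_of_pos_of_lt_pi (by positivity) (by nlinarith [Real.pi_pos])
  have e : balakrishnan J α ⟨f, hf⟩ = ((Real.sin (α * Real.pi) / Real.pi : ℝ) : ℂ) •
      ∫ t in Ioi (0 : ℝ), balaIntegrand J α (J ⟨f, h⟩) t := rfl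
  have hpi := Real.pi_pos
  rw [e, norm_smul, Complex.norm_real, Real.norm_eq_abs, abs_of_pos (by positivity)]
  generalize Real.sin (α * Real.pi) = s at hsin
  field_simp

theorem fracPow_apply_of_mem {J : H →ₗ.[ℂ] H} {α : ℝ} {f : H}
    (hf : f ∈ (balakrishnan J α).domain) : ∃ h, fracPow J α ⟨f, h⟩ = balakrishnan J α ⟨f, hf⟩ :=
  ⟨(LinearPMap.le_closure _).1 hf, ((LinearPMap.le_closure _).2 rfl).symm⟩

end PartialMaps

/-! ### Relative bound for the fractional derivative; domains -/

section Bounds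

variable {a b P α σ : ℝ} {T U : L2 a b →L[ℂ] L2 a b} {hT : Function.Injective T}

theorem exists_fracDeriv_bound (hab : a < b) (hP : P = a ∨ P = b) (hα0 : 0 < α) (hα1 : α < 1)
    (hm : ∀ f, U f ∈ meanZero a b) (hU : ∀ f, primL a b (U f) = T f) (hn : ∀ f, ‖U f‖ = ‖f‖)
    (hJ : MAccretive (invP T hT))
    (hacc : ∀ u : (invP T hT).domain, 0 ≤ (inner ℂ (u : L2 a b) (invP T hT u)).re) :
    ∃ C : ℝ, 0 ≤ C ∧ ∀ f : L2 a b, ∃ h : T f ∈ (fracDeriv a b P α).domain,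
      ‖fracDeriv a b P α ⟨T f, h⟩‖ ≤ C * ‖∫ t in Ioi (0 : ℝ), balaIntegrand (invP T hT) α f t‖ := by
  obtain ⟨C, hC0, hC⟩ := exists_lintegral_kerFun_le hab hP hα0 hα1 hm hU hn hJ hacc
  set k := |1 / Real.Gamma (1 - α)| with hk
  refine ⟨k * √C, by positivity, fun f => ?_⟩
  obtain ⟨h, hD⟩ := exists_fracDeriv_eq hab hP hα0 hα1 (mem_meanZero.1 (hm f))
    (u := T f) (by rw [← hU]; exact primL_coe _)
  refine ⟨h, ?_⟩
  set I := ‖∫ t in Ioi (0 : ℝ), balaIntegrand (invP T hT) α f t‖ with hI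
  set X := fracDeriv a b P α ⟨T f, h⟩ with hX
  have h1 : ‖X‖ₑ ^ 2 ≤ ENNReal.ofReal ((k * √C * I) ^ 2) := by
    have e1 : ‖X‖ₑ ^ 2 = ∫⁻ x in Ioo a b, ‖X x‖ₑ ^ 2 := by
      rw [Lp.enorm_def, eLpNorm_two, ← ENNReal.rpow_natCast, ← ENNReal.rpow_mul]
      norm_num
    have e2 : ∫⁻ x in Ioo a b, ‖X x‖ₑ ^ 2 = ENNReal.ofReal (k ^ 2) *
        ∫⁻ x in Ioo a b, ‖kerFun a b (derivKernel P α 0) (U f) x‖ₑ ^ 2 := by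
      rw [← lintegral_const_mul' _ _ ENNReal.ofReal_ne_top]
      refine lintegral_congr_ae ?_
      filter_upwards [hD] with x hx
      rw [hx, enorm_mul, enorm_mul, ← ofReal_norm (sgn a P), norm_sgn, ENNReal.ofReal_one, one_mul,
        mul_pow, ENNReal.ofReal_pow (abs_nonneg _), ← ofReal_norm, Complex.norm_real,
        Real.norm_eq_abs]
    rw [e1, e2]
    refine (mul_le_mul_right (hC f) _).trans_eq ?_
    rw [← ENNReal.ofReal_mul (by positivity), mul_pow, mul_pow, Real.sq_sqrt hC0, mul_assoc]
  rw [← ofReal_norm, ← ENNReal.ofReal_pow (norm_nonneg _),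
    ENNReal.ofReal_le_ofReal_iff (by positivity)] at h1
  exact (sq_le_sq₀ (norm_nonneg _) (by positivity)).1 h1

theorem le_re_inner_mul {c : ℝ → ℂ} {γ : ℝ} (hre : ∀ x ∈ Ioo a b, γ ≤ (c x).re) {g h : L2 a b}
    (hh : h =ᵐ[mu a b] fun x => c x * g x) : γ * ‖g‖ ^ 2 ≤ (inner ℂ g h).re := by
  have hi1 := L2.integrable_inner (𝕜 := ℂ) g g
  have hi2 := L2.integrable_inner (𝕜 := ℂ) g h
  have e0 : ‖g‖ ^ 2 = (inner ℂ g g).re := (inner_self_eq_norm_sq (𝕜 := ℂ) g).symm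
  have e1 : (inner ℂ g g).re = ∫ x in Ioo a b, (inner ℂ (g x) (g x) : ℂ).re := by
    rw [L2.inner_def]
    exact (integral_re hi1).symm
  have e2 : (inner ℂ g h).re = ∫ x in Ioo a b, (inner ℂ (g x) (h x) : ℂ).re := by
    rw [L2.inner_def]
    exact (integral_re hi2).symm
  rw [e0, e1, e2, ← integral_const_mul]
  refine integral_mono_ae (hi1.re.const_mul γ) hi2.re ?_
  filter_upwards [hh, ae_restrict_mem measurableSet_Ioo] with x hx hx'
  have e3 : (inner ℂ (g x) (h x) : ℂ) = c x * ((‖g x‖ ^ 2 : ℝ) : ℂ) := by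
    rw [hx, ← smul_eq_mul, inner_smul_right, inner_self_eq_norm_sq_to_K]
    norm_cast
  have e4 : (inner ℂ (g x) (g x) : ℂ) = ((‖g x‖ ^ 2 : ℝ) : ℂ) := by
    rw [inner_self_eq_norm_sq_to_K]
    norm_cast
  change γ * (inner ℂ (g x) (g x) : ℂ).re ≤ (inner ℂ (g x) (h x) : ℂ).re
  rw [e3, e4, Complex.re_mul_ofReal, Complex.ofReal_re]
  exact mul_le_mul_of_nonneg_right (hre x hx') (by positivity)

theorem weakDeriv_apply_range (hab : a ≤ b) (hU : ∀ f, primL a b (U f) = T f) (f : L2 a b) :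
    ∃ h, weakDeriv a b ⟨T f, h⟩ = U f := by
  have h : HasWeakDeriv a b (T f) (U f) := by
    rw [← hU]
    exact hasWeakDeriv_primL hab _
  exact ⟨⟨_, h⟩, weakDeriv_apply h _⟩

/-- The range of `T` consists of the primitives of the functions `U f`, and `U` maps onto all
mean-zero functions. -/
theorem domain_invP_eq_H10 (hab : a < b) (hm : ∀ f, U f ∈ meanZero a b)
    (hU : ∀ f, primL a b (U f) = T f) (hr : ∀ g ∈ meanZero a b, ∃ f, U f = g) :
    (invP T hT).domain = H10 a b := by
  ext u
  rw [mem_H10_iff hab]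
  constructor
  · rintro ⟨f, rfl⟩
    exact ⟨U f, hm f, hU f⟩
  · rintro ⟨g, hg, rfl⟩
    obtain ⟨f, rfl⟩ := hr g hg
    exact ⟨f, (hU f).symm⟩

/-- By continuity the lower bound on `Re c` extends to the closed interval, so `1 / c` is `C¹` there
as well and multiplication can be undone within `H¹`. -/
theorem mul_mem_weakDeriv_domain_iff (hab : a < b) {c : ℝ → ℂ} {γ : ℝ}
    (hc : ContDiffOn ℝ 1 c (Icc a b)) (hre : ∀ x ∈ Ioo a b, γ ≤ (c x).re) (hγ : 0 < γ)
    {u v : L2 a b} (hv : v =ᵐ[mu a b] fun x => c x * u x) :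
    v ∈ (weakDeriv a b).domain ↔ u ∈ (weakDeriv a b).domain := by
  have hre' : ∀ x ∈ Icc a b, γ ≤ (c x).re := by
    have hcl : closure (Ioo a b) = Icc a b := closure_Ioo hab.ne
    intro x hx
    rw [← hcl] at hx hc
    exact le_on_closure hre continuousOn_const
      (Complex.continuous_re.comp_continuousOn hc.continuousOn) hx
  have hne : ∀ x ∈ Icc a b, c x ≠ 0 := fun x hx h => by
    have := hre' x hx
    rw [h, Complex.zero_re] at this
    linarith
  refine ⟨fun h => ?_, fun h => mem_weakDeriv_domain_of_mul hab hc h hv⟩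
  refine mem_weakDeriv_domain_of_mul hab (hc.inv hne) h ?_
  filter_upwards [hv, ae_restrict_mem measurableSet_Ioo] with x hx hx'
  rw [hx, Pi.inv_apply, inv_mul_cancel_left₀ (hne x (Ioo_subset_Icc_self hx'))]

end Bounds

/-! ### The representation `L = J* G J + F J^α` -/

section Representation

variable {a b P α σ : ℝ} {T U : L2 a b →L[ℂ] L2 a b} {hT : Function.Injective T}

/-- The composition of the fractional integral, a bounded multiplier and the fractional derivative
factors through the fractional power. -/
theorem exists_factor (hab : a < b) (hP : P = a ∨ P = b) (hα0 : 0 < α) (hα1 : α < 1) (hσ0 : 0 ≤ σ)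
    (hm : ∀ f, U f ∈ meanZero a b) (hU : ∀ f, primL a b (U f) = T f) (hn : ∀ f, ‖U f‖ = ‖f‖)
    (hJ : MAccretive (invP T hT))
    (hacc : ∀ u : (invP T hT).domain, 0 ≤ (inner ℂ (u : L2 a b) (invP T hT u)).re) :
    ∃ C : ℝ, 0 ≤ C ∧ ∀ ρ : ℝ → ℂ, MemLp ρ ⊤ (mu a b) → ∃ F : L2 a b →L[ℂ] L2 a b,
      ‖F‖ ≤ C * (eLpNorm ρ ⊤ (mu a b)).toReal ∧ ∀ u ∈ (invP T hT).domain, ∃ v,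
        (∃ h, mulP (fracInt a b P σ) (mulP (mulOp a b ρ) (fracDeriv a b P α)) ⟨u, h⟩ = F v) ∧
        ∃ h, fracPow (invP T hT) α ⟨u, h⟩ = v := by
  obtain ⟨C₁, hC₁, hI⟩ := exists_fracInt_bound (σ := σ) hab.le hP hσ0
  obtain ⟨C₂, hC₂, hD⟩ := exists_fracDeriv_bound hab hP hα0 hα1 hm hU hn hJ hacc
  have hsin : 0 < Real.sin (α * Real.pi) :=
    Real.sin_pos_of_pos_of_lt_pi (by positivity) (by nlinarith [Real.pi_pos])
  have hpi := Real.pi_pos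
  refine ⟨C₁ * (C₂ * (Real.pi / Real.sin (α * Real.pi))), by positivity, fun ρ hρ => ?_⟩
  obtain ⟨M, hMn, -, hM⟩ := exists_clm_mulOp hρ
  set r := (eLpNorm ρ ⊤ (mu a b)).toReal with hr
  have hr0 : 0 ≤ r := ENNReal.toReal_nonneg
  set A := mulP (fracInt a b P σ) (mulP (mulOp a b ρ) (fracDeriv a b P α)) with hA
  have key : ∀ f, ∃ h : T f ∈ A.domain, ‖A ⟨T f, h⟩‖
      ≤ C₁ * (r * (C₂ * ‖∫ t in Ioi (0 : ℝ), balaIntegrand (invP T hT) α f t‖)) := by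
    intro f
    obtain ⟨h1, h1'⟩ := hD f
    obtain ⟨h2, h2'⟩ := hI (M (fracDeriv a b P α ⟨T f, h1⟩))
    obtain ⟨h3, h3'⟩ := mulP_apply_of_eq (mulP_apply_of_eq ⟨h1, rfl⟩ (hM _)) ⟨h2, rfl⟩
    refine ⟨h3, ?_⟩
    rw [h3']
    refine h2'.trans ?_
    gcongr
    refine (M.le_opNorm _).trans ?_
    gcongr
  have hBd := balakrishnan_domain hJ hacc hα0 hα1
  have hAd : (invP T hT).domain ≤ A.domain := by
    rintro _ ⟨f, rfl⟩
    exact (key f).choose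
  -- Douglas' lemma on `D(J)` with the Balakrishnan operator as the dominating one; `π / sin απ`
  -- converts the bare integral into that operator. On `D(J)` the closure `fracPow` takes the same
  -- values.
  obtain ⟨F, hF, hFA⟩ := exists_clm_comp_eq
    (A.toFun.comp (Submodule.inclusion hAd))
    ((balakrishnan (invP T hT) α).toFun.comp (Submodule.inclusion hBd.ge))
    (C := C₁ * (C₂ * (Real.pi / Real.sin (α * Real.pi))) * r) (by positivity) (by
      rintro ⟨_, f, rfl⟩
      obtain ⟨h, hle⟩ := key f
      have hb : T f ∈ (balakrishnan (invP T hT) α).domain := hBd.ge ⟨f, rfl⟩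
      have hnb : ‖∫ t in Ioi (0 : ℝ), balaIntegrand (invP T hT) α f t‖ = _ :=
        norm_balakrishnan hα0 hα1 ⟨apply_mem_invP_domain f, invP_apply f _⟩ hb
      rw [hnb] at hle
      refine hle.trans_eq ?_
      change _ = _ * ‖balakrishnan (invP T hT) α ⟨T f, hb⟩‖
      ring)
  refine ⟨F, hF, fun u hu => ⟨balakrishnan (invP T hT) α ⟨u, hBd.ge hu⟩, ⟨hAd hu, ?_⟩,
    fracPow_apply_of_mem _⟩⟩
  exact (hFA ⟨u, hu⟩).symm

/-- The representation of the operator `L` by the transform of an m-accretive operator. -/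
theorem kipriyanovL_eq_transformZ (hab : a < b) (hs : ∀ x y, inner ℂ (T x) y = inner ℂ x (T y))
    (hm : ∀ f, U f ∈ meanZero a b) (hU : ∀ f, primL a b (U f) = T f)
    (hr : ∀ g ∈ meanZero a b, ∃ f, U f = g) {c ρ : ℝ → ℂ} {γ : ℝ}
    (hc : ContDiffOn ℝ 1 c (Icc a b)) (hre : ∀ x ∈ Ioo a b, γ ≤ (c x).re) (hγ : 0 < γ)
    {M F : L2 a b →L[ℂ] L2 a b} (hM : ∀ f : L2 a b, M f =ᵐ[mu a b] fun x => c x * f x)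
    (hMc : ∀ f, ∃ h, mulOp a b c ⟨f, h⟩ = M f)
    (hF : ∀ u ∈ (invP T hT).domain, ∃ v,
      (∃ h, mulP (fracInt a b P σ) (mulP (mulOp a b ρ) (fracDeriv a b P α)) ⟨u, h⟩ = F v) ∧
      ∃ h, fracPow (invP T hT) α ⟨u, h⟩ = v) :
    (kipriyanovL a b P α σ c ρ).domain = H2 a b ⊓ H10 a b ∧
      kipriyanovL a b P α σ c ρ = transformZ α
        ((U.adjoint.comp (M.comp U) : L2 a b →ₗ[ℂ] L2 a b).toPMap ⊤) F (invP T hT) := by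
  have hdom := domain_invP_eq_H10 (hT := hT) hab hm hU hr
  have hadj := adjoint_invP (hT := hT) hs (dense_range_of_injective hT hs)
  set J := invP T hT with hJdef
  set G := (U.adjoint.comp (M.comp U) : L2 a b →ₗ[ℂ] L2 a b).toPMap ⊤ with hG
  have hwd := weakDeriv_apply_range hab.le hU
  have hE : ∀ f, ∃ h, mulP (mulOp a b c) (weakDeriv a b) ⟨T f, h⟩ = M (U f) := fun f =>
    mulP_apply_of_eq (hwd f) (hMc _)
  -- Since `U f` is the derivative of `T f`, this says that `u'` lies in `H¹` exactly when `c u'`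
  -- does.
  have hH2 : ∀ f, T f ∈ H2 a b ↔ M (U f) ∈ (weakDeriv a b).domain := fun f =>
    (mem_mulP_domain_of_eq (hwd f)).trans (mul_mem_weakDeriv_domain_iff hab hc hre hγ (hM _)).symm
  have hGJ : ∀ f, ∃ h, mulP G J ⟨T f, h⟩ = U.adjoint (M (U f)) := fun f =>
    mulP_apply_of_eq ⟨apply_mem_invP_domain f, invP_apply f _⟩ ⟨trivial, rfl⟩
  have hdiv : ∀ f, T f ∈ H2 a b → ∃ w, (∃ h, mulP (weakDeriv a b)
      (mulP (mulOp a b c) (weakDeriv a b)) ⟨T f, h⟩ = w) ∧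
      ∃ h, mulP J.adjoint (mulP G J) ⟨T f, h⟩ = -w := by
    intro f hf
    have h1 := (hH2 f).1 hf
    refine ⟨weakDeriv a b ⟨_, h1⟩, mulP_apply_of_eq (hE f) ⟨h1, rfl⟩,
      mulP_apply_of_eq (hGJ f) ?_⟩
    rw [hadj, adjoint_apply_of_mem hab hs hm hU (hasWeakDeriv_weakDeriv h1)]
    exact ⟨apply_mem_invP_domain _, invP_apply _ _⟩
  have hH10 : ∀ u ∈ H10 a b, ∃ f, T f = u := fun u hu => by
    rw [← hdom] at hu
    exact hu
  have hval : ∀ u ∈ H2 a b ⊓ H10 a b, ∃ w v,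
      (∃ h, mulP (weakDeriv a b) (mulP (mulOp a b c) (weakDeriv a b)) ⟨u, h⟩ = w) ∧
      (∃ h, mulP J.adjoint (mulP G J) ⟨u, h⟩ = -w) ∧
      (∃ h, mulP (fracInt a b P σ) (mulP (mulOp a b ρ) (fracDeriv a b P α)) ⟨u, h⟩ = F v) ∧
      ∃ h, fracPow J α ⟨u, h⟩ = v := by
    rintro u ⟨h2, h10⟩
    obtain ⟨f, rfl⟩ := hH10 u h10
    obtain ⟨w, hw1, hw2⟩ := hdiv f h2
    obtain ⟨v, hv1, hv2⟩ := hF (T f) (apply_mem_invP_domain f)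
    exact ⟨w, v, hw1, hw2, hv1, hv2⟩
  have hL : (kipriyanovL a b P α σ c ρ).domain = H2 a b ⊓ H10 a b := by
    refine inf_eq_left.2 fun u hu => ?_
    obtain ⟨w, v, ⟨h1, -⟩, -, ⟨h2, -⟩, -⟩ := hval u hu
    exact ⟨h1, h2⟩
  -- Only `J* G J` restricts the domain: the fractional power is defined on all of `D(J) = H¹₀`. As
  -- `J* = J`, the condition is that `U* (c u')` lie in the range of `T`, which forces `c u'` into
  -- `H¹`.
  have hZ : (transformZ α G F J).domain = H2 a b ⊓ H10 a b := by
    refine le_antisymm ?_ fun u hu => ?_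
    · rintro u ⟨h1, -⟩
      have huJ : u ∈ J.domain := h1.choose.choose
      obtain ⟨f, rfl⟩ : ∃ f, T f = u := huJ
      have h2 : U.adjoint (M (U f)) ∈ J.adjoint.domain := (mem_mulP_domain_of_eq (hGJ f)).1 h1
      rw [hadj] at h2
      obtain ⟨w, hw⟩ : ∃ w, T w = U.adjoint (M (U f)) := h2
      refine ⟨(hH2 f).2 ⟨_, hasWeakDeriv_of_adjoint_eq hs hU hr hab.le hw.symm⟩, ?_⟩
      rw [← hdom]
      exact apply_mem_invP_domain f
    · obtain ⟨w, v, -, ⟨h1, -⟩, -, ⟨h2, -⟩⟩ := hval u hu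
      exact ⟨h1, h2⟩
  refine ⟨hL, pmap_eq_of_forall hL hZ fun u hu => ?_⟩
  obtain ⟨w, v, ⟨h1, e1⟩, h2, ⟨h3, e3⟩, ⟨h4, e4⟩⟩ := hval u hu
  refine ⟨-w + F v, ⟨hL.ge hu, ?_⟩, add_apply_of_eq h2 ⟨h4, ?_⟩⟩
  · rw [← e1, ← e3]
    exact LinearPMap.domRestrict_apply (x := ⟨u, hL.ge hu⟩) (y := ⟨u, h1, h3⟩) rfl
  · rw [← e4]
    rfl

end Representation

end FracOp

end

/-! ### The corollary -/

theorem mainTheorem4 (a b P α σ : ℝ) (hab : a < b) (hP : P = a ∨ P = b)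
    (hα0 : 0 < α) (hα1 : α < 1) (hσ0 : 0 ≤ σ) (hσ1 : σ < 1) :
    ∃ K : ℝ, 0 < K ∧ ∀ (c ρ : ℝ → ℂ) (γ : ℝ),
      ContDiffOn ℝ 2 c (Set.Icc a b) →
      (∀ x ∈ Set.Ioo a b, γ ≤ (c x).re) →
      0 < γ →
      MeasureTheory.MemLp ρ ⊤ (FracOp.mu a b) →
      K * (MeasureTheory.eLpNorm ρ ⊤ (FracOp.mu a b)).toReal < γ →
      (FracOp.kipriyanovL a b P α σ c ρ).domain = FracOp.H2 a b ⊓ FracOp.H10 a b ∧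
      FracOp.ClassG α (FracOp.kipriyanovL a b P α σ c ρ) := by
  obtain ⟨T, U, hT, hs, hpos, hcomp, hm, hU, hn, hr⟩ := FracOp.exists_sqrt_dirichlet hab
  have hJ := FracOp.mAccretive_invP (hT := hT) hpos (FracOp.dense_range_of_injective hT hs)
  obtain ⟨C, hC0, hF⟩ := FracOp.exists_factor (σ := σ) hab hP hα0 hα1 hσ0 hm hU hn hJ
    (FracOp.re_inner_invP_nonneg hpos)
  have h1α : 0 < 1 - α := by linarith
  set D := (2 * α⁻¹ * ‖T‖ + (1 - α)⁻¹) * ‖T‖ with hD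
  have hD0 : 0 ≤ D := by positivity
  -- `D` is `C_α ‖J⁻¹‖` and `‖F‖ ≤ C ‖ρ‖`, so `D * C` already suffices; the summand `1` only makes
  -- `K` positive.
  refine ⟨D * C + 1, by positivity, fun c ρ γ hc hre hγ hρ hK => ?_⟩
  have hc1 : ContDiffOn ℝ 1 c (Set.Icc a b) := hc.of_le (by norm_num)
  obtain ⟨F, hFn, hFu⟩ := hF ρ hρ
  obtain ⟨M, -, hM, hMc⟩ := FracOp.exists_clm_mulOp
    (FracOp.memLp_top_of_continuousOn hc.continuousOn)
  obtain ⟨hdom, hrep⟩ := FracOp.kipriyanovL_eq_transformZ (P := P) (σ := σ) (α := α) (hT := hT)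
    hab hs hm hU hr hc1 hre hγ hM hMc hFu
  refine ⟨hdom, FracOp.invP T hT,
    (U.adjoint.comp (M.comp U) : FracOp.L2 a b →ₗ[ℂ] FracOp.L2 a b).toPMap ⊤, F, T, γ, hJ,
    FracOp.isResolvent_invP, hcomp, ?_, fun _ => trivial, hγ, ?_, ?_, hrep⟩
  · exact ⟨‖U.adjoint.comp (M.comp U)‖, fun f => (U.adjoint.comp (M.comp U)).le_opNorm f⟩
  · intro f
    -- The form of `G` at `f` is the form of multiplication by `c` at `U f`, and `‖U f‖ = ‖f‖`, so
    -- the lower bound `γ` passes to `G` without loss.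
    have h1 : inner ℂ (f : FracOp.L2 a b) (U.adjoint (M (U f)))
        = inner ℂ (U f) (M (U f)) := ContinuousLinearMap.adjoint_inner_right _ _ _
    have h2 := FracOp.le_re_inner_mul hre (hM (U f))
    rw [hn, ← h1] at h2
    exact h2
  · set r := (MeasureTheory.eLpNorm ρ ⊤ (FracOp.mu a b)).toReal with hr
    have hr0 : 0 ≤ r := ENNReal.toReal_nonneg
    calc D * ‖F‖ ≤ D * (C * r) := by gcongr
      _ ≤ (D * C + 1) * r := by nlinarith
      _ < γ := hK
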